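/- Let $F$ be a totally real number field, $\mathcal O$ its ring of integers, $\mathbb A$ its adele ring, $|\cdot|$ the adelic absolute value and $\Psi=\prod_v\Psi_v$ the standard additive character of $\mathbb A$: $\Psi_v(x)=\exp(2i\pi x)$ for $v$ infinite, $\Psi_v(x)=\exp(-2i\pi\,\mathrm{Tr}_{F_v/\mathbb Q_p}(x))$ for $v\mid p$ finite (with $\exp(-2i\pi y)=\exp(-2i\pi r)$ if $y\in r+\mathbb Z_p$, $r\in\mathbb Z[1/p]$). Let $du=\prod_v du_v$ be the self-dual Haar measure on $\mathbb A$ (Lebesgue measure at the infinite places, $\mathrm{vol}(\mathcal O_v)=N(\mathfrak d_v)^{-1/2}$ at the finite places, with $\mathfrak d$ the different), and $d^\times t=\prod_v d^\times t_v$ the Haar measure on $\mathbb A^\times$ with $d^\times t_v=dt/|t|$ for $v$ infinite and $\mathrm{vol}(\mathcal O_v^\times)=\mathrm{vol}(\mathcal O_v)$ for $v$ finite; $\mathbb A/F$ and $\mathbb A^\times/F^\times$ carry the quotient measures. Let $\omega$ be a unitary Hecke character of $F$ with local components $\omega_v$, let $s\in\mathbb C$ with $\mathrm{Re}(s)>1$,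 and let $\varphi$ be a Schwartz-Bruhat function on $\mathbb A^2$. For $g\in\mathrm{GL}_2(\mathbb A)$ put $(g\varphi)(x)=\varphi(g^{-1}x)$, $\Theta(\varphi)(g)=\sum_{v\in F^2\setminus\{0\}}(g\varphi)(v)$, $$E(g)=|\det g|^{-s}\int_{\mathbb A^\times/F^\times}\omega(t)|t|^{2s}\,\Theta(\varphi)(g/t)\,d^\times t,$$ $$a_\xi(g)=\int_{\mathbb A/F}E\left(\begin{pmatrix}1&u\\0&1\end{pmatrix}g\right)\Psi(-\xi u)\,du\qquad(\xi\in F).$$ 1. For every $\xi\in F^\times$ and every $g\in\mathrm{GL}_2(\mathbb A)$, $\displaystyle a_\xi(g)=a_1\left(\begin{pmatrix}\xi&0\\0&1\end{pmatrix}g\right)$. 2. For every $g\in\mathrm{GL}_2(\mathbb A)$, $$a_1(g)=|\det g|^{-s}\int_{\mathbb A\times\mathbb A^\times}\omega(t)|t|^{2s}\,(g\varphi)\left(t\binom u1\right)\Psi(u)\,du\,d^\times t,$$ and the integral converges absolutely. 3. Suppose that $\varphi=\bigotimes_v\varphi_v$ is a pure tensor, i.e. $\varphi(x)=\prod_v\varphi_v(x_v)$,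 where $\varphi_v$ is a Schwartz function on $F_v^2=\mathbb R^2$ for $v$ infinite, $\varphi_v$ is locally constant with compact support on $F_v^2$ for $v$ finite, and $\varphi_v$ is the characteristic function of $\mathcal O_v^2$ for almost all $v$. Then, for every $g\in\mathrm{GL}_2(\mathbb A)$, the local integrals $$a_{1,v}(g_v)=|\det g_v|_v^{-s}\int_{F_v\times F_v^\times}\omega_v(t)|t|_v^{2s}\,(g_v\varphi_v)\left(t\binom u1\right)\Psi_v(u)\,du_v\,d^\times t_v$$ converge absolutely, are equal to $1$ for almost all $v$, and $a_1(g)=\prod_v a_{1,v}(g_v)$. -/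

import Mathlib

open NumberField IsDedekindDomain MeasureTheory Matrix
open scoped SchwartzMap MatrixGroups

noncomputable section

namespace EisensteinWhittaker

/-! ### Functions on `R²`, for an arbitrary commutative ring `R` -/

section General

/-- The left action `(gφ)(x) = φ(g⁻¹ x)` of `GL₂(R)` on functions on column vectors. -/
def act {R : Type*} [CommRing R] (g : GL (Fin 2) R) (φ : (Fin 2 → R) → ℂ) : (Fin 2 → R) → ℂ :=
  fun x => φ (((g⁻¹ : GL (Fin 2) R) : Matrix (Fin 2) (Fin 2) R) *ᵥ x)

/-- The matrix `(t 0; 0 1)`. -/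
def diagOne {R : Type*} [CommRing R] (t : Rˣ) : GL (Fin 2) R where
  val := !![(t : R), 0; 0, 1]
  inv := !![((t⁻¹ : Rˣ) : R), 0; 0, 1]
  val_inv := by ext i j; fin_cases i <;> fin_cases j <;> simp
  inv_val := by ext i j; fin_cases i <;> fin_cases j <;> simp

/-- The function `(u, t) ↦ χ(t) |t|^{2s} (gφ)(t (u, 1)) ψ(u)` on `R × Rˣ`, where `nm` is the
absolute value `|·|` of `R`. -/
def whittakerIntegrand {R : Type*} [CommRing R] (nm : R → ℝ) (ψ : R → ℂ) (χ : Rˣ → ℂ) (s : ℂ)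
    (φ : (Fin 2 → R) → ℂ) (g : GL (Fin 2) R) : R × Rˣ → ℂ :=
  fun p => χ p.2 * ((nm (p.2 : R) : ℝ) : ℂ) ^ (2 * s) *
    act g φ ((p.2 : R) • ![p.1, 1]) * ψ p.1

/-- `|det g|^{-s} ∫_{R × Rˣ} χ(t) |t|^{2s} (gφ)(t (u, 1)) ψ(u) du dˣt`, for measures `μ = du` on `R`
and `ν = dˣt` on `Rˣ`. -/
def whittakerIntegral {R : Type*} [CommRing R] [MeasurableSpace R] (nm : R → ℝ) (ψ : R → ℂ)
    (χ : Rˣ → ℂ) (μ : Measure R) (ν : Measure Rˣ) (s : ℂ)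
    (φ : (Fin 2 → R) → ℂ) (g : GL (Fin 2) R) : ℂ :=
  ((nm (g : Matrix (Fin 2) (Fin 2) R).det : ℝ) : ℂ) ^ (-s) *
    ∫ p : R × Rˣ, whittakerIntegrand nm ψ χ s φ g p ∂(μ.prod ν)

/-- The Haar measure of `G` that gives the set `S` the volume `c` (unique, for `G` locally compact
and second countable, as soon as `S` has finite nonzero Haar measure and `0 < c < ∞`). -/
def haarWith (G : Type*) [Group G] [TopologicalSpace G] [MeasurableSpace G] (S : Set G)
    (c : ENNReal) : Measure G :=
  Classical.epsilon fun μ : Measure G => μ.IsHaarMeasure ∧ μ S = c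

/-- Additive version of `haarWith`. -/
def addHaarWith (G : Type*) [AddGroup G] [TopologicalSpace G] [MeasurableSpace G] (S : Set G)
    (c : ENNReal) : Measure G :=
  Classical.epsilon fun μ : Measure G => μ.IsAddHaarMeasure ∧ μ S = c

open scoped Classical in
/-- `∫_{G/Γ} f dμ` for a `Γ`-invariant function `f` on `G` and a discrete subgroup `Γ`: the integral
of `f` over a fundamental domain of `Γ` (it does not depend on the fundamental domain). -/
def quotientIntegral {G : Type*} [Group G] [MeasurableSpace G] (Γ : Subgroup G) (μ : Measure G)
    (f : G → ℂ) : ℂ :=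
  if h : ∃ D : Set G, IsFundamentalDomain Γ D μ then ∫ x in h.choose, f x ∂μ else 0

open scoped Classical in
/-- Additive version of `quotientIntegral`. -/
def addQuotientIntegral {G : Type*} [AddGroup G] [MeasurableSpace G] (Γ : AddSubgroup G)
    (μ : Measure G) (f : G → ℂ) : ℂ :=
  if h : ∃ D : Set G, IsAddFundamentalDomain Γ D μ then ∫ x in h.choose, f x ∂μ else 0

end General

/-! ### Places, adeles and ideles of a number field -/

section Adeles

variable (F : Type*) [Field F] [NumberField F]

/-- The adele ring of `F`. -/
abbrev Adele : Type _ := AdeleRing (𝓞 F) F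

instance : MeasurableSpace (Adele F) := borel _
instance : BorelSpace (Adele F) := ⟨rfl⟩

instance (v : InfinitePlace F) : MeasurableSpace v.Completion := borel _
instance (v : InfinitePlace F) : BorelSpace v.Completion := ⟨rfl⟩

instance (v : HeightOneSpectrum (𝓞 F)) : MeasurableSpace (v.adicCompletion F) := borel _
instance (v : HeightOneSpectrum (𝓞 F)) : BorelSpace (v.adicCompletion F) := ⟨rfl⟩

variable {F}

/-- The component `x ↦ x_v` of an adele at an infinite place. -/
def infEval (v : InfinitePlace F) : Adele F →+* v.Completion where
  toFun x := x.1 v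
  map_one' := rfl
  map_mul' _ _ := rfl
  map_zero' := rfl
  map_add' _ _ := rfl

/-- The component `x ↦ x_v` of an adele at a finite place. -/
def finEval (v : HeightOneSpectrum (𝓞 F)) : Adele F →+* v.adicCompletion F where
  toFun x := x.2 v
  map_one' := rfl
  map_mul' _ _ := rfl
  map_zero' := rfl
  map_add' _ _ := rfl

open scoped Classical in
/-- The idele with component `t` at the infinite place `v` and `1` elsewhere. -/
def infIdele (v : InfinitePlace F) : v.Completionˣ →* (Adele F)ˣ :=
  Units.map
    { toFun := fun x => ((Pi.mulSingle v x : ∀ w : InfinitePlace F, w.Completion), 1)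
      map_one' := Prod.ext (Pi.mulSingle_one v) rfl
      map_mul' := fun x y => Prod.ext (Pi.mulSingle_mul v x y) (mul_one _).symm }

open scoped Classical in
/-- The idele with component `t` at the finite place `v` and `1` elsewhere. -/
def finIdele (v : HeightOneSpectrum (𝓞 F)) : (v.adicCompletion F)ˣ →* (Adele F)ˣ :=
  Units.map
    { toFun := fun x => (1, RestrictedProduct.mulSingle
        (fun w : HeightOneSpectrum (𝓞 F) => w.adicCompletionIntegers F) v x)
      map_one' := Prod.ext rfl (RestrictedProduct.mulSingle_one _ v)
      map_mul' := fun x y => Prod.ext (mul_one _).symm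
        (RestrictedProduct.mulSingle_mul _ v x y) }

/-- The adelic absolute value `|x| = ∏_v |x_v|_v`. -/
def adeleNorm (x : Adele F) : ℝ :=
  (∏ v : InfinitePlace F, ‖infEval v x‖ ^ v.mult) *
    ∏ᶠ v : HeightOneSpectrum (𝓞 F), ‖finEval v x‖

variable (F)

/-- The principal ideles `Fˣ ⊆ 𝔸ˣ`. -/
def principalIdeles : Subgroup (Adele F)ˣ := (Units.map (algebraMap F (Adele F)).toMonoidHom).range

end Adeles

section TotallyReal

variable {F : Type*} [Field F] [NumberField F]

/-! ### The standard additive character -/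

/-- The closure of `ℚ` in the completion `F_v` at a finite place `v ∣ p`, that is, `ℚ_p`. -/
def padicSubfield (v : HeightOneSpectrum (𝓞 F)) : Subfield (v.adicCompletion F) :=
  (⊥ : Subfield (v.adicCompletion F)).topologicalClosure

/-- The trace `Tr_{F_v/ℚ_p}`. -/
def localTrace (v : HeightOneSpectrum (𝓞 F)) (x : v.adicCompletion F) : v.adicCompletion F :=
  (Algebra.trace (padicSubfield v) (v.adicCompletion F) x : padicSubfield v)

open scoped Classical in
/-- `exp(-2iπ y)` for `y ∈ ℚ_p ⊆ F_v`, through the fractional part of `y`: if `r ∈ ℤ[1/p]` and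
`y - r ∈ ℤ_p` then `exp(-2iπ y)` means `exp(-2iπ r)`, which does not depend on `r`.
(The norm of the prime ideal `v` is a power of `p`.) -/
def padicExp (v : HeightOneSpectrum (𝓞 F)) (y : v.adicCompletion F) : ℂ :=
  if h : ∃ r : ℚ, (∃ n : ℕ, r.den ∣ Ideal.absNorm v.asIdeal ^ n) ∧
      y - (r : v.adicCompletion F) ∈ v.adicCompletionIntegers F
  then Complex.exp (-2 * Complex.I * Real.pi * (h.choose : ℂ)) else 1

/-- The additive character `x ↦ exp(-2iπ Tr_{F_v/ℚ_p} x)` of `F_v`, for `v ∣ p` finite. -/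
def finChar (v : HeightOneSpectrum (𝓞 F)) (x : v.adicCompletion F) : ℂ :=
  padicExp v (localTrace v x)

/-- The identification of the completion at an infinite place with `ℝ`. -/
def realEmb [IsTotallyReal F] (v : InfinitePlace F) : v.Completion →+* ℝ :=
  InfinitePlace.Completion.extensionEmbeddingOfIsReal (IsTotallyReal.isReal v)

/-- The additive character `x ↦ exp(2iπ x)` of `F_v = ℝ`, for `v` infinite. -/
def infChar [IsTotallyReal F] (v : InfinitePlace F) (x : v.Completion) : ℂ :=
  Complex.exp (2 * Complex.I * Real.pi * (realEmb v x : ℂ))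

/-- The standard additive character `Ψ` of the adeles, a product over all places. -/
def adeleChar [IsTotallyReal F] (x : Adele F) : ℂ :=
  (∏ v : InfinitePlace F, infChar v (infEval v x)) *
    ∏ᶠ v : HeightOneSpectrum (𝓞 F), finChar v (finEval v x)

/-! ### Haar measures -/

/-- The volume `(N 𝔡_v)^{-1/2}` of the ring of integers of `F_v` for the self-dual measure, where
`𝔡_v` is the `v`-part of the different of `F`. -/
def integersVolume (v : HeightOneSpectrum (𝓞 F)) : ENNReal :=
  ENNReal.ofReal
    ((Ideal.absNorm (v.maxPowDividing (differentIdeal ℤ (𝓞 F))) : ℝ) ^ (-(1 / 2) : ℝ))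

/-- The self-dual measure of `F_v` for `v` finite. -/
def finMeasure (v : HeightOneSpectrum (𝓞 F)) : Measure (v.adicCompletion F) :=
  addHaarWith _ {x | ‖x‖ ≤ 1} (integersVolume v)

/-- The multiplicative measure of `F_v` for `v` finite: `(1 - q_v⁻¹)⁻¹ dx / |x|`, which gives the
units the same volume as `dx` gives to the integers. -/
def finMulMeasure (v : HeightOneSpectrum (𝓞 F)) : Measure (v.adicCompletion F)ˣ :=
  haarWith _ {x | ‖(x : v.adicCompletion F)‖ = 1} (integersVolume v)

/-- Lebesgue measure on `F_v = ℝ` for `v` infinite: `[-1, 1]` has volume `2`. -/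
def infMeasure (v : InfinitePlace F) : Measure v.Completion :=
  addHaarWith _ {x | ‖x‖ ≤ 1} 2

/-- The measure `dx / |x|` on `F_vˣ = ℝˣ` for `v` infinite: `{x | 1 ≤ |x| ≤ e}` has volume `2`. -/
def infMulMeasure (v : InfinitePlace F) : Measure v.Completionˣ :=
  haarWith _ {x | 1 ≤ ‖(x : v.Completion)‖ ∧ ‖(x : v.Completion)‖ ≤ Real.exp 1} 2

variable (F)

/-- The measure `du = ∏_v du_v` of the adeles, which is the self-dual one: the Haar measure that
gives a box the product of its local volumes. -/
def adeleMeasure : Measure (Adele F) :=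
  addHaarWith _
    {x | (∀ v : InfinitePlace F, ‖infEval v x‖ ≤ 1) ∧
      ∀ v : HeightOneSpectrum (𝓞 F), ‖finEval v x‖ ≤ 1}
    ((∏ _v : InfinitePlace F, 2) * ∏ᶠ v : HeightOneSpectrum (𝓞 F), integersVolume v)

/-- The measure `dˣt = ∏_v dˣt_v` of the ideles: the Haar measure that gives a box the product of
its local volumes. -/
def ideleMeasure : Measure (Adele F)ˣ :=
  haarWith _
    {x | (∀ v : InfinitePlace F, 1 ≤ ‖infEval v (x : Adele F)‖ ∧
        ‖infEval v (x : Adele F)‖ ≤ Real.exp 1) ∧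
      ∀ v : HeightOneSpectrum (𝓞 F), ‖finEval v (x : Adele F)‖ = 1}
    ((∏ _v : InfinitePlace F, 2) * ∏ᶠ v : HeightOneSpectrum (𝓞 F), integersVolume v)

/-! ### Schwartz-Bruhat functions -/

/-- The Schwartz-Bruhat space `𝒮(𝔸²)`: the span of the functions `x ↦ φ_f(x_f) φ_∞(x_∞)` with `φ_f`
locally constant with compact support and `φ_∞` a Schwartz function. -/
def SchwartzBruhat [IsTotallyReal F] : Submodule ℂ ((Fin 2 → Adele F) → ℂ) :=
  Submodule.span ℂ
    {φ | ∃ (φf : (Fin 2 → FiniteAdeleRing (𝓞 F) F) → ℂ)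
        (φinf : 𝓢(Fin 2 → InfinitePlace F → ℝ, ℂ)),
      IsLocallyConstant φf ∧ HasCompactSupport φf ∧
      ∀ x, φ x = φf (fun i => (x i).2) * φinf (fun i v => realEmb v (infEval v (x i)))}

variable {F}

/-- `φ` is the pure tensor `⊗_v φ_v`: each `φ_v` is a Schwartz-Bruhat function on `F_v²`, almost all
of them are the characteristic function of the integral vectors, and `φ(x) = ∏_v φ_v(x_v)`. -/
structure IsPureTensor [IsTotallyReal F] (φ : (Fin 2 → Adele F) → ℂ)
    (φinf : ∀ v : InfinitePlace F, (Fin 2 → v.Completion) → ℂ)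
    (φfin : ∀ v : HeightOneSpectrum (𝓞 F), (Fin 2 → v.adicCompletion F) → ℂ) : Prop where
  schwartz : ∀ v, ∃ f : 𝓢(Fin 2 → ℝ, ℂ), ∀ x, φinf v x = f (fun i => realEmb v (x i))
  locallyConstant : ∀ v, IsLocallyConstant (φfin v)
  compactSupport : ∀ v, HasCompactSupport (φfin v)
  unramified : ∀ᶠ v in Filter.cofinite,
    φfin v = Set.indicator {x | ∀ i, x i ∈ v.adicCompletionIntegers F} 1
  eq_prod : ∀ x, φ x = (∏ v, φinf v (fun i => infEval v (x i))) *
    ∏ᶠ v, φfin v (fun i => finEval v (x i))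

/-! ### The Eisenstein series and its Fourier coefficients -/

/-- `Θ(φ)(g) = ∑_{v ∈ F² ∖ {0}} (gφ)(v)`. -/
def theta (φ : (Fin 2 → Adele F) → ℂ) (g : GL (Fin 2) (Adele F)) : ℂ :=
  ∑' v : {v : Fin 2 → F // v ≠ 0}, act g φ (fun i => algebraMap F (Adele F) (v.1 i))

/-- The Eisenstein series
`E(g) = |det g|^{-s} ∫_{𝔸ˣ/Fˣ} ω(t) |t|^{2s} Θ(φ)(g/t) dˣt`. -/
def eisenstein (ω : (Adele F)ˣ →ₜ* Circle) (s : ℂ) (φ : (Fin 2 → Adele F) → ℂ)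
    (g : GL (Fin 2) (Adele F)) : ℂ :=
  ((adeleNorm (g : Matrix (Fin 2) (Fin 2) (Adele F)).det : ℝ) : ℂ) ^ (-s) *
    quotientIntegral (principalIdeles F) (ideleMeasure F) fun t =>
      (ω t : ℂ) * ((adeleNorm (t : Adele F) : ℝ) : ℂ) ^ (2 * s) *
        theta φ (GeneralLinearGroup.scalar (Fin 2) t⁻¹ * g)

/-- The Fourier coefficient `a_ξ(g) = ∫_{𝔸/F} E((1 u; 0 1) g) Ψ(-ξu) du` of the Eisenstein series;
`a_1` is its Whittaker function. -/
def fourierCoeff [IsTotallyReal F] (ω : (Adele F)ˣ →ₜ* Circle) (s : ℂ)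
    (φ : (Fin 2 → Adele F) → ℂ) (ξ : F) (g : GL (Fin 2) (Adele F)) : ℂ :=
  addQuotientIntegral (AdeleRing.principalSubgroup (𝓞 F) F) (adeleMeasure F) fun u =>
    eisenstein ω s φ (GeneralLinearGroup.upperRightHom u * g) *
      adeleChar (-(algebraMap F (Adele F) ξ * u))

/-! ### The local and global data of the Whittaker integrals -/

/-- The local component `ω_v` of `ω` at an infinite place. -/
def infComponent (ω : (Adele F)ˣ →ₜ* Circle) (v : InfinitePlace F) (t : v.Completionˣ) : ℂ :=
  (ω (infIdele v t) : ℂ)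

/-- The local component `ω_v` of `ω` at a finite place. -/
def finComponent (ω : (Adele F)ˣ →ₜ* Circle) (v : HeightOneSpectrum (𝓞 F))
    (t : (v.adicCompletion F)ˣ) : ℂ :=
  (ω (finIdele v t) : ℂ)

end TotallyReal

end EisensteinWhittaker

end

open EisensteinWhittaker

namespace EisensteinWhittaker

section FinitePlaces

variable {F : Type*} [Field F] [NumberField F] (v : HeightOneSpectrum (𝓞 F))

instance countable_numberField : Countable F :=
  (Module.finBasis ℚ F).equivFun.toEquiv.injective.countable

instance countable_heightOneSpectrum : Countable (HeightOneSpectrum (𝓞 F)) := by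
  have h : ∀ I : Ideal (𝓞 F), ∃ s : Finset (𝓞 F), Ideal.span (s : Set (𝓞 F)) = I := fun I =>
    (isNoetherian_def.1 inferInstance I : I.FG)
  choose f hf using h
  have : Countable (𝓞 F) := (RingOfIntegers.coe_injective (K := F)).countable
  exact Function.Injective.countable (f := fun v : HeightOneSpectrum (𝓞 F) => f v.asIdeal)
    fun v w h => HeightOneSpectrum.ext (by rw [← hf v.asIdeal, ← hf w.asIdeal]; exact congrArg _ (congrArg _ h))

/-- The cardinality of the residue field at `v`. -/
noncomputable def residueCard : ℝ := (Ideal.absNorm v.asIdeal : ℝ)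

theorem one_lt_residueCard : 1 < residueCard v := by
  unfold residueCard
  exact_mod_cast NumberField.HeightOneSpectrum.one_lt_absNorm v

theorem residueCard_pos : 0 < residueCard v := zero_lt_one.trans (one_lt_residueCard v)

theorem norm_le_one_iff (x : v.adicCompletion F) :
    ‖x‖ ≤ 1 ↔ x ∈ v.adicCompletionIntegers F := by
  rw [HeightOneSpectrum.mem_adicCompletionIntegers, NumberField.FinitePlace.norm_def]
  rw [← NNReal.coe_one, NNReal.coe_le_coe]
  exact WithZeroMulInt.toNNReal_le_one_iff (NumberField.HeightOneSpectrum.one_lt_absNorm_nnreal v)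

theorem norm_algebraMap_eq (x : F) : ‖algebraMap F (v.adicCompletion F) x‖ =
    WithZeroMulInt.toNNReal (NumberField.HeightOneSpectrum.absNorm_ne_zero v) (v.valuation F x) :=
  NumberField.FinitePlace.norm_embedding' v x

theorem norm_algebraMap_int_le_one (a : 𝓞 F) :
    ‖algebraMap F (v.adicCompletion F) (a : F)‖ ≤ 1 :=
  NumberField.FinitePlace.norm_le_one F v a

theorem norm_algebraMap_int_lt_one_iff (a : 𝓞 F) :
    ‖algebraMap F (v.adicCompletion F) (a : F)‖ < 1 ↔ a ∈ v.asIdeal :=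
  NumberField.FinitePlace.norm_lt_one_iff_mem F v a

theorem exists_norm_eq_zpow {x : v.adicCompletion F} (hx : x ≠ 0) :
    ∃ n : ℤ, ‖x‖ = residueCard v ^ n := by
  have h0 : Valued.v x ≠ 0 := (Valuation.ne_zero_iff _).2 hx
  refine ⟨(WithZero.unzero h0).toAdd, ?_⟩
  rw [NumberField.FinitePlace.norm_def, WithZeroMulInt.toNNReal_neg_apply _ h0]
  simp [residueCard]

theorem toNNReal_exp (n : ℤ) : ((WithZeroMulInt.toNNReal
    (NumberField.HeightOneSpectrum.absNorm_ne_zero v) (WithZero.exp n) : NNReal) : ℝ)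
      = residueCard v ^ n := by
  rw [WithZeroMulInt.toNNReal_neg_apply _ (WithZero.exp_ne_zero)]
  simp [residueCard]
  rfl

theorem exists_norm_eq (n : ℤ) : ∃ x : v.adicCompletion F, x ≠ 0 ∧ ‖x‖ = residueCard v ^ n := by
  obtain ⟨x, hx⟩ := v.valuedAdicCompletion_surjective F (WithZero.exp n)
  have h1 : ‖x‖ = residueCard v ^ n := by
    rw [NumberField.FinitePlace.norm_def, hx, toNNReal_exp]
  refine ⟨x, ?_, h1⟩
  rintro rfl
  rw [norm_zero] at h1
  exact (zpow_pos (residueCard_pos v) n).ne h1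

theorem norm_algebraMap_int_le_pow_iff (a : 𝓞 F) (n : ℕ) :
    ‖algebraMap F (v.adicCompletion F) (a : F)‖ ≤ residueCard v ^ (-n : ℤ) ↔
      a ∈ v.asIdeal ^ n := by
  rw [norm_algebraMap_eq, HeightOneSpectrum.valuation_of_algebraMap, ← toNNReal_exp,
    NNReal.coe_le_coe, (WithZeroMulInt.toNNReal_strictMono
      (NumberField.HeightOneSpectrum.one_lt_absNorm_nnreal v)).le_iff_le,
    HeightOneSpectrum.intValuation_le_pow_iff_mem]

theorem exists_zpow_lt {ε : ℝ} (hε : 0 < ε) : ∃ n : ℕ, residueCard v ^ (-n : ℤ) < ε := by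
  obtain ⟨n, hn⟩ := exists_pow_lt_of_lt_one hε (inv_lt_one_of_one_lt₀ (one_lt_residueCard v))
  exact ⟨n, by simpa using hn⟩

theorem denseRange_algebraMap_completion : DenseRange (algebraMap F (v.adicCompletion F)) :=
  v.denseRange_algebraMap F

theorem exists_int_norm_sub_lt {x : v.adicCompletion F} (hx : ‖x‖ ≤ 1) {ε : ℝ} (hε : 0 < ε) :
    ∃ a : 𝓞 F, ‖x - algebraMap F (v.adicCompletion F) (a : F)‖ < ε := by
  obtain ⟨n, hn⟩ := exists_zpow_lt v hε
  obtain ⟨y, hy⟩ := (denseRange_algebraMap_completion v).exists_dist_lt x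
    (lt_min hε zero_lt_one)
  rw [dist_eq_norm, lt_min_iff] at hy
  have hy1 : ‖algebraMap F (v.adicCompletion F) y‖ ≤ 1 := by
    have := IsUltrametricDist.norm_add_le_max x (algebraMap F (v.adicCompletion F) y - x)
    rw [add_sub_cancel, norm_sub_rev] at this
    exact this.trans (max_le hx hy.2.le)
  have hy2 : v.valuation F y ≤ 1 := by
    rw [norm_le_one_iff, HeightOneSpectrum.mem_adicCompletionIntegers] at hy1
    rwa [← v.valuedAdicCompletion_eq_valuation']
  obtain ⟨a, ha⟩ := v.exists_valuation_sub_lt_of_integer (K := F) hy2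
    (Units.mk0 (WithZero.exp (-n : ℤ)) WithZero.exp_ne_zero)
  refine ⟨a, ?_⟩
  have h3 : ‖algebraMap F (v.adicCompletion F) (y - a)‖ < ε := by
    rw [norm_algebraMap_eq]
    refine lt_of_le_of_lt ?_ hn
    rw [← toNNReal_exp, NNReal.coe_le_coe]
    refine (WithZeroMulInt.toNNReal_strictMono
      (NumberField.HeightOneSpectrum.one_lt_absNorm_nnreal v)).monotone ?_
    simpa [Valuation.map_sub_swap] using ha.le
  have := IsUltrametricDist.norm_add_le_max (x - algebraMap F (v.adicCompletion F) y)
    (algebraMap F (v.adicCompletion F) (y - a))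
  rw [map_sub, sub_add_sub_cancel] at this
  rw [map_sub] at h3
  exact this.trans_lt (max_lt hy.1 h3)

theorem isCompact_norm_le_one : IsCompact {x : v.adicCompletion F | ‖x‖ ≤ 1} := by
  have hcl : IsClosed {x : v.adicCompletion F | ‖x‖ ≤ 1} :=
    isClosed_le continuous_norm continuous_const
  refine TotallyBounded.isCompact_of_isClosed ?_ hcl
  rw [Metric.totallyBounded_iff]
  intro ε hε
  obtain ⟨n, hn⟩ := exists_zpow_lt v hε
  have : Finite (𝓞 F ⧸ v.asIdeal ^ n) :=
    Ideal.finiteQuotientOfFreeOfNeBot _ (pow_ne_zero n v.ne_bot)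
  refine ⟨Set.range fun c : 𝓞 F ⧸ v.asIdeal ^ n =>
    algebraMap F (v.adicCompletion F) ((Quotient.out c : 𝓞 F) : F), Set.finite_range _, ?_⟩
  intro x hx
  obtain ⟨a, ha⟩ := exists_int_norm_sub_lt v hx hε
  simp only [Set.mem_iUnion, Set.mem_range, exists_prop, exists_exists_eq_and, Metric.mem_ball,
    dist_eq_norm]
  refine ⟨Ideal.Quotient.mk _ a, ?_⟩
  set b : 𝓞 F := Quotient.out (Ideal.Quotient.mk (v.asIdeal ^ n) a)
  have hb : a - b ∈ v.asIdeal ^ n :=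
    Ideal.Quotient.eq.1 (Quotient.out_eq (Ideal.Quotient.mk (v.asIdeal ^ n) a)).symm
  have h2 := (norm_algebraMap_int_le_pow_iff v (a - b) n).2 hb
  have := IsUltrametricDist.norm_add_le_max (x - algebraMap F (v.adicCompletion F) a)
    (algebraMap F (v.adicCompletion F) ((a - b : 𝓞 F) : F))
  have e : ((a - b : 𝓞 F) : F) = a - b := map_sub (algebraMap (𝓞 F) F) a b
  rw [e, map_sub, sub_add_sub_cancel] at this
  rw [e, map_sub] at h2
  exact this.trans_lt (max_lt ha (h2.trans_lt hn))

theorem isOpen_norm_le_one : IsOpen {x : v.adicCompletion F | ‖x‖ ≤ 1} := by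
  have := IsUltrametricDist.isOpen_closedBall (0 : v.adicCompletion F) one_ne_zero
  simpa [Metric.closedBall, dist_eq_norm] using this

theorem isOpen_norm_eq_one : IsOpen {x : v.adicCompletion F | ‖x‖ = 1} := by
  have := IsUltrametricDist.isOpen_sphere (0 : v.adicCompletion F) one_ne_zero
  simpa [Metric.sphere, dist_eq_norm] using this

instance locallyCompactSpace_adicCompletion : LocallyCompactSpace (v.adicCompletion F) :=
  (isCompact_norm_le_one v).locallyCompactSpace_of_mem_nhds_of_addGroup (x := 0)
    ((isOpen_norm_le_one v).mem_nhds (by simp))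

instance secondCountable_adicCompletion : SecondCountableTopology (v.adicCompletion F) := by
  have : TopologicalSpace.SeparableSpace (v.adicCompletion F) :=
    ⟨⟨_, Set.countable_range _, denseRange_algebraMap_completion v⟩⟩
  exact UniformSpace.secondCountable_of_separable _

instance compactSpace_adicCompletionIntegers : CompactSpace (v.adicCompletionIntegers F) :=
  isCompact_iff_compactSpace.1 <| by
    convert isCompact_norm_le_one v using 1
    ext x
    exact (norm_le_one_iff v x).symm

instance fact_isOpen_adicCompletionIntegers : Fact (∀ v : HeightOneSpectrum (𝓞 F),
    IsOpen (v.adicCompletionIntegers F : Set (v.adicCompletion F))) :=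
  ⟨fun _ => Valued.isOpen_valuationSubring _⟩

end FinitePlaces

section InfinitePlaces

variable {F : Type*} [Field F] [NumberField F] (v : InfinitePlace F)

instance secondCountable_completion : SecondCountableTopology v.Completion := by
  have : TopologicalSpace.SeparableSpace v.Completion :=
    have : Countable (WithAbs v.1) := (WithAbs.equiv v.1).injective.countable
    ⟨⟨_, Set.countable_range _, InfinitePlace.Completion.denseRange_coe v⟩⟩
  exact UniformSpace.secondCountable_of_separable _

end InfinitePlaces

/-- The units of a topological ring whose topology is Polish carry the Borel `σ`-algebra. -/
theorem borelSpace_units {R : Type*} [CommRing R] [TopologicalSpace R] [IsTopologicalRing R]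
    [PolishSpace R] [MeasurableSpace R] [BorelSpace R] : BorelSpace Rˣ := by
  have hP : PolishSpace Rˣ := by
    have : PolishSpace Rᵐᵒᵖ := MulOpposite.opHomeomorph.symm.isClosedEmbedding.polishSpace
    exact Units.isClosedEmbedding_embedProduct.polishSpace
  constructor
  let m : MeasurableSpace Rˣ := borel _
  have : @BorelSpace Rˣ _ m := ⟨rfl⟩
  exact (Continuous.measurableEmbedding (β := R) (γ := Rˣ) Units.continuous_val
    Units.val_injective).comap_eq

instance borelSpace_units_adicCompletion {F : Type*} [Field F] [NumberField F]
    (v : HeightOneSpectrum (𝓞 F)) : BorelSpace (v.adicCompletion F)ˣ := borelSpace_units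

instance borelSpace_units_completion {F : Type*} [Field F] [NumberField F]
    (v : InfinitePlace F) : BorelSpace v.Completionˣ := borelSpace_units


section StrongApproximation

variable {F : Type*} [Field F] [NumberField F]

theorem norm_algebraMap_int_eq_one_iff (v : HeightOneSpectrum (𝓞 F)) (a : 𝓞 F) :
    ‖algebraMap F (v.adicCompletion F) (a : F)‖ = 1 ↔ a ∉ v.asIdeal :=
  NumberField.FinitePlace.norm_eq_one_iff_notMem F v a

theorem finite_mem_asIdeal {N : 𝓞 F} (hN : N ≠ 0) :
    {v : HeightOneSpectrum (𝓞 F) | N ∈ v.asIdeal}.Finite := by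
  have := Ideal.finite_factors (R := 𝓞 F) (I := Ideal.span {N})
    (by simpa [Ideal.span_singleton_eq_bot] using hN)
  simpa [Ideal.dvd_span_singleton] using this

theorem finite_one_lt_norm (x : FiniteAdeleRing (𝓞 F) F) : {v | ¬ ‖x v‖ ≤ 1}.Finite := by
  have := x.2
  rw [Filter.eventually_cofinite] at this
  simpa only [norm_le_one_iff] using! this

theorem exists_int_mul_integral (x : FiniteAdeleRing (𝓞 F) F) :
    ∃ N : 𝓞 F, N ≠ 0 ∧ ∀ v, ‖algebraMap F (v.adicCompletion F) (N : F) * x v‖ ≤ 1 := by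
  classical
  choose b hb hb' using fun v : HeightOneSpectrum (𝓞 F) =>
    HeightOneSpectrum.adicCompletion.mul_nonZeroDivisor_mem_adicCompletionIntegers
      (K := F) v (x v)
  refine ⟨∏ v ∈ (finite_one_lt_norm x).toFinset, b v, ?_, fun v => ?_⟩
  · exact Finset.prod_ne_zero_iff.2 fun v _ => nonZeroDivisors.ne_zero (hb v)
  · by_cases hv : ‖x v‖ ≤ 1
    · rw [norm_mul]
      exact mul_le_one₀ (norm_algebraMap_int_le_one v _) (norm_nonneg _) hv
    · have hmem : v ∈ (finite_one_lt_norm x).toFinset := by simpa using hv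
      rw [← Finset.mul_prod_erase _ _ hmem]
      have e : ∀ c d : 𝓞 F, ((c * d : 𝓞 F) : F) = c * d := map_mul (algebraMap (𝓞 F) F)
      rw [e, map_mul, mul_right_comm, norm_mul]
      refine mul_le_one₀ ?_ (norm_nonneg _) (norm_algebraMap_int_le_one v _)
      rw [norm_le_one_iff, mul_comm]
      exact hb' v

/-- Strong approximation: `F` meets every coset of the integral finite adeles. -/
theorem exists_norm_sub_algebraMap_le_one (x : FiniteAdeleRing (𝓞 F) F) :
    ∃ a : F, ∀ v, ‖x v - algebraMap F (v.adicCompletion F) a‖ ≤ 1 := by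
  classical
  obtain ⟨N, hN, hNx⟩ := exists_int_mul_integral x
  have hN' : (N : F) ≠ 0 := by simpa using hN
  have hNv : ∀ v : HeightOneSpectrum (𝓞 F), 0 < ‖algebraMap F (v.adicCompletion F) (N : F)‖ :=
    fun v => norm_pos_iff.2 (by simpa using hN')
  choose a ha using fun v => exists_int_norm_sub_lt v (hNx v) (hNv v)
  choose e he using fun v => exists_zpow_lt v (hNv v)
  obtain ⟨y, hy⟩ := IsDedekindDomain.exists_forall_sub_mem_ideal
    (s := (finite_mem_asIdeal hN).toFinset) (fun v => v.asIdeal) e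
    (fun v _ => v.prime) (fun v _ w _ h h' => h (HeightOneSpectrum.ext h')) (fun v => a v)
  refine ⟨(y : F) / N, fun v => ?_⟩
  have hk : ‖algebraMap F (v.adicCompletion F) (N : F) * x v -
      algebraMap F (v.adicCompletion F) (y : F)‖ ≤ ‖algebraMap F (v.adicCompletion F) (N : F)‖ := by
    by_cases hv : N ∈ v.asIdeal
    · have h1 := hy v (by simpa using hv)
      rw [← norm_algebraMap_int_le_pow_iff] at h1
      have e1 : ((y - a v : 𝓞 F) : F) = y - a v := map_sub (algebraMap (𝓞 F) F) y (a v)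
      rw [e1, map_sub, norm_sub_rev] at h1
      have := IsUltrametricDist.norm_add_le_max (algebraMap F (v.adicCompletion F) (N : F) * x v -
        algebraMap F (v.adicCompletion F) (a v : F)) (algebraMap F (v.adicCompletion F) (a v : F) -
          algebraMap F (v.adicCompletion F) (y : F))
      rw [sub_add_sub_cancel] at this
      exact this.trans (max_le (ha v).le (h1.trans (he v).le))
    · rw [(norm_algebraMap_int_eq_one_iff v N).2 hv]
      have := IsUltrametricDist.norm_add_le_max (algebraMap F (v.adicCompletion F) (N : F) * x v)
        (-algebraMap F (v.adicCompletion F) (y : F))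
      rw [← sub_eq_add_neg, norm_neg] at this
      exact this.trans (max_le (hNx v) (norm_algebraMap_int_le_one v y))
  have h0 : algebraMap F (v.adicCompletion F) (N : F) ≠ 0 := norm_pos_iff.1 (hNv v)
  rw [← mul_le_mul_iff_right₀ (hNv v), ← norm_mul, mul_sub, map_div₀, mul_div_cancel₀ _ h0, mul_one]
  exact hk

end StrongApproximation

section Topology

variable (F : Type*) [Field F] [NumberField F]

instance t2Space_infiniteAdele : T2Space (InfiniteAdeleRing F) :=
  inferInstanceAs (T2Space (∀ v : InfinitePlace F, v.Completion))

instance secondCountable_infiniteAdele : SecondCountableTopology (InfiniteAdeleRing F) :=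
  inferInstanceAs (SecondCountableTopology (∀ v : InfinitePlace F, v.Completion))

instance t2Space_finiteAdele : T2Space (FiniteAdeleRing (𝓞 F) F) :=
  inferInstanceAs (T2Space (RestrictedProduct (fun v : HeightOneSpectrum (𝓞 F) =>
    v.adicCompletion F) (fun v => (v.adicCompletionIntegers F : Set _)) Filter.cofinite))

instance locallyCompactSpace_finiteAdele : LocallyCompactSpace (FiniteAdeleRing (𝓞 F) F) :=
  inferInstanceAs (LocallyCompactSpace (RestrictedProduct (fun v : HeightOneSpectrum (𝓞 F) =>
    v.adicCompletion F) (fun v => (v.adicCompletionIntegers F : Set _)) Filter.cofinite))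

variable {F}

theorem continuous_finiteAdele_apply (v : HeightOneSpectrum (𝓞 F)) :
    Continuous fun x : FiniteAdeleRing (𝓞 F) F => x v :=
  RestrictedProduct.continuous_eval (R := fun v : HeightOneSpectrum (𝓞 F) => v.adicCompletion F)
    (A := fun v => (v.adicCompletionIntegers F : Set (v.adicCompletion F)))
    (𝓕 := Filter.cofinite) v

theorem isOpen_forall_imp_norm_le_one (p : HeightOneSpectrum (𝓞 F) → Prop) :
    IsOpen {x : FiniteAdeleRing (𝓞 F) F | ∀ v, p v → ‖x v‖ ≤ 1} := by
  simp only [norm_le_one_iff]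
  exact RestrictedProduct.isOpen_forall_imp_mem
    (R := fun v : HeightOneSpectrum (𝓞 F) => v.adicCompletion F)
    (A := fun v => (v.adicCompletionIntegers F : Set _)) (fun v => Valued.isOpen_valuationSubring _)

/-- The integral finite adeles. -/
def integralFiniteAdeles (F : Type*) [Field F] [NumberField F] :
    Set (FiniteAdeleRing (𝓞 F) F) := {x | ∀ v, ‖x v‖ ≤ 1}

theorem isOpen_integralFiniteAdeles : IsOpen (integralFiniteAdeles F) := by
  simpa [integralFiniteAdeles] using isOpen_forall_imp_norm_le_one (F := F) fun _ => True

theorem range_structureMap_eq : Set.range (RestrictedProduct.structureMap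
    (fun v : HeightOneSpectrum (𝓞 F) => v.adicCompletion F)
    (fun v => (v.adicCompletionIntegers F : Set (v.adicCompletion F))) Filter.cofinite) =
    integralFiniteAdeles F := by
  rw [RestrictedProduct.range_structureMap]
  ext x
  simp only [integralFiniteAdeles, Set.mem_ofPred_eq, norm_le_one_iff]
  rfl

theorem isCompact_integralFiniteAdeles : IsCompact (integralFiniteAdeles F) := by
  have : ∀ v : HeightOneSpectrum (𝓞 F), CompactSpace
      (v.adicCompletionIntegers F : Set (v.adicCompletion F)) :=
    fun v => compactSpace_adicCompletionIntegers v
  have := isCompact_range (RestrictedProduct.isEmbedding_structureMap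
    (R := fun v : HeightOneSpectrum (𝓞 F) => v.adicCompletion F)
    (A := fun v => (v.adicCompletionIntegers F : Set (v.adicCompletion F)))
    (𝓕 := Filter.cofinite)).continuous
  rwa [range_structureMap_eq] at this

instance secondCountable_finiteAdele : SecondCountableTopology (FiniteAdeleRing (𝓞 F) F) := by
  have h1 : SecondCountableTopology (integralFiniteAdeles F) := by
    have e := (RestrictedProduct.isEmbedding_structureMap
      (R := fun v : HeightOneSpectrum (𝓞 F) => v.adicCompletion F)
      (A := fun v => (v.adicCompletionIntegers F : Set (v.adicCompletion F)))
      (𝓕 := Filter.cofinite)).toHomeomorph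
    rw [range_structureMap_eq] at e
    exact e.symm.isEmbedding.secondCountableTopology
  let t : F → FiniteAdeleRing (𝓞 F) F ≃ₜ FiniteAdeleRing (𝓞 F) F := fun a =>
    Homeomorph.addLeft (algebraMap F (FiniteAdeleRing (𝓞 F) F) a)
  have h2 : ∀ a, SecondCountableTopology ((t a) '' integralFiniteAdeles F) := fun a =>
    ((t a).image _).symm.isEmbedding.secondCountableTopology
  refine TopologicalSpace.secondCountableTopology_of_countable_cover (ι := F)
    (U := fun a => (t a) '' integralFiniteAdeles F)
    (fun a => (t a).isOpenMap _ isOpen_integralFiniteAdeles) ?_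
  rw [Set.eq_univ_iff_forall]
  intro x
  obtain ⟨a, ha⟩ := exists_norm_sub_algebraMap_le_one x
  refine Set.mem_iUnion.2 ⟨a, x - algebraMap F _ a, ?_, ?_⟩
  · intro v
    exact ha v
  · simp [t]

instance t2Space_adele : T2Space (Adele F) :=
  inferInstanceAs (T2Space (InfiniteAdeleRing F × FiniteAdeleRing (𝓞 F) F))

instance locallyCompactSpace_adele : LocallyCompactSpace (Adele F) :=
  inferInstanceAs (LocallyCompactSpace (InfiniteAdeleRing F × FiniteAdeleRing (𝓞 F) F))

instance secondCountable_adele : SecondCountableTopology (Adele F) :=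
  inferInstanceAs (SecondCountableTopology (InfiniteAdeleRing F × FiniteAdeleRing (𝓞 F) F))

/-- Bounded boxes of finite adeles. -/
theorem isCompact_finiteAdeleBox {R : HeightOneSpectrum (𝓞 F) → ℝ}
    (hR : ∀ᶠ v in Filter.cofinite, R v = 1) :
    IsCompact {x : FiniteAdeleRing (𝓞 F) F | ∀ v, ‖x v‖ ≤ R v} := by
  classical
  have hy : ∀ v : HeightOneSpectrum (𝓞 F), ∃ y : v.adicCompletion F, y ≠ 0 ∧ R v ≤ ‖y‖ ∧
      (R v = 1 → y = 1) := by
    intro v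
    by_cases h : R v = 1
    · exact ⟨1, one_ne_zero, by simp [h], fun _ => rfl⟩
    · obtain ⟨n, hn⟩ := pow_unbounded_of_one_lt (R v) (one_lt_residueCard v)
      obtain ⟨y, hy, hy'⟩ := exists_norm_eq v n
      exact ⟨y, hy, by rw [hy', zpow_natCast]; exact hn.le, fun h' => absurd h' h⟩
  choose y hy0 hyR hy1 using hy
  let Y : FiniteAdeleRing (𝓞 F) F := ⟨y, by
    filter_upwards [hR] with v hv
    rw [hy1 v hv]
    exact one_mem _⟩
  refine ((isCompact_integralFiniteAdeles (F := F)).image (continuous_const_mul Y)).of_isClosed_subset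
    ?_ ?_
  · simp only [Set.ofPred_forall]
    exact isClosed_iInter fun v =>
      isClosed_le (continuous_finiteAdele_apply v).norm continuous_const
  · intro x hx
    have hx' : ∀ v, ‖x v‖ ≤ R v := hx
    have hz : ∀ v, ‖(y v)⁻¹ * x v‖ ≤ 1 := fun v => by
      rw [norm_mul, norm_inv, inv_mul_le_one₀ (norm_pos_iff.2 (hy0 v))]
      exact (hx' v).trans (hyR v)
    refine ⟨⟨fun v => (y v)⁻¹ * x v, .of_forall fun v => (norm_le_one_iff v _).1 (hz v)⟩, hz, ?_⟩
    refine FiniteAdeleRing.ext F fun v => ?_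
    exact mul_inv_cancel_left₀ (hy0 v) (x v)

theorem continuous_infEval (v : InfinitePlace F) : Continuous (infEval v : Adele F → v.Completion) :=
  (continuous_apply v).comp (continuous_fst (X := InfiniteAdeleRing F)
    (Y := FiniteAdeleRing (𝓞 F) F))

theorem continuous_finEval (v : HeightOneSpectrum (𝓞 F)) :
    Continuous (finEval v : Adele F → v.adicCompletion F) :=
  (continuous_finiteAdele_apply v).comp (continuous_snd (X := InfiniteAdeleRing F)
    (Y := FiniteAdeleRing (𝓞 F) F))

instance properSpace_completion (v : InfinitePlace F) : ProperSpace v.Completion := by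
  have h := InfinitePlace.Completion.isometry_extensionEmbedding v
  refine ⟨fun x r => ?_⟩
  rw [← h.preimage_closedBall]
  exact h.isClosedEmbedding.isCompact_preimage (isCompact_closedBall _ _)

/-- The box of adeles bounded by `r` at the infinite places and by `R v` at the finite places. -/
def adeleBox (r : ℝ) (R : HeightOneSpectrum (𝓞 F) → ℝ) : Set (Adele F) :=
  {x | (∀ v : InfinitePlace F, ‖infEval v x‖ ≤ r) ∧ ∀ v, ‖finEval v x‖ ≤ R v}

theorem isCompact_adeleBox (r : ℝ) {R : HeightOneSpectrum (𝓞 F) → ℝ}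
    (hR : ∀ᶠ v in Filter.cofinite, R v = 1) : IsCompact (adeleBox r R) := by
  have h1 : IsCompact (Set.univ.pi fun v : InfinitePlace F => Metric.closedBall
      (0 : v.Completion) r) :=
    isCompact_univ_pi fun v => isCompact_closedBall _ _
  have h2 : adeleBox r R = (Set.univ.pi fun v : InfinitePlace F => Metric.closedBall
      (0 : v.Completion) r) ×ˢ {x : FiniteAdeleRing (𝓞 F) F | ∀ v, ‖x v‖ ≤ R v} := by
    refine Set.ext fun x => ?_
    exact ⟨fun h => ⟨fun v _ => by simpa using! h.1 v, h.2⟩,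
      fun h => ⟨fun v => by simpa using! h.1 v trivial, h.2⟩⟩
  rw [h2]
  exact h1.prod (isCompact_finiteAdeleBox hR)

theorem isOpen_forall_imp_finEval_le_one (p : HeightOneSpectrum (𝓞 F) → Prop) :
    IsOpen {x : Adele F | ∀ v, p v → ‖finEval v x‖ ≤ 1} :=
  (isOpen_forall_imp_norm_le_one p).preimage (continuous_snd (X := InfiniteAdeleRing F)
    (Y := FiniteAdeleRing (𝓞 F) F))

instance polishSpace_adele : PolishSpace (Adele F) := by
  let _ : UniformSpace (Adele F) := IsTopologicalAddGroup.rightUniformSpace (Adele F)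
  have : IsUniformAddGroup (Adele F) := isUniformAddGroup_of_addCommGroup
  have : (_root_.uniformity (Adele F)).IsCountablyGenerated :=
    IsUniformAddGroup.uniformity_countably_generated
  have : CompleteSpace (Adele F) :=
    IsRightUniformAddGroup.completeSpace_of_weaklyLocallyCompactSpace
  infer_instance

instance borelSpace_units_adele : BorelSpace (Adele F)ˣ := borelSpace_units

theorem norm_infEval_units (v : InfinitePlace F) (t : (Adele F)ˣ) :
    ‖infEval v ((t⁻¹ : (Adele F)ˣ) : Adele F)‖ = ‖infEval v (t : Adele F)‖⁻¹ := by
  rw [← norm_inv, ← map_units_inv]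

theorem norm_finEval_units (v : HeightOneSpectrum (𝓞 F)) (t : (Adele F)ˣ) :
    ‖finEval v ((t⁻¹ : (Adele F)ˣ) : Adele F)‖ = ‖finEval v (t : Adele F)‖⁻¹ := by
  rw [← norm_inv, ← map_units_inv]

theorem isCompact_ideleBox (r : ℝ) {R : HeightOneSpectrum (𝓞 F) → ℝ}
    (hR : ∀ᶠ v in Filter.cofinite, R v = 1) :
    IsCompact {t : (Adele F)ˣ | (t : Adele F) ∈ adeleBox r R ∧
      ((t⁻¹ : (Adele F)ˣ) : Adele F) ∈ adeleBox r R} := by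
  have h := (isCompact_adeleBox r hR).prod
    ((isCompact_adeleBox r hR).image MulOpposite.continuous_op)
  convert Units.isClosedEmbedding_embedProduct.isCompact_preimage h using 1
  ext t
  simp

theorem isOpen_forall_imp_finEval_eq_one (p : HeightOneSpectrum (𝓞 F) → Prop) :
    IsOpen {t : (Adele F)ˣ | ∀ v, p v → ‖finEval v (t : Adele F)‖ = 1} := by
  have h1 := ((isOpen_forall_imp_finEval_le_one p).preimage Units.continuous_val).inter
    ((isOpen_forall_imp_finEval_le_one p).preimage Units.continuous_coe_inv)
  convert h1 using 1
  ext t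
  simp only [Set.mem_ofPred_eq, Set.mem_inter_iff, Set.mem_preimage, norm_finEval_units]
  rw [← forall_and]
  refine forall_congr' fun v => ?_
  have : 0 < ‖finEval v (t : Adele F)‖ := norm_pos_iff.2 ((t.isUnit.map (finEval v)).ne_zero)
  rw [inv_le_one₀ this, le_antisymm_iff, imp_and]

theorem eventually_finEval_le_one (x : Adele F) : ∀ᶠ v in Filter.cofinite, ‖finEval v x‖ ≤ 1 :=
  Filter.eventually_cofinite.2 (finite_one_lt_norm x.2)

theorem eventually_finEval_eq_one (t : (Adele F)ˣ) :
    ∀ᶠ v in Filter.cofinite, ‖finEval v (t : Adele F)‖ = 1 := by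
  filter_upwards [eventually_finEval_le_one (t : Adele F),
    eventually_finEval_le_one ((t⁻¹ : (Adele F)ˣ) : Adele F)] with v h1 h2
  rw [norm_finEval_units, inv_le_one₀ (norm_pos_iff.2 ((t.isUnit.map (finEval v)).ne_zero))] at h2
  exact le_antisymm h1 h2

end Topology


section ProductIntegrals

open scoped ENNReal

theorem lintegral_fin_nat_prod_eq_prod {n : ℕ} {E : Fin n → Type*}
    {mE : ∀ i, MeasurableSpace (E i)} {μ : (i : Fin n) → Measure (E i)} [∀ i, SigmaFinite (μ i)]
    {f : (i : Fin n) → E i → ℝ≥0∞} (hf : ∀ i, Measurable (f i)) :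
    ∫⁻ x : (i : Fin n) → E i, ∏ i, f i (x i) ∂(Measure.pi μ) = ∏ i, ∫⁻ x, f i x ∂(μ i) := by
  induction n with
  | zero => simp
  | succ n n_ih =>
    calc
      _ = ∫⁻ x : E 0 × ((i : Fin n) → E (Fin.succ i)),
          f 0 x.1 * ∏ i : Fin n, f (Fin.succ i) (x.2 i)
          ∂((μ 0).prod (Measure.pi (fun i ↦ μ i.succ))) := by
        rw [← ((measurePreserving_piFinSuccAbove μ 0).symm).lintegral_comp_emb
          (MeasurableEquiv.measurableEmbedding _)]
        refine lintegral_congr fun x => ?_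
        rw [Fin.prod_univ_succ]
        rfl
      _ = (∫⁻ x, f 0 x ∂μ 0)
          * ∏ i : Fin n, ∫⁻ (x : E (Fin.succ i)), f (Fin.succ i) x ∂(μ i.succ) := by
        rw [← n_ih fun i => hf _, ← lintegral_prod_mul (hf 0).aemeasurable]
        exact (Finset.measurable_prod _ fun i _ =>
          (hf i.succ).comp (measurable_pi_apply i)).aemeasurable
      _ = ∏ i, ∫⁻ x, f i x ∂(μ i) := by rw [Fin.prod_univ_succ]

theorem lintegral_fintype_prod_eq_prod {ι : Type*} [Fintype ι] {E : ι → Type*}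
    {mE : ∀ i, MeasurableSpace (E i)} {μ : (i : ι) → Measure (E i)} [∀ i, SigmaFinite (μ i)]
    {f : (i : ι) → E i → ℝ≥0∞} (hf : ∀ i, Measurable (f i)) :
    ∫⁻ x : (i : ι) → E i, ∏ i, f i (x i) ∂(Measure.pi μ) = ∏ i, ∫⁻ x, f i x ∂(μ i) := by
  let e := (Fintype.equivFin ι).symm
  rw [← (measurePreserving_piCongrLeft _ e).lintegral_comp_emb
    (MeasurableEquiv.measurableEmbedding _)]
  simp_rw [← e.prod_comp, MeasurableEquiv.coe_piCongrLeft, Equiv.piCongrLeft_apply_apply]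
  exact lintegral_fin_nat_prod_eq_prod fun i => hf _

end ProductIntegrals

section HaarPushforward

/-- A homomorphism that is proper and surjective on an open subgroup pushes the restriction of a
Haar measure forward to a multiple of a Haar measure; one set fixes the multiple. -/
@[to_additive]
theorem map_restrict_eq_of_isHaarMeasure {G H : Type*} [Group G] [TopologicalSpace G]
    [IsTopologicalGroup G] [MeasurableSpace G] [BorelSpace G] [Group H] [TopologicalSpace H]
    [IsTopologicalGroup H] [MeasurableSpace H] [BorelSpace H] [LocallyCompactSpace H]
    [SecondCountableTopology H] (U : Subgroup G) (p : G →* H)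
    (hp : Continuous p) (hsurj : ∀ h, ∃ g ∈ U, p g = h)
    (hcpt : ∀ K, IsCompact K → ∃ K', IsCompact K' ∧ (U : Set G) ∩ p ⁻¹' K ⊆ K')
    (μ : Measure G) (ν : Measure H) [μ.IsHaarMeasure] [ν.IsHaarMeasure] {B : Set H}
    (hB : MeasurableSet B) (hB0 : ν B ≠ 0) (hB1 : ν B ≠ ⊤)
    (h : μ ((U : Set G) ∩ p ⁻¹' B) = ν B) :
    (μ.restrict (U : Set G)).map p = ν := by
  have happ : ∀ E, MeasurableSet E →
      (μ.restrict (U : Set G)).map p E = μ ((U : Set G) ∩ p ⁻¹' E) := fun E hE => by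
    rw [Measure.map_apply hp.measurable hE, Measure.restrict_apply (hp.measurable hE),
      Set.inter_comm]
  have hinv : ((μ.restrict (U : Set G)).map p).IsMulLeftInvariant := by
    refine ⟨fun x => Measure.ext fun E hE => ?_⟩
    obtain ⟨g, hg, rfl⟩ := hsurj x
    rw [Measure.map_apply (measurable_const_mul _) hE, happ _ hE,
      happ _ (measurable_const_mul _ hE), ← measure_preimage_mul μ g ((U : Set G) ∩ p ⁻¹' E)]
    congr 1
    ext y
    simp [U.mul_mem_cancel_left hg]
  have hfin : IsFiniteMeasureOnCompacts ((μ.restrict (U : Set G)).map p) := by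
    refine ⟨fun K hK => ?_⟩
    rw [← hK.measure_closure, happ _ isClosed_closure.measurableSet]
    obtain ⟨K', hK', hsub⟩ := hcpt _ hK.closure
    exact (measure_mono hsub).trans_lt hK'.measure_lt_top
  have hc := Measure.isMulLeftInvariant_eq_smul ((μ.restrict (U : Set G)).map p) ν
  set c := ((μ.restrict (U : Set G)).map p).haarScalarFactor ν
  have h1 : (c : ENNReal) * ν B = ν B := by
    conv_rhs => rw [← h, ← happ B hB, hc]
    rfl
  have h2 : (c : ENNReal) = 1 := by
    rw [← ENNReal.mul_left_inj hB0 hB1, one_mul, h1]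
  rw [hc, ENNReal.coe_eq_one.1 h2, one_smul]

@[to_additive]
theorem exists_isHaarMeasure_eq {G : Type*} [Group G] [TopologicalSpace G]
    [IsTopologicalGroup G] [MeasurableSpace G] [BorelSpace G] [LocallyCompactSpace G]
    {S K : Set G} (hS : (interior S).Nonempty) (hK : IsCompact K) (hSK : S ⊆ K)
    {c : ENNReal} (h0 : c ≠ 0) (h1 : c ≠ ⊤) :
    ∃ μ : Measure G, μ.IsHaarMeasure ∧ μ S = c := by
  have hS0 : (Measure.haar : Measure G) S ≠ 0 :=
    (Measure.measure_pos_of_nonempty_interior _ hS).ne'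
  have hS1 : (Measure.haar : Measure G) S ≠ ⊤ :=
    ((measure_mono hSK).trans_lt hK.measure_lt_top).ne
  refine ⟨(c / (Measure.haar : Measure G) S) • Measure.haar,
    Measure.IsHaarMeasure.smul _ (ENNReal.div_ne_zero.2 ⟨h0, hS1⟩) (ENNReal.div_ne_top h1 hS0), ?_⟩
  rw [Measure.smul_apply, smul_eq_mul, ENNReal.div_mul_cancel hS0 hS1]

end HaarPushforward

open scoped ENNReal

/-- `μ` is the restricted product of the measures `ρ i` and `τ j` on `X`, where almost all the
components `b j` lie in `C j`: on the points with `b j x ∈ C j` outside a large finite set `S`, the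
measure `μ` induces the product measure on the remaining components. -/
structure IsRestrictedProductMeasure {X I J : Type*} [MeasurableSpace X] [Fintype I]
    {Y : I → Type*} {Z : J → Type*} [∀ i, MeasurableSpace (Y i)] [∀ j, MeasurableSpace (Z j)]
    (μ : Measure X) (a : ∀ i, X → Y i) (b : ∀ j, X → Z j) (C : ∀ j, Set (Z j))
    (ρ : ∀ i, Measure (Y i)) (τ : ∀ j, Measure (Z j)) : Prop where
  measurable_left : ∀ i, Measurable (a i)
  measurable_right : ∀ j, Measurable (b j)
  measurableSet : ∀ S : Finset J, MeasurableSet {x | ∀ j ∉ S, b j x ∈ C j}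
  eventually_mem : ∀ x, ∀ᶠ j in Filter.cofinite, b j x ∈ C j
  map_eq : ∃ S₀ : Finset J, ∀ S, S₀ ⊆ S → (μ.restrict {x | ∀ j ∉ S, b j x ∈ C j}).map
    (fun x => ((fun i => a i x), fun j : S => b j x)) =
      (Measure.pi ρ).prod (Measure.pi fun j : S => τ j)

namespace IsRestrictedProductMeasure

theorem monotone_set {X J : Type*} {Z : J → Type*} (C : ∀ j, Set (Z j)) (b : ∀ j, X → Z j) :
    Monotone fun S : Finset J => {x | ∀ j ∉ S, b j x ∈ C j} :=
  fun _ _ hST _ hx j hj => hx j fun hj' => hj (hST hj')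

variable {X I J : Type*} [MeasurableSpace X] [Fintype I]
    {Y : I → Type*} {Z : J → Type*} [∀ i, MeasurableSpace (Y i)] [∀ j, MeasurableSpace (Z j)]
    {μ : Measure X} {a : ∀ i, X → Y i} {b : ∀ j, X → Z j} {C : ∀ j, Set (Z j)}
    {ρ : ∀ i, Measure (Y i)} {τ : ∀ j, Measure (Z j)}

theorem measurable_map (h : IsRestrictedProductMeasure μ a b C ρ τ) (S : Finset J) :
    Measurable fun x => ((fun i => a i x), fun j : S => b j x) :=
  (measurable_pi_lambda _ fun i => h.measurable_left i).prodMk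
    (measurable_pi_lambda _ fun j => h.measurable_right j)

theorem iUnion_set (h : IsRestrictedProductMeasure μ a b C ρ τ) :
    ⋃ S : Finset J, {x | ∀ j ∉ S, b j x ∈ C j} = Set.univ := by
  refine Set.eq_univ_of_forall fun x => Set.mem_iUnion.2 ?_
  refine ⟨(Filter.eventually_cofinite.1 (h.eventually_mem x)).toFinset, fun j hj => ?_⟩
  simpa using hj

theorem exists_setLIntegral_eq [∀ i, SigmaFinite (ρ i)] [∀ j, SigmaFinite (τ j)]
    (h : IsRestrictedProductMeasure μ a b C ρ τ) :
    ∃ S₀ : Finset J, ∀ S, S₀ ⊆ S → ∀ (f : ∀ i, Y i → ℝ≥0∞) (k : ∀ j, Z j → ℝ≥0∞),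
      (∀ i, Measurable (f i)) → (∀ j, Measurable (k j)) →
      ∫⁻ x in {x | ∀ j ∉ S, b j x ∈ C j}, (∏ i, f i (a i x)) * ∏ j ∈ S, k j (b j x) ∂μ =
        (∏ i, ∫⁻ y, f i y ∂ρ i) * ∏ j ∈ S, ∫⁻ z, k j z ∂τ j := by
  obtain ⟨S₀, hS₀⟩ := h.map_eq
  refine ⟨S₀, fun S hS f k hf hk => ?_⟩
  have hm1 : Measurable fun y : ∀ i, Y i => ∏ i, f i (y i) :=
    Finset.measurable_prod _ fun i _ => (hf i).comp (measurable_pi_apply i)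
  have hm2 : Measurable fun z : ∀ j : S, Z j => ∏ j : S, k j (z j) :=
    Finset.measurable_prod _ fun j _ => (hk j).comp (measurable_pi_apply j)
  have := lintegral_map (μ := μ.restrict {x | ∀ j ∉ S, b j x ∈ C j})
    (f := fun q : (∀ i, Y i) × (∀ j : S, Z j) => (∏ i, f i (q.1 i)) * ∏ j : S, k j (q.2 j))
    ((hm1.comp measurable_fst).mul (hm2.comp measurable_snd)) (h.measurable_map S)
  rw [hS₀ S hS, lintegral_prod_mul (f := fun y : ∀ i, Y i => ∏ i, f i (y i))
    (g := fun z : ∀ j : S, Z j => ∏ j : S, k j (z j)) hm1.aemeasurable hm2.aemeasurable,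
    lintegral_fintype_prod_eq_prod hf, lintegral_fintype_prod_eq_prod fun j : S => hk j,
    Finset.prod_coe_sort S fun j => ∫⁻ z, k j z ∂τ j] at this
  rw [this]
  refine lintegral_congr fun x => ?_
  rw [Finset.prod_coe_sort S fun j => k j (b j x)]

theorem exists_setIntegral_eq [∀ i, SigmaFinite (ρ i)] [∀ j, SigmaFinite (τ j)]
    (h : IsRestrictedProductMeasure μ a b C ρ τ) :
    ∃ S₀ : Finset J, ∀ S, S₀ ⊆ S → ∀ (f : ∀ i, Y i → ℂ) (k : ∀ j, Z j → ℂ),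
      (∀ i, Measurable (f i)) → (∀ j, Measurable (k j)) →
      ∫ x in {x | ∀ j ∉ S, b j x ∈ C j}, (∏ i, f i (a i x)) * ∏ j ∈ S, k j (b j x) ∂μ =
        (∏ i, ∫ y, f i y ∂ρ i) * ∏ j ∈ S, ∫ z, k j z ∂τ j := by
  obtain ⟨S₀, hS₀⟩ := h.map_eq
  refine ⟨S₀, fun S hS f k hf hk => ?_⟩
  have hm1 : Measurable fun y : ∀ i, Y i => ∏ i, f i (y i) :=
    Finset.measurable_prod _ fun i _ => (hf i).comp (measurable_pi_apply i)
  have hm2 : Measurable fun z : ∀ j : S, Z j => ∏ j : S, k j (z j) :=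
    Finset.measurable_prod _ fun j _ => (hk j).comp (measurable_pi_apply j)
  have := integral_map (μ := μ.restrict {x | ∀ j ∉ S, b j x ∈ C j})
    (f := fun q : (∀ i, Y i) × (∀ j : S, Z j) => (∏ i, f i (q.1 i)) * ∏ j : S, k j (q.2 j))
    (h.measurable_map S).aemeasurable
    ((hm1.comp measurable_fst).mul (hm2.comp measurable_snd)).aestronglyMeasurable
  rw [hS₀ S hS, integral_prod_mul (f := fun y : ∀ i, Y i => ∏ i, f i (y i))
    (g := fun z : ∀ j : S, Z j => ∏ j : S, k j (z j)),
    integral_fintype_prod_eq_prod, integral_fintype_prod_eq_prod,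
    Finset.prod_coe_sort S fun j => ∫ z, k j z ∂τ j] at this
  rw [this]
  refine integral_congr_ae (.of_forall fun x => ?_)
  simp only
  rw [Finset.prod_coe_sort S fun j => k j (b j x)]

/-- A pure tensor has finite integral if the local integrals are finite and have bounded products. -/
theorem lintegral_lt_top [Countable J] [∀ i, SigmaFinite (ρ i)]
    [∀ j, SigmaFinite (τ j)] (h : IsRestrictedProductMeasure μ a b C ρ τ)
    {Φ : X → ℝ≥0∞} {f : ∀ i, Y i → ℝ≥0∞} {k : ∀ j, Z j → ℝ≥0∞} (hf : ∀ i, Measurable (f i))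
    (hk : ∀ j, Measurable (k j)) {S₁ : Finset J}
    (hΦ : ∀ S, S₁ ⊆ S → ∀ x, (∀ j ∉ S, b j x ∈ C j) →
      Φ x = (∏ i, f i (a i x)) * ∏ j ∈ S, k j (b j x))
    (hfi : ∀ i, ∫⁻ y, f i y ∂ρ i ≠ ⊤) {M : ℝ≥0∞} (hM : M ≠ ⊤)
    (hki : ∀ S, S₁ ⊆ S → ∏ j ∈ S, ∫⁻ z, k j z ∂τ j ≤ M) : ∫⁻ x, Φ x ∂μ < ⊤ := by
  classical
  obtain ⟨S₀, hS₀⟩ := h.exists_setLIntegral_eq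
  have hN : (∏ i, ∫⁻ y, f i y ∂ρ i) * M < ⊤ :=
    ENNReal.mul_lt_top (ENNReal.prod_lt_top fun i _ => (hfi i).lt_top) hM.lt_top
  refine lt_of_le_of_lt ?_ hN
  rw [← setLIntegral_univ, ← h.iUnion_set, setLIntegral_iUnion_of_directed _
    (monotone_set C b).directed_le]
  refine iSup_le fun S => ?_
  calc ∫⁻ x in {x | ∀ j ∉ S, b j x ∈ C j}, Φ x ∂μ
      ≤ ∫⁻ x in {x | ∀ j ∉ S ∪ (S₀ ∪ S₁), b j x ∈ C j}, Φ x ∂μ :=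
        lintegral_mono_set (monotone_set C b Finset.subset_union_left)
    _ = ∫⁻ x in {x | ∀ j ∉ S ∪ (S₀ ∪ S₁), b j x ∈ C j},
          (∏ i, f i (a i x)) * ∏ j ∈ S ∪ (S₀ ∪ S₁), k j (b j x) ∂μ :=
        setLIntegral_congr_fun (h.measurableSet _) fun x hx => hΦ _ (by grind) x hx
    _ = _ := hS₀ _ (by grind) f k hf hk
    _ ≤ _ := mul_le_mul_right (hki _ (by grind)) _

/-- The integral of a pure tensor is the product of the local integrals. -/
theorem integral_eq_prod [Countable J] [∀ i, SigmaFinite (ρ i)]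
    [∀ j, SigmaFinite (τ j)] (h : IsRestrictedProductMeasure μ a b C ρ τ)
    {Φ : X → ℂ} {f : ∀ i, Y i → ℂ} {k : ∀ j, Z j → ℂ} (hf : ∀ i, Measurable (f i))
    (hk : ∀ j, Measurable (k j)) {S₁ : Finset J}
    (hΦ : ∀ S, S₁ ⊆ S → ∀ x, (∀ j ∉ S, b j x ∈ C j) →
      Φ x = (∏ i, f i (a i x)) * ∏ j ∈ S, k j (b j x))
    (hki : ∀ j ∉ S₁, ∫ z, k j z ∂τ j = 1) (hint : Integrable Φ μ) :
    ∫ x, Φ x ∂μ = (∏ i, ∫ y, f i y ∂ρ i) * ∏ᶠ j, ∫ z, k j z ∂τ j := by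
  classical
  obtain ⟨S₀, hS₀⟩ := h.exists_setIntegral_eq
  have hlim := tendsto_setIntegral_of_monotone (μ := μ) (f := Φ) h.measurableSet
    (monotone_set C b) hint.integrableOn
  rw [h.iUnion_set, setIntegral_univ] at hlim
  refine tendsto_nhds_unique hlim (tendsto_const_nhds.congr' ?_)
  filter_upwards [Filter.eventually_ge_atTop (S₀ ∪ S₁)] with S hS
  have h0 : S₀ ⊆ S := Finset.subset_union_left.trans hS
  have h1 : S₁ ⊆ S := Finset.subset_union_right.trans hS
  rw [setIntegral_congr_fun (h.measurableSet S) fun x hx => hΦ S h1 x hx, hS₀ S h0 f k hf hk,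
    finprod_eq_prod_of_mulSupport_subset _ (s := S)]
  intro j hj
  by_contra hj'
  exact hj (hki j fun hj1 => hj' (h1 hj1))

end IsRestrictedProductMeasure


open scoped ENNReal

instance secondCountable_units {R : Type*} [CommRing R] [TopologicalSpace R]
    [SecondCountableTopology R] : SecondCountableTopology Rˣ := by
  have : SecondCountableTopology Rᵐᵒᵖ :=
    MulOpposite.opHomeomorph.symm.isEmbedding.secondCountableTopology
  exact Units.isEmbedding_embedProduct.secondCountableTopology

section LocalMeasures

variable {F : Type*} [Field F] [NumberField F]

theorem isCompact_units_of_norm_le {K : Type*} [NormedField K] [ProperSpace K] (r : ℝ) :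
    IsCompact {t : Kˣ | ‖(t : K)‖ ≤ r ∧ ‖((t⁻¹ : Kˣ) : K)‖ ≤ r} := by
  have h := (isCompact_closedBall (0 : K) r).prod
    ((isCompact_closedBall (0 : K) r).image MulOpposite.continuous_op)
  convert Units.isClosedEmbedding_embedProduct.isCompact_preimage h using 1
  ext t
  simp only [Set.mem_preimage, Units.embedProduct_apply, Set.mem_prod, mem_closedBall_zero_iff,
    Set.mem_image, MulOpposite.op_inj, exists_eq_right, Set.mem_ofPred_eq]

noncomputable instance nontriviallyNormedField_adicCompletion (v : HeightOneSpectrum (𝓞 F)) :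
    NontriviallyNormedField (v.adicCompletion F) where
  non_trivial := by
    obtain ⟨x, -, hx⟩ := exists_norm_eq v 1
    exact ⟨x, by rw [hx, zpow_one]; exact one_lt_residueCard v⟩

instance properSpace_adicCompletion (v : HeightOneSpectrum (𝓞 F)) :
    ProperSpace (v.adicCompletion F) :=
  ProperSpace.of_locallyCompactSpace (v.adicCompletion F)

theorem integersVolume_ne_zero (v : HeightOneSpectrum (𝓞 F)) : integersVolume v ≠ 0 := by
  rw [integersVolume, ne_eq, ENNReal.ofReal_eq_zero, not_le]
  refine Real.rpow_pos_of_pos ?_ _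
  have : Ideal.absNorm (v.maxPowDividing (differentIdeal ℤ (𝓞 F))) ≠ 0 := by
    rw [ne_eq, Ideal.absNorm_eq_zero_iff]
    exact pow_ne_zero _ v.ne_bot
  positivity

theorem integersVolume_ne_top (v : HeightOneSpectrum (𝓞 F)) : integersVolume v ≠ ⊤ :=
  ENNReal.ofReal_ne_top

theorem finite_integersVolume_ne_one :
    {v : HeightOneSpectrum (𝓞 F) | integersVolume v ≠ 1}.Finite := by
  have h := Ideal.hasFiniteMulSupport (R := 𝓞 F) (I := differentIdeal ℤ (𝓞 F))
    differentIdeal_ne_bot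
  refine h.subset fun v hv => ?_
  rw [Function.mem_mulSupport]
  intro h1
  exact hv (by rw [integersVolume, h1]; simp)

theorem isAddHaarMeasure_finMeasure_and (v : HeightOneSpectrum (𝓞 F)) :
    (finMeasure v).IsAddHaarMeasure ∧ finMeasure v {x | ‖x‖ ≤ 1} = integersVolume v :=
  Classical.epsilon_spec (p := fun μ : Measure (v.adicCompletion F) =>
    μ.IsAddHaarMeasure ∧ μ {x | ‖x‖ ≤ 1} = integersVolume v)
    (exists_isAddHaarMeasure_eq ⟨0, mem_interior_iff_mem_nhds.2
      ((isOpen_norm_le_one v).mem_nhds (by simp))⟩ (isCompact_norm_le_one v) subset_rfl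
      (integersVolume_ne_zero v) (integersVolume_ne_top v))

instance isAddHaarMeasure_finMeasure (v : HeightOneSpectrum (𝓞 F)) :
    (finMeasure v).IsAddHaarMeasure := (isAddHaarMeasure_finMeasure_and v).1

theorem isOpen_units_norm_eq_one (v : HeightOneSpectrum (𝓞 F)) :
    IsOpen {t : (v.adicCompletion F)ˣ | ‖(t : v.adicCompletion F)‖ = 1} :=
  (isOpen_norm_eq_one v).preimage Units.continuous_val

theorem isHaarMeasure_finMulMeasure_and (v : HeightOneSpectrum (𝓞 F)) :
    (finMulMeasure v).IsHaarMeasure ∧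
      finMulMeasure v {x | ‖(x : v.adicCompletion F)‖ = 1} = integersVolume v :=
  Classical.epsilon_spec (p := fun μ : Measure (v.adicCompletion F)ˣ =>
    μ.IsHaarMeasure ∧ μ {x | ‖(x : v.adicCompletion F)‖ = 1} = integersVolume v)
    (exists_isHaarMeasure_eq ⟨1, mem_interior_iff_mem_nhds.2
      ((isOpen_units_norm_eq_one v).mem_nhds (by simp))⟩ (isCompact_units_of_norm_le 1)
      (fun t ht => by
        have ht' : ‖(t : v.adicCompletion F)‖ = 1 := ht
        exact ⟨ht'.le, by rw [Units.val_inv_eq_inv_val, norm_inv, ht', inv_one]⟩) (integersVolume_ne_zero v) (integersVolume_ne_top v))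

instance isHaarMeasure_finMulMeasure (v : HeightOneSpectrum (𝓞 F)) :
    (finMulMeasure v).IsHaarMeasure := (isHaarMeasure_finMulMeasure_and v).1

theorem isAddHaarMeasure_infMeasure_and (v : InfinitePlace F) :
    (infMeasure v).IsAddHaarMeasure ∧ infMeasure v {x | ‖x‖ ≤ 1} = 2 :=
  Classical.epsilon_spec (p := fun μ : Measure v.Completion =>
    μ.IsAddHaarMeasure ∧ μ {x | ‖x‖ ≤ 1} = 2)
    (exists_isAddHaarMeasure_eq ⟨0, mem_interior_iff_mem_nhds.2
      (by simpa [Metric.closedBall] using Metric.closedBall_mem_nhds (0 : v.Completion) one_pos)⟩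
      (by simpa [Metric.closedBall] using isCompact_closedBall (0 : v.Completion) 1) subset_rfl
      two_ne_zero ENNReal.ofNat_ne_top)

instance isAddHaarMeasure_infMeasure (v : InfinitePlace F) :
    (infMeasure v).IsAddHaarMeasure := (isAddHaarMeasure_infMeasure_and v).1

theorem norm_completion_two (v : InfinitePlace F) : ‖(2 : v.Completion)‖ = 2 := by
  have := (InfinitePlace.Completion.isometry_extensionEmbedding v).norm_map_of_map_zero
    (map_zero _) 2
  rw [← this, ← one_add_one_eq_two, map_add, map_one, one_add_one_eq_two, Complex.norm_two]

theorem two_lt_exp_one : (2 : ℝ) < Real.exp 1 := by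
  have := Real.exp_one_gt_d9
  linarith

theorem isHaarMeasure_infMulMeasure_and (v : InfinitePlace F) :
    (infMulMeasure v).IsHaarMeasure ∧ infMulMeasure v
      {x | 1 ≤ ‖(x : v.Completion)‖ ∧ ‖(x : v.Completion)‖ ≤ Real.exp 1} = 2 := by
  refine Classical.epsilon_spec (p := fun μ : Measure v.Completionˣ => μ.IsHaarMeasure ∧ μ
      {x | 1 ≤ ‖(x : v.Completion)‖ ∧ ‖(x : v.Completion)‖ ≤ Real.exp 1} = 2)
    (exists_isHaarMeasure_eq ?_ (isCompact_units_of_norm_le (Real.exp 1)) ?_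
      two_ne_zero ENNReal.ofNat_ne_top)
  · have h2 : (2 : v.Completion) ≠ 0 := norm_pos_iff.1 (by rw [norm_completion_two]; simp)
    refine ⟨Units.mk0 2 h2, mem_interior.2 ⟨{x | 1 < ‖(x : v.Completion)‖ ∧
      ‖(x : v.Completion)‖ < Real.exp 1}, fun x hx => ⟨hx.1.le, hx.2.le⟩, ?_, ?_⟩⟩
    · exact (isOpen_lt continuous_const Units.continuous_val.norm).inter
        (isOpen_lt Units.continuous_val.norm continuous_const)
    · simp [norm_completion_two, two_lt_exp_one]
  · intro t ht
    refine ⟨ht.2, ?_⟩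
    rw [Units.val_inv_eq_inv_val, norm_inv]
    exact (inv_le_one_of_one_le₀ ht.1).trans (Real.one_le_exp zero_le_one)

instance isHaarMeasure_infMulMeasure (v : InfinitePlace F) :
    (infMulMeasure v).IsHaarMeasure := (isHaarMeasure_infMulMeasure_and v).1

end LocalMeasures

section GlobalMeasures

variable (F : Type*) [Field F] [NumberField F]

/-- The total volume of the boxes that normalize the global measures. -/
noncomputable def boxVolume : ℝ≥0∞ :=
  (∏ _v : InfinitePlace F, 2) * ∏ᶠ v : HeightOneSpectrum (𝓞 F), integersVolume v

theorem boxVolume_eq {S : Finset (HeightOneSpectrum (𝓞 F))}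
    (hS : ∀ v ∉ S, integersVolume v = 1) :
    boxVolume F = (∏ _v : InfinitePlace F, 2) * ∏ v ∈ S, integersVolume v := by
  rw [boxVolume, finprod_eq_prod_of_mulSupport_subset _ (s := S)]
  intro v hv
  by_contra h
  exact hv (hS v h)

theorem exists_integersVolume_eq_one : ∃ S : Finset (HeightOneSpectrum (𝓞 F)),
    ∀ v ∉ S, integersVolume v = 1 :=
  ⟨finite_integersVolume_ne_one.toFinset, fun v hv => by simpa using hv⟩

theorem boxVolume_ne_zero : boxVolume F ≠ 0 := by
  obtain ⟨S, hS⟩ := exists_integersVolume_eq_one F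
  rw [boxVolume_eq F hS]
  exact mul_ne_zero (Finset.prod_ne_zero_iff.2 fun _ _ => two_ne_zero)
    (Finset.prod_ne_zero_iff.2 fun v _ => integersVolume_ne_zero v)

theorem boxVolume_ne_top : boxVolume F ≠ ⊤ := by
  obtain ⟨S, hS⟩ := exists_integersVolume_eq_one F
  rw [boxVolume_eq F hS]
  exact ENNReal.mul_ne_top (ENNReal.prod_ne_top fun _ _ => ENNReal.ofNat_ne_top)
    (ENNReal.prod_ne_top fun v _ => integersVolume_ne_top v)

theorem isAddHaarMeasure_adeleMeasure_and : (adeleMeasure F).IsAddHaarMeasure ∧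
    adeleMeasure F {x | (∀ v : InfinitePlace F, ‖infEval v x‖ ≤ 1) ∧
      ∀ v : HeightOneSpectrum (𝓞 F), ‖finEval v x‖ ≤ 1} = boxVolume F := by
  refine Classical.epsilon_spec (p := fun μ : Measure (Adele F) => μ.IsAddHaarMeasure ∧
    μ {x | (∀ v : InfinitePlace F, ‖infEval v x‖ ≤ 1) ∧
      ∀ v : HeightOneSpectrum (𝓞 F), ‖finEval v x‖ ≤ 1} = boxVolume F)
    (exists_isAddHaarMeasure_eq ?_ (isCompact_adeleBox 1 (R := fun _ => 1) (.of_forall fun _ => rfl))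
      subset_rfl (boxVolume_ne_zero F) (boxVolume_ne_top F))
  refine ⟨0, mem_interior.2 ⟨{x | (∀ v : InfinitePlace F, ‖infEval v x‖ < 1) ∧
      ∀ v : HeightOneSpectrum (𝓞 F), True → ‖finEval v x‖ ≤ 1},
    fun x hx => ⟨fun v => (hx.1 v).le, fun v => hx.2 v trivial⟩, ?_, ?_⟩⟩
  · have h : IsOpen {x : Adele F | ∀ v : InfinitePlace F, ‖infEval v x‖ < 1} := by
      simp only [Set.ofPred_forall]
      exact isOpen_iInter_of_finite fun v => isOpen_lt (continuous_infEval v).norm continuous_const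
    exact h.inter (isOpen_forall_imp_finEval_le_one fun _ => True)
  · simp

instance isAddHaarMeasure_adeleMeasure : (adeleMeasure F).IsAddHaarMeasure :=
  (isAddHaarMeasure_adeleMeasure_and F).1

theorem adeleMeasure_box : adeleMeasure F (adeleBox 1 fun _ => 1) = boxVolume F :=
  (isAddHaarMeasure_adeleMeasure_and F).2

open scoped Classical in
variable {F} in
/-- The adele with given components at the infinite places and at a finite set of finite places,
and `c` at the others. -/
noncomputable def adeleOfFinset (S : Finset (HeightOneSpectrum (𝓞 F)))
    (y : ∀ v : InfinitePlace F, v.Completion) (z : ∀ v : S, v.1.adicCompletion F) : Adele F :=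
  (y, ⟨fun v => if h : v ∈ S then z ⟨v, h⟩ else 1, by
    filter_upwards [S.finite_toSet.compl_mem_cofinite] with v hv
    have hv' : v ∉ S := hv
    simp only [hv', dif_neg, not_false_eq_true]
    exact one_mem _⟩)

variable {F} in
theorem infEval_adeleOfFinset (S : Finset (HeightOneSpectrum (𝓞 F)))
    (y : ∀ v : InfinitePlace F, v.Completion) (z : ∀ v : S, v.1.adicCompletion F) (v) :
    infEval v (adeleOfFinset S y z) = y v := rfl

variable {F} in
theorem finEval_adeleOfFinset_mem (S : Finset (HeightOneSpectrum (𝓞 F)))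
    (y : ∀ v : InfinitePlace F, v.Completion) (z : ∀ v : S, v.1.adicCompletion F) (v : S) :
    finEval v.1 (adeleOfFinset S y z) = z v := dif_pos v.2

variable {F} in
theorem finEval_adeleOfFinset_notMem (S : Finset (HeightOneSpectrum (𝓞 F)))
    (y : ∀ v : InfinitePlace F, v.Completion) (z : ∀ v : S, v.1.adicCompletion F) {v}
    (hv : v ∉ S) : finEval v (adeleOfFinset S y z) = 1 := dif_neg hv

variable {F} in
theorem adele_ext {x y : Adele F} (h1 : ∀ v, infEval v x = infEval v y)
    (h2 : ∀ v, finEval v x = finEval v y) : x = y :=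
  Prod.ext (funext h1) (FiniteAdeleRing.ext F h2)

open scoped Classical in
variable {F} in
/-- The idele with given components at the infinite places and at a finite set of finite places,
and `1` at the others. -/
noncomputable def ideleOfFinset (S : Finset (HeightOneSpectrum (𝓞 F)))
    (y : ∀ v : InfinitePlace F, v.Completionˣ) (z : ∀ v : S, (v.1.adicCompletion F)ˣ) :
    (Adele F)ˣ where
  val := adeleOfFinset S (fun v => y v) (fun v => z v)
  inv := adeleOfFinset S (fun v => ((y v)⁻¹ : v.Completionˣ)) (fun v => ((z v)⁻¹ : _ˣ))
  val_inv := adele_ext (fun v => by simp [infEval_adeleOfFinset]) fun v => by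
    rw [map_mul, map_one]
    by_cases hv : v ∈ S
    · rw [finEval_adeleOfFinset_mem S _ _ ⟨v, hv⟩, finEval_adeleOfFinset_mem S _ _ ⟨v, hv⟩,
        Units.mul_inv]
    · rw [finEval_adeleOfFinset_notMem S _ _ hv, finEval_adeleOfFinset_notMem S _ _ hv, one_mul]
  inv_val := adele_ext (fun v => by simp [infEval_adeleOfFinset]) fun v => by
    rw [map_mul, map_one]
    by_cases hv : v ∈ S
    · rw [finEval_adeleOfFinset_mem S _ _ ⟨v, hv⟩, finEval_adeleOfFinset_mem S _ _ ⟨v, hv⟩,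
        Units.inv_mul]
    · rw [finEval_adeleOfFinset_notMem S _ _ hv, finEval_adeleOfFinset_notMem S _ _ hv, one_mul]

variable {F} in
/-- The component of an idele at an infinite place. -/
noncomputable def infUnit (v : InfinitePlace F) : (Adele F)ˣ →* v.Completionˣ := Units.map (infEval v).toMonoidHom

variable {F} in
/-- The component of an idele at a finite place. -/
noncomputable def finUnit (v : HeightOneSpectrum (𝓞 F)) : (Adele F)ˣ →* (v.adicCompletion F)ˣ :=
  Units.map (finEval v).toMonoidHom

variable {F} in
theorem continuous_infUnit (v : InfinitePlace F) :
    Continuous (infUnit v : (Adele F)ˣ → v.Completionˣ) :=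
  Continuous.units_map _ (continuous_infEval v)

variable {F} in
theorem continuous_finUnit (v : HeightOneSpectrum (𝓞 F)) :
    Continuous (finUnit v : (Adele F)ˣ → (v.adicCompletion F)ˣ) :=
  Continuous.units_map _ (continuous_finEval v)

theorem isHaarMeasure_ideleMeasure_and : (ideleMeasure F).IsHaarMeasure ∧
    ideleMeasure F {x | (∀ v : InfinitePlace F, 1 ≤ ‖infEval v (x : Adele F)‖ ∧
        ‖infEval v (x : Adele F)‖ ≤ Real.exp 1) ∧
      ∀ v : HeightOneSpectrum (𝓞 F), ‖finEval v (x : Adele F)‖ = 1} = boxVolume F := by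
  refine Classical.epsilon_spec (p := fun μ : Measure (Adele F)ˣ => μ.IsHaarMeasure ∧
    μ {x | (∀ v : InfinitePlace F, 1 ≤ ‖infEval v (x : Adele F)‖ ∧
        ‖infEval v (x : Adele F)‖ ≤ Real.exp 1) ∧
      ∀ v : HeightOneSpectrum (𝓞 F), ‖finEval v (x : Adele F)‖ = 1} = boxVolume F)
    (exists_isHaarMeasure_eq ?_ (isCompact_ideleBox (Real.exp 1) (R := fun _ => 1)
      (.of_forall fun _ => rfl)) ?_ (boxVolume_ne_zero F) (boxVolume_ne_top F))
  · have h2 : ∀ v : InfinitePlace F, (2 : v.Completion) ≠ 0 := fun v =>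
      norm_pos_iff.1 (by rw [norm_completion_two]; simp)
    refine ⟨ideleOfFinset ∅ (fun v => Units.mk0 2 (h2 v)) (fun v => 1), mem_interior.2
      ⟨{x | (∀ v : InfinitePlace F, 1 < ‖infEval v (x : Adele F)‖ ∧
        ‖infEval v (x : Adele F)‖ < Real.exp 1) ∧
        ∀ v : HeightOneSpectrum (𝓞 F), True → ‖finEval v (x : Adele F)‖ = 1},
      fun x hx => ⟨fun v => ⟨(hx.1 v).1.le, (hx.1 v).2.le⟩, fun v => hx.2 v trivial⟩, ?_, ?_⟩⟩
    · have h : IsOpen {x : (Adele F)ˣ | ∀ v : InfinitePlace F, 1 < ‖infEval v (x : Adele F)‖ ∧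
          ‖infEval v (x : Adele F)‖ < Real.exp 1} := by
        simp only [Set.ofPred_forall]
        refine isOpen_iInter_of_finite fun v => ?_
        have hc := ((continuous_infEval v).comp (Units.continuous_val (M := Adele F))).norm
        exact (isOpen_lt continuous_const hc).inter (isOpen_lt hc continuous_const)
      exact h.inter (isOpen_forall_imp_finEval_eq_one fun _ => True)
    · refine ⟨fun v => ?_, fun v _ => ?_⟩
      · change 1 < ‖(2 : v.Completion)‖ ∧ ‖(2 : v.Completion)‖ < Real.exp 1
        rw [norm_completion_two]
        exact ⟨one_lt_two, two_lt_exp_one⟩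
      · have : finEval v ((ideleOfFinset ∅ (fun v => Units.mk0 2 (h2 v)) (fun v => 1) :
            (Adele F)ˣ) : Adele F) = 1 := finEval_adeleOfFinset_notMem _ _ _ (by simp)
        rw [this, norm_one]
  · intro t ht
    refine ⟨⟨fun v => (ht.1 v).2, fun v => (ht.2 v).le⟩, fun v => ?_, fun v => ?_⟩
    · rw [norm_infEval_units]
      exact (inv_le_one_of_one_le₀ (ht.1 v).1).trans (Real.one_le_exp zero_le_one)
    · rw [norm_finEval_units, ht.2 v, inv_one]

instance isHaarMeasure_ideleMeasure : (ideleMeasure F).IsHaarMeasure :=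
  (isHaarMeasure_ideleMeasure_and F).1

end GlobalMeasures


open scoped ENNReal

section

variable (F : Type*) [Field F] [NumberField F]

/-- Adeles integral outside `S`. -/
def integralOutside (S : Finset (HeightOneSpectrum (𝓞 F))) : AddSubgroup (Adele F) where
  carrier := {x | ∀ v ∉ S, finEval v x ∈ {y | ‖y‖ ≤ 1}}
  zero_mem' v _ := by simp
  add_mem' {x y} hx hy v hv := by
    have h := IsUltrametricDist.norm_add_le_max (finEval v x) (finEval v y)
    rw [← map_add] at h
    exact h.trans (max_le (hx v hv) (hy v hv))
  neg_mem' {x} hx v hv := by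
    have h : ‖finEval v x‖ ≤ 1 := hx v hv
    simpa only [map_neg, norm_neg, Set.mem_ofPred_eq] using h

/-- Ideles that are units outside `S`. -/
def unitsOutside (S : Finset (HeightOneSpectrum (𝓞 F))) : Subgroup (Adele F)ˣ where
  carrier := {t | ∀ v ∉ S, finUnit v t ∈ {y : (v.adicCompletion F)ˣ | ‖(y : v.adicCompletion F)‖ = 1}}
  one_mem' v _ := by simp
  mul_mem' {x y} hx hy v hv := by
    have h1 : ‖((finUnit v x : (v.adicCompletion F)ˣ) : v.adicCompletion F)‖ = 1 := hx v hv
    have h2 : ‖((finUnit v y : (v.adicCompletion F)ˣ) : v.adicCompletion F)‖ = 1 := hy v hv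
    simp only [map_mul, Set.mem_ofPred_eq, Units.val_mul, norm_mul, h1, h2, mul_one]
  inv_mem' {x} hx v hv := by
    have h1 : ‖((finUnit v x : (v.adicCompletion F)ˣ) : v.adicCompletion F)‖ = 1 := hx v hv
    simp only [map_inv, Set.mem_ofPred_eq, Units.val_inv_eq_inv_val, norm_inv, h1, inv_one]

variable {F}

theorem val_infUnit (v : InfinitePlace F) (t : (Adele F)ˣ) :
    ((infUnit v t : v.Completionˣ) : v.Completion) = infEval v (t : Adele F) := rfl

theorem val_finUnit (v : HeightOneSpectrum (𝓞 F)) (t : (Adele F)ˣ) :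
    ((finUnit v t : (v.adicCompletion F)ˣ) : v.adicCompletion F) = finEval v (t : Adele F) := rfl

theorem measurable_infEval (v : InfinitePlace F) : Measurable (infEval v : Adele F → v.Completion) :=
  (continuous_infEval v).measurable

theorem measurable_finEval (v : HeightOneSpectrum (𝓞 F)) :
    Measurable (finEval v : Adele F → v.adicCompletion F) :=
  (continuous_finEval v).measurable

variable (F)

/-- The self-dual measure of the adeles is the restricted product of the local measures. -/
theorem isRestrictedProductMeasure_adele :
    IsRestrictedProductMeasure (adeleMeasure F) (fun v : InfinitePlace F => infEval v)
      (fun v : HeightOneSpectrum (𝓞 F) => finEval v) (fun v => {x | ‖x‖ ≤ 1})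
      infMeasure finMeasure where
  measurable_left := measurable_infEval
  measurable_right := measurable_finEval
  measurableSet S := (isOpen_forall_imp_finEval_le_one fun v => v ∉ S).measurableSet
  eventually_mem := eventually_finEval_le_one
  map_eq := by
    obtain ⟨S₀, hS₀⟩ := exists_integersVolume_eq_one F
    refine ⟨S₀, fun S hS => ?_⟩
    let p : Adele F →+ (∀ v : InfinitePlace F, v.Completion) × (∀ v : S, v.1.adicCompletion F) :=
      (AddMonoidHom.pi fun v => (infEval v).toAddMonoidHom).prod
        (AddMonoidHom.pi fun v : S => (finEval v.1).toAddMonoidHom)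
    have hp : Continuous p := (continuous_pi fun v => continuous_infEval v).prodMk
      (continuous_pi fun v => continuous_finEval v.1)
    have hB : MeasurableSet ((Set.univ.pi fun v : InfinitePlace F => {x : v.Completion | ‖x‖ ≤ 1}) ×ˢ
        (Set.univ.pi fun v : S => {x : v.1.adicCompletion F | ‖x‖ ≤ 1})) :=
      (MeasurableSet.univ_pi fun v => (isClosed_le continuous_norm continuous_const).measurableSet).prod
        (MeasurableSet.univ_pi fun v =>
          (isClosed_le continuous_norm continuous_const).measurableSet)
    have hν : ((Measure.pi (infMeasure (F := F))).prod (Measure.pi fun v : S => finMeasure v.1))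
        ((Set.univ.pi fun v : InfinitePlace F => {x : v.Completion | ‖x‖ ≤ 1}) ×ˢ
        (Set.univ.pi fun v : S => {x : v.1.adicCompletion F | ‖x‖ ≤ 1})) = boxVolume F := by
      rw [Measure.prod_prod, Measure.pi_pi, Measure.pi_pi,
        boxVolume_eq F (S := S) fun v hv => hS₀ v fun h => hv (hS h)]
      simp only [(isAddHaarMeasure_infMeasure_and _).2, (isAddHaarMeasure_finMeasure_and _).2]
      rw [Finset.prod_coe_sort S integersVolume]
    have h1 : (Measure.pi (infMeasure (F := F))).IsAddHaarMeasure := Measure.pi.isAddHaarMeasure _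
    have h2 : (Measure.pi fun v : S => finMeasure v.1).IsAddHaarMeasure :=
      Measure.pi.isAddHaarMeasure _
    have h3 := Measure.prod.instIsAddHaarMeasure (Measure.pi (infMeasure (F := F)))
      (Measure.pi fun v : S => finMeasure v.1)
    refine map_restrict_eq_of_isAddHaarMeasure (integralOutside F S) p hp ?_ ?_ (adeleMeasure F) _
      hB (hν ▸ boxVolume_ne_zero F) (hν ▸ boxVolume_ne_top F) ?_
    · rintro ⟨y, z⟩
      refine ⟨adeleOfFinset S y z, fun v hv => ?_, Prod.ext rfl (funext fun v => ?_)⟩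
      · simp [finEval_adeleOfFinset_notMem S y z hv]
      · exact finEval_adeleOfFinset_mem S y z v
    · intro K hK
      classical
      obtain ⟨r, hr⟩ := hK.isBounded.exists_norm_le
      refine ⟨_, isCompact_adeleBox r (R := fun v => if v ∈ S then r else 1) ?_, ?_⟩
      · filter_upwards [S.finite_toSet.compl_mem_cofinite] with v hv
        have hv' : v ∉ S := hv
        simp [hv']
      · rintro x ⟨hx, hxK⟩
        have h := hr _ hxK
        refine ⟨fun v => ?_, fun v => ?_⟩
        · exact ((norm_le_pi_norm (p x).1 v).trans (norm_fst_le _)).trans h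
        · by_cases hv : v ∈ S
          · simp only [hv, if_true]
            exact ((norm_le_pi_norm (p x).2 ⟨v, hv⟩).trans (norm_snd_le _)).trans h
          · simp only [hv, if_false]
            exact hx v hv
    · rw [hν, ← adeleMeasure_box F]
      congr 1
      ext x
      refine ⟨fun h => ⟨fun v => h.2.1 v trivial, fun v => ?_⟩,
        fun h => ⟨fun v _ => h.2 v, fun v _ => h.1 v, fun v _ => h.2 v.1⟩⟩
      by_cases hv : v ∈ S
      · exact h.2.2 ⟨v, hv⟩ trivial
      · exact h.1 v hv

/-- The Haar measure of the ideles is the restricted product of the local measures. -/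
theorem isRestrictedProductMeasure_idele :
    IsRestrictedProductMeasure (ideleMeasure F) (fun v : InfinitePlace F => infUnit v)
      (fun v : HeightOneSpectrum (𝓞 F) => finUnit v)
      (fun v => {x : (v.adicCompletion F)ˣ | ‖(x : v.adicCompletion F)‖ = 1})
      infMulMeasure finMulMeasure where
  measurable_left v := (continuous_infUnit v).measurable
  measurable_right v := (continuous_finUnit v).measurable
  measurableSet S := (isOpen_forall_imp_finEval_eq_one fun v => v ∉ S).measurableSet
  eventually_mem := eventually_finEval_eq_one
  map_eq := by
    obtain ⟨S₀, hS₀⟩ := exists_integersVolume_eq_one F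
    refine ⟨S₀, fun S hS => ?_⟩
    let p : (Adele F)ˣ →* (∀ v : InfinitePlace F, v.Completionˣ) ×
        (∀ v : S, (v.1.adicCompletion F)ˣ) :=
      (MonoidHom.pi fun v => infUnit v).prod (MonoidHom.pi fun v : S => finUnit v.1)
    have hp : Continuous p := (continuous_pi fun v => continuous_infUnit v).prodMk
      (continuous_pi fun v => continuous_finUnit v.1)
    have hB : MeasurableSet ((Set.univ.pi fun v : InfinitePlace F =>
        {x : v.Completionˣ | 1 ≤ ‖(x : v.Completion)‖ ∧ ‖(x : v.Completion)‖ ≤ Real.exp 1}) ×ˢ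
        (Set.univ.pi fun v : S =>
          {x : (v.1.adicCompletion F)ˣ | ‖(x : v.1.adicCompletion F)‖ = 1})) :=
      (MeasurableSet.univ_pi fun v =>
        ((isClosed_le continuous_const Units.continuous_val.norm).inter
          (isClosed_le Units.continuous_val.norm continuous_const)).measurableSet).prod
        (MeasurableSet.univ_pi fun v =>
          (isOpen_units_norm_eq_one v.1).measurableSet)
    have hν : ((Measure.pi (infMulMeasure (F := F))).prod
        (Measure.pi fun v : S => finMulMeasure v.1)) ((Set.univ.pi fun v : InfinitePlace F =>
        {x : v.Completionˣ | 1 ≤ ‖(x : v.Completion)‖ ∧ ‖(x : v.Completion)‖ ≤ Real.exp 1}) ×ˢ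
        (Set.univ.pi fun v : S =>
          {x : (v.1.adicCompletion F)ˣ | ‖(x : v.1.adicCompletion F)‖ = 1})) = boxVolume F := by
      rw [Measure.prod_prod, Measure.pi_pi, Measure.pi_pi,
        boxVolume_eq F (S := S) fun v hv => hS₀ v fun h => hv (hS h)]
      simp only [(isHaarMeasure_infMulMeasure_and _).2, (isHaarMeasure_finMulMeasure_and _).2]
      rw [Finset.prod_coe_sort S integersVolume]
    have h1 : (Measure.pi (infMulMeasure (F := F))).IsHaarMeasure := Measure.pi.isHaarMeasure _
    have h2 : (Measure.pi fun v : S => finMulMeasure v.1).IsHaarMeasure :=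
      Measure.pi.isHaarMeasure _
    have h3 := Measure.prod.instIsHaarMeasure (Measure.pi (infMulMeasure (F := F)))
      (Measure.pi fun v : S => finMulMeasure v.1)
    refine map_restrict_eq_of_isHaarMeasure (unitsOutside F S) p hp ?_ ?_ (ideleMeasure F) _
      hB (hν ▸ boxVolume_ne_zero F) (hν ▸ boxVolume_ne_top F) ?_
    · rintro ⟨y, z⟩
      refine ⟨ideleOfFinset S y z, fun v hv => ?_, Prod.ext (funext fun v => Units.ext ?_)
        (funext fun v => Units.ext ?_)⟩
      · have := finEval_adeleOfFinset_notMem S (fun v => (y v : v.Completion))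
          (fun v => (z v : v.1.adicCompletion F)) hv
        change ‖finEval v (adeleOfFinset S (fun v => (y v : v.Completion))
          (fun v => (z v : v.1.adicCompletion F)))‖ = 1
        rw [this, norm_one]
      · rfl
      · exact finEval_adeleOfFinset_mem S (fun v => (y v : v.Completion))
          (fun v => (z v : v.1.adicCompletion F)) v
    · intro K hK
      classical
      let n : (∀ v : InfinitePlace F, v.Completionˣ) × (∀ v : S, (v.1.adicCompletion F)ˣ) → ℝ :=
        fun q => ((∑ v, ‖(q.1 v : v.Completion)‖) + ∑ v, ‖(((q.1 v)⁻¹ : _ˣ) : v.Completion)‖) +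
          ((∑ v, ‖(q.2 v : v.1.adicCompletion F)‖) +
            ∑ v, ‖(((q.2 v)⁻¹ : _ˣ) : v.1.adicCompletion F)‖)
      have hn : Continuous n := by
        refine .add (.add ?_ ?_) (.add ?_ ?_) <;> refine continuous_finsetSum _ fun v _ => .norm ?_
        · exact Units.continuous_val.comp ((continuous_apply v).comp continuous_fst)
        · exact Units.continuous_coe_inv.comp ((continuous_apply v).comp continuous_fst)
        · exact Units.continuous_val.comp ((continuous_apply v).comp continuous_snd)
        · exact Units.continuous_coe_inv.comp ((continuous_apply v).comp continuous_snd)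
      obtain ⟨r, hr⟩ := hK.bddAbove_image hn.continuousOn
      refine ⟨_, isCompact_ideleBox r (R := fun v => if v ∈ S then r else 1) ?_, ?_⟩
      · filter_upwards [S.finite_toSet.compl_mem_cofinite] with v hv
        have hv' : v ∉ S := hv
        simp [hv']
      · rintro t ⟨ht, htK⟩
        have h : n (p t) ≤ r := hr ⟨_, htK, rfl⟩
        have key1 : ∀ v, ‖infEval v (t : Adele F)‖ ≤ ∑ v, ‖(((p t).1 v : _ˣ) : v.Completion)‖ :=
          fun v => Finset.single_le_sum (f := fun v => ‖(((p t).1 v : _ˣ) : v.Completion)‖)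
            (fun _ _ => norm_nonneg _) (Finset.mem_univ v)
        have key2 : ∀ v, ‖infEval v ((t⁻¹ : (Adele F)ˣ) : Adele F)‖ ≤
            ∑ v, ‖((((p t).1 v)⁻¹ : _ˣ) : v.Completion)‖ :=
          fun v => Finset.single_le_sum (f := fun v => ‖((((p t).1 v)⁻¹ : _ˣ) : v.Completion)‖)
            (fun _ _ => norm_nonneg _) (Finset.mem_univ v)
        have key3 : ∀ v : S, ‖finEval v.1 (t : Adele F)‖ ≤
            ∑ v, ‖(((p t).2 v : _ˣ) : v.1.adicCompletion F)‖ :=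
          fun v => Finset.single_le_sum (f := fun v => ‖(((p t).2 v : _ˣ) : v.1.adicCompletion F)‖)
            (fun _ _ => norm_nonneg _) (Finset.mem_univ v)
        have key4 : ∀ v : S, ‖finEval v.1 ((t⁻¹ : (Adele F)ˣ) : Adele F)‖ ≤
            ∑ v, ‖((((p t).2 v)⁻¹ : _ˣ) : v.1.adicCompletion F)‖ :=
          fun v => Finset.single_le_sum
            (f := fun v => ‖((((p t).2 v)⁻¹ : _ˣ) : v.1.adicCompletion F)‖)
            (fun _ _ => norm_nonneg _) (Finset.mem_univ v)
        have p1 : 0 ≤ ∑ v, ‖(((p t).1 v : _ˣ) : v.Completion)‖ :=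
          Finset.sum_nonneg fun _ _ => norm_nonneg _
        have p2 : 0 ≤ ∑ v, ‖((((p t).1 v)⁻¹ : _ˣ) : v.Completion)‖ :=
          Finset.sum_nonneg fun _ _ => norm_nonneg _
        have p3 : 0 ≤ ∑ v, ‖(((p t).2 v : _ˣ) : v.1.adicCompletion F)‖ :=
          Finset.sum_nonneg fun _ _ => norm_nonneg _
        have p4 : 0 ≤ ∑ v, ‖((((p t).2 v)⁻¹ : _ˣ) : v.1.adicCompletion F)‖ :=
          Finset.sum_nonneg fun _ _ => norm_nonneg _
        simp only [n] at h
        refine ⟨⟨fun v => ?_, fun v => ?_⟩, fun v => ?_, fun v => ?_⟩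
        · linarith [key1 v]
        · by_cases hv : v ∈ S
          · simp only [hv, if_true]
            linarith [key3 ⟨v, hv⟩]
          · simp only [hv, if_false]
            exact (ht v hv).le
        · linarith [key2 v]
        · by_cases hv : v ∈ S
          · simp only [hv, if_true]
            linarith [key4 ⟨v, hv⟩]
          · simp only [hv, if_false]
            have : ‖finEval v (t : Adele F)‖ = 1 := ht v hv
            rw [norm_finEval_units, this, inv_one]
    · rw [hν, ← (isHaarMeasure_ideleMeasure_and F).2]
      congr 1
      ext x
      refine ⟨fun h => ⟨fun v => h.2.1 v trivial, fun v => ?_⟩,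
        fun h => ⟨fun v _ => h.2 v, fun v _ => h.1 v, fun v _ => h.2 v.1⟩⟩
      by_cases hv : v ∈ S
      · exact h.2.2 ⟨v, hv⟩ trivial
      · exact h.1 v hv

end


open scoped ENNReal Pointwise

section Products

theorem pi_prod_eq_map {ι : Type*} [Fintype ι] {Y Y' : ι → Type*} [∀ i, MeasurableSpace (Y i)]
    [∀ i, MeasurableSpace (Y' i)] (ρ : ∀ i, Measure (Y i)) (ρ' : ∀ i, Measure (Y' i))
    [∀ i, SigmaFinite (ρ i)] [∀ i, SigmaFinite (ρ' i)] :
    Measure.pi (fun i => (ρ i).prod (ρ' i)) =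
      ((Measure.pi ρ).prod (Measure.pi ρ')).map fun q i => (q.1 i, q.2 i) := by
  have hm : Measurable fun (q : (∀ i, Y i) × (∀ i, Y' i)) i => (q.1 i, q.2 i) := by fun_prop
  refine Measure.pi_eq_generateFrom (C := fun i => Set.image2 (· ×ˢ ·)
    {s : Set (Y i) | MeasurableSet s} {t : Set (Y' i) | MeasurableSet t})
    (fun i => generateFrom_prod) (fun i => isPiSystem_prod)
    (fun i => (ρ i).toFiniteSpanningSetsIn.prod (ρ' i).toFiniteSpanningSetsIn) fun s hs => ?_
  choose a ha b hb hab using hs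
  obtain rfl : (fun i => a i ×ˢ b i) = s := funext hab
  rw [Measure.map_apply hm (.univ_pi fun i => (ha i).prod (hb i))]
  have : (fun (q : (∀ i, Y i) × (∀ i, Y' i)) i => (q.1 i, q.2 i)) ⁻¹'
      Set.univ.pi (fun i => a i ×ˢ b i) = Set.univ.pi a ×ˢ Set.univ.pi b := by
    ext q
    simp [forall_and]
  rw [this, Measure.prod_prod, Measure.pi_pi, Measure.pi_pi, ← Finset.prod_mul_distrib]
  simp_rw [Measure.prod_prod]

theorem map_prod_prod_comm {A B C D : Type*} [MeasurableSpace A] [MeasurableSpace B]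
    [MeasurableSpace C] [MeasurableSpace D] (μ : Measure A) (ν : Measure B) (μ' : Measure C)
    (ν' : Measure D) [SFinite μ] [SFinite ν] [SFinite μ'] [SFinite ν'] :
    ((μ.prod ν).prod (μ'.prod ν')).map (fun q => ((q.1.1, q.2.1), (q.1.2, q.2.2))) =
      (μ.prod μ').prod (ν.prod ν') := by
  refine Measure.ext_of_lintegral _ fun f hf => ?_
  rw [lintegral_map hf (by fun_prop), lintegral_prod _ (by fun_prop),
    lintegral_prod _ (by fun_prop), lintegral_prod _ (by fun_prop), lintegral_prod _ (by fun_prop)]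
  refine lintegral_congr fun a => ?_
  have h1 : ∀ b, ∫⁻ q : C × D, f ((a, q.1), (b, q.2)) ∂(μ'.prod ν') =
      ∫⁻ c, ∫⁻ d, f ((a, c), (b, d)) ∂ν' ∂μ' := fun b => lintegral_prod _ (by fun_prop)
  have h2 : ∀ c, ∫⁻ q : B × D, f ((a, c), q) ∂(ν.prod ν') =
      ∫⁻ b, ∫⁻ d, f ((a, c), (b, d)) ∂ν' ∂ν := fun c => lintegral_prod _ (by fun_prop)
  simp_rw [h1, h2]
  refine lintegral_lintegral_swap (Measurable.aemeasurable ?_)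
  have : Measurable fun q : (B × C) × D => f ((a, q.1.2), (q.1.1, q.2)) := by fun_prop
  exact this.lintegral_prod_right'

/-- The product of two restricted product measures is one. -/
theorem IsRestrictedProductMeasure.prod {X X' I J : Type*} [MeasurableSpace X]
    [MeasurableSpace X'] [Fintype I] {Y Y' : I → Type*} {Z Z' : J → Type*}
    [∀ i, MeasurableSpace (Y i)] [∀ j, MeasurableSpace (Z j)]
    [∀ i, MeasurableSpace (Y' i)] [∀ j, MeasurableSpace (Z' j)]
    {μ : Measure X} {a : ∀ i, X → Y i} {b : ∀ j, X → Z j} {C : ∀ j, Set (Z j)}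
    {ρ : ∀ i, Measure (Y i)} {τ : ∀ j, Measure (Z j)}
    {μ' : Measure X'} {a' : ∀ i, X' → Y' i} {b' : ∀ j, X' → Z' j} {C' : ∀ j, Set (Z' j)}
    {ρ' : ∀ i, Measure (Y' i)} {τ' : ∀ j, Measure (Z' j)}
    [SigmaFinite μ] [SigmaFinite μ']
    [∀ i, SigmaFinite (ρ i)] [∀ j, SigmaFinite (τ j)]
    [∀ i, SigmaFinite (ρ' i)] [∀ j, SigmaFinite (τ' j)]
    (h : IsRestrictedProductMeasure μ a b C ρ τ)
    (h' : IsRestrictedProductMeasure μ' a' b' C' ρ' τ') :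
    IsRestrictedProductMeasure (μ.prod μ') (fun i (x : X × X') => (a i x.1, a' i x.2))
      (fun j (x : X × X') => (b j x.1, b' j x.2)) (fun j => C j ×ˢ C' j)
      (fun i => (ρ i).prod (ρ' i)) (fun j => (τ j).prod (τ' j)) where
  measurable_left i := ((h.measurable_left i).comp measurable_fst).prodMk
    ((h'.measurable_left i).comp measurable_snd)
  measurable_right j := ((h.measurable_right j).comp measurable_fst).prodMk
    ((h'.measurable_right j).comp measurable_snd)
  measurableSet S := by
    convert! (h.measurableSet S).prod (h'.measurableSet S) using 1
    ext x
    simp [forall_and]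
  eventually_mem x := (h.eventually_mem x.1).and (h'.eventually_mem x.2)
  map_eq := by
    classical
    obtain ⟨S₀, hS₀⟩ := h.map_eq
    obtain ⟨S₁, hS₁⟩ := h'.map_eq
    refine ⟨S₀ ∪ S₁, fun S hS => ?_⟩
    have e0 := hS₀ S (Finset.subset_union_left.trans hS)
    have e1 := hS₁ S (Finset.subset_union_right.trans hS)
    have hset : {x : X × X' | ∀ j ∉ S, (b j x.1, b' j x.2) ∈ C j ×ˢ C' j} =
        {x | ∀ j ∉ S, b j x ∈ C j} ×ˢ {x | ∀ j ∉ S, b' j x ∈ C' j} := by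
      ext x
      simp [forall_and]
    have : SigmaFinite (Measure.map (fun x => ((fun i => a i x), fun j : S => b j x))
      (μ.restrict {x | ∀ j ∉ S, b j x ∈ C j})) := by rw [e0]; infer_instance
    have : SigmaFinite (Measure.map (fun x => ((fun i => a' i x), fun j : S => b' j x))
      (μ'.restrict {x | ∀ j ∉ S, b' j x ∈ C' j})) := by rw [e1]; infer_instance
    have e := Measure.map_prod_map (μ.restrict {x | ∀ j ∉ S, b j x ∈ C j})
      (μ'.restrict {x | ∀ j ∉ S, b' j x ∈ C' j}) (h.measurable_map S) (h'.measurable_map S)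
    rw [e0, e1, Measure.prod_restrict, ← hset] at e
    have hA : Measurable fun (q : (∀ i, Y i) × (∀ i, Y' i)) i => (q.1 i, q.2 i) := by fun_prop
    have hB : Measurable fun (q : (∀ j : S, Z j) × (∀ j : S, Z' j)) j => (q.1 j, q.2 j) := by
      fun_prop
    have hs : Measurable fun q : ((∀ i, Y i) × (∀ j : S, Z j)) × ((∀ i, Y' i) × (∀ j : S, Z' j)) =>
      ((q.1.1, q.2.1), (q.1.2, q.2.2)) := by fun_prop
    have hp := Measure.map_prod_map ((Measure.pi ρ).prod (Measure.pi ρ'))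
      ((Measure.pi fun j : S => τ j).prod (Measure.pi fun j : S => τ' j)) hA hB
    have hswap : (((Measure.pi ρ).prod (Measure.pi fun j : S => τ j)).prod
        ((Measure.pi ρ').prod (Measure.pi fun j : S => τ' j))).map
          (fun q => ((q.1.1, q.2.1), (q.1.2, q.2.2))) =
        ((Measure.pi ρ).prod (Measure.pi ρ')).prod
          ((Measure.pi fun j : S => τ j).prod (Measure.pi fun j : S => τ' j)) :=
      map_prod_prod_comm _ _ _ _
    rw [pi_prod_eq_map, pi_prod_eq_map, hp, ← hswap, e, Measure.map_map (by fun_prop) hs,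
      Measure.map_map (by fun_prop)
        ((h.measurable_map S).prodMap (h'.measurable_map S))]
    rfl

end Products

section FundamentalDomains

/-- A countable discrete subgroup has a measurable fundamental domain. -/
@[to_additive]
theorem exists_fundamentalDomain_commGroup {G : Type*} [CommGroup G] [TopologicalSpace G]
    [IsTopologicalGroup G] [SecondCountableTopology G] [MeasurableSpace G] [BorelSpace G]
    (Γ : Subgroup G) [Countable Γ] (μ : Measure G) {U : Set G} (hU : IsOpen U) (h1 : 1 ∈ U)
    (hUΓ : ∀ x ∈ U, ∀ y ∈ U, x / y ∈ Γ → x = y) : ∃ D : Set G, IsFundamentalDomain Γ D μ := by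
  obtain ⟨T, hT, hcov⟩ := TopologicalSpace.countable_cover_nhds
    (f := fun x : G => x • U) fun x => by
      simpa using smul_mem_nhds_smul x (hU.mem_nhds h1)
  obtain ⟨x, rfl⟩ : ∃ x : ℕ → G, T = Set.range x := by
    refine (hT.exists_eq_range ?_).imp fun _ h => h
    rw [Set.nonempty_iff_ne_empty]
    rintro rfl
    simp at hcov
    exact (Set.univ_nonempty (α := G)).ne_empty hcov.symm
  have hcov' : ∀ z, ∃ n, z ∈ x n • U := fun z => by
    have : z ∈ ⋃ y ∈ Set.range x, y • U := hcov ▸ Set.mem_univ z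
    simpa using! this
  have hex : ∀ z, ∃ n, ∃ γ : Γ, γ • z ∈ x n • U := fun z => by
    obtain ⟨n, hn⟩ := hcov' z
    exact ⟨n, 1, by simpa using hn⟩
  have hopen : ∀ n, IsOpen (x n • U) := fun n => hU.smul _
  have hopen2 : ∀ n, IsOpen {z | ∃ γ : Γ, γ • z ∈ x n • U} := fun n => by
    have : {z | ∃ γ : Γ, γ • z ∈ x n • U} = ⋃ γ : Γ, (fun z : G => (γ : G) * z) ⁻¹' (x n • U) := by
      ext z; simp [Subgroup.smul_def]
    rw [this]
    exact isOpen_iUnion fun γ => (hopen n).preimage (continuous_const_mul _)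
  refine ⟨⋃ n, (x n • U \ ⋃ m < n, {z | ∃ γ : Γ, γ • z ∈ x m • U}), .mk' ?_ fun z => ?_⟩
  · refine (MeasurableSet.iUnion fun n => (hopen n).measurableSet.diff ?_).nullMeasurableSet
    exact .biUnion (Set.to_countable _) fun m _ => (hopen2 m).measurableSet
  · classical
    obtain ⟨γ, hγ⟩ := Nat.find_spec (hex z)
    have hmin : ∀ m < Nat.find (hex z), ∀ γ : Γ, γ • z ∉ x m • U := fun m hm γ hγ =>
      Nat.find_min (hex z) hm ⟨γ, hγ⟩
    refine ⟨γ, Set.mem_iUnion.2 ⟨Nat.find (hex z), hγ, ?_⟩, fun δ hδ => ?_⟩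
    · simp only [Set.mem_iUnion, not_exists]
      rintro m hm ⟨δ, hδ⟩
      exact hmin m hm (δ * γ) (by rwa [mul_smul])
    · obtain ⟨n, hn, hn'⟩ := Set.mem_iUnion.1 hδ
      have : n = Nat.find (hex z) := by
        refine le_antisymm ?_ (Nat.find_min' _ ⟨δ, hn⟩)
        by_contra! hlt
        refine hn' (Set.mem_iUnion₂.2 ⟨_, hlt, γ * δ⁻¹, ?_⟩)
        rwa [← mul_smul, inv_mul_cancel_right]
      rw [this] at hn
      obtain ⟨u, hu, hu'⟩ := hn
      obtain ⟨w, hw, hw'⟩ := hγ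
      simp only [Subgroup.smul_def, smul_eq_mul] at hu' hw'
      have : u / w = (δ : G) / γ := by
        have h3 : u = (x (Nat.find (hex z)))⁻¹ * (δ * z) := by rw [← hu']; simp
        have h4 : w = (x (Nat.find (hex z)))⁻¹ * (γ * z) := by rw [← hw']; simp
        rw [h3, h4]
        rw [mul_div_mul_left_eq_div, mul_div_mul_right_eq_div]
      have hh := hUΓ u hu w hw (this ▸ Γ.div_mem δ.2 γ.2)
      rw [hh, div_self', eq_comm, div_eq_one] at this
      exact Subtype.ext this

/-- A fundamental domain has finite measure if the translates of a set of finite measure cover. -/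
@[to_additive]
theorem measure_fundamentalDomain_lt_top_of_smul_mem {G α : Type*} [Group G] [Countable G]
    [MulAction G α] [MeasurableSpace α] [MeasurableConstSMul G α] {μ : Measure α}
    [SMulInvariantMeasure G α μ] {D : Set α} (hD : IsFundamentalDomain G D μ) {C : Set α}
    (hC : μ C < ⊤) (hcov : ∀ x, ∃ g : G, g • x ∈ C) : μ D < ⊤ := by
  refine lt_of_le_of_lt ?_ hC
  rw [hD.measure_eq_tsum C]
  refine (measure_mono fun x hx => ?_).trans (measure_iUnion_le fun g : G => g • C ∩ D)
  obtain ⟨g, hg⟩ := hcov x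
  exact Set.mem_iUnion.2 ⟨g⁻¹, Set.mem_smul_set_iff_inv_smul_mem.2 (by simpa using hg), hx⟩

/-- Unfolding of a sum over `Γ` and a countable family of integrable functions. -/
@[to_additive]
theorem integral_tsum_smul_fundamentalDomain {G α J : Type*} [Group G] [Countable G]
    [MulAction G α] [MeasurableSpace α] [MeasurableConstSMul G α] {μ : Measure α}
    [SMulInvariantMeasure G α μ] [Countable J] {D : Set α} (hD : IsFundamentalDomain G D μ)
    {k : J → α → ℂ} (hk : ∀ j, Integrable (k j) μ) (hs : ∑' j, ∫⁻ x, ‖k j x‖ₑ ∂μ ≠ ⊤) :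
    IntegrableOn (fun x => ∑' p : J × G, k p.1 (p.2 • x)) D μ ∧
      ∫ x in D, ∑' p : J × G, k p.1 (p.2 • x) ∂μ = ∑' j, ∫ x, k j x ∂μ := by
  have hm : ∀ p : J × G, AEStronglyMeasurable (fun x => k p.1 (p.2 • x)) (μ.restrict D) :=
    fun p => ((hk p.1).1.comp_quasiMeasurePreserving
      (measurePreserving_smul p.2 μ).quasiMeasurePreserving).restrict
  have hsum : ∑' p : J × G, ∫⁻ x in D, ‖k p.1 (p.2 • x)‖ₑ ∂μ ≠ ⊤ := by
    rw [ENNReal.tsum_prod']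
    convert! hs using 3 with j
    exact (hD.lintegral_eq_tsum'' fun x => ‖k j x‖ₑ).symm
  have hint : ∀ p : J × G, IntegrableOn (fun x => k p.1 (p.2 • x)) D μ := fun p =>
    ⟨hm p, lt_of_le_of_lt (ENNReal.le_tsum p) hsum.lt_top⟩
  constructor
  · refine ⟨AEMeasurable.aestronglyMeasurable ?_, ?_⟩
    · exact AEMeasurable.tsum fun p => (hm p).aemeasurable
    · refine lt_of_le_of_lt (lintegral_mono fun x => enorm_tsum_le_tsum_enorm) ?_
      rw [lintegral_tsum fun p => (hm p).enorm]
      exact hsum.lt_top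
  · rw [integral_tsum hm hsum]
    have hs' : Summable fun p : J × G => ∫ x in D, k p.1 (p.2 • x) ∂μ := by
      refine .of_norm_bounded (g := fun p => (∫⁻ x in D, ‖k p.1 (p.2 • x)‖ₑ ∂μ).toReal)
        (ENNReal.summable_toReal hsum) fun p => ?_
      rw [← toReal_enorm]
      exact ENNReal.toReal_mono ((hint p).2.ne) (enorm_integral_le_lintegral_enorm _)
    rw [hs'.tsum_prod]
    exact tsum_congr fun j => (hD.integral_eq_tsum'' _ (hk j)).symm

end FundamentalDomains


open scoped ENNReal Pointwise

theorem norm_sub_le_max {E : Type*} [SeminormedAddGroup E] [IsUltrametricDist E] (x y : E) :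
    ‖x - y‖ ≤ max ‖x‖ ‖y‖ := by
  simpa [sub_eq_add_neg] using IsUltrametricDist.norm_add_le_max x (-y)

section AdeleNorm

variable {F : Type*} [Field F] [NumberField F]

theorem norm_infEval_algebraMap (v : InfinitePlace F) (x : F) :
    ‖infEval v (algebraMap F (Adele F) x)‖ = v x :=
  InfinitePlace.Completion.norm_coe v _

theorem finEval_algebraMap (v : HeightOneSpectrum (𝓞 F)) (x : F) :
    finEval v (algebraMap F (Adele F) x) = algebraMap F (v.adicCompletion F) x := rfl

theorem adeleNorm_eq_prod {t : Adele F} {S : Finset (HeightOneSpectrum (𝓞 F))}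
    (h : ∀ v ∉ S, ‖finEval v t‖ = 1) :
    adeleNorm t = (∏ v : InfinitePlace F, ‖infEval v t‖ ^ v.mult) * ∏ v ∈ S, ‖finEval v t‖ := by
  rw [adeleNorm, finprod_eq_prod_of_mulSupport_subset _ (s := S)]
  intro v hv
  by_contra hv'
  exact hv (h v hv')

theorem exists_finEval_eq_one (t : (Adele F)ˣ) : ∃ S : Finset (HeightOneSpectrum (𝓞 F)),
    ∀ v ∉ S, ‖finEval v (t : Adele F)‖ = 1 :=
  ⟨(Filter.eventually_cofinite.1 (eventually_finEval_eq_one t)).toFinset, fun v hv => by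
    simpa using hv⟩

theorem infEval_units_ne_zero (v : InfinitePlace F) (t : (Adele F)ˣ) : infEval v (t : Adele F) ≠ 0 :=
  (infUnit v t).ne_zero

theorem finEval_units_ne_zero (v : HeightOneSpectrum (𝓞 F)) (t : (Adele F)ˣ) :
    finEval v (t : Adele F) ≠ 0 :=
  (finUnit v t).ne_zero

theorem adeleNorm_mul (t t' : (Adele F)ˣ) :
    adeleNorm ((t : Adele F) * (t' : Adele F)) = adeleNorm (t : Adele F) * adeleNorm (t' : Adele F) := by
  classical
  obtain ⟨S, hS⟩ := exists_finEval_eq_one t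
  obtain ⟨S', hS'⟩ := exists_finEval_eq_one t'
  have h1 : ∀ v ∉ S ∪ S', ‖finEval v (t : Adele F)‖ = 1 := fun v hv => hS v (by grind)
  have h2 : ∀ v ∉ S ∪ S', ‖finEval v (t' : Adele F)‖ = 1 := fun v hv => hS' v (by grind)
  rw [adeleNorm_eq_prod h1, adeleNorm_eq_prod h2, adeleNorm_eq_prod (S := S ∪ S')]
  · simp only [map_mul, norm_mul, mul_pow, Finset.prod_mul_distrib]
    ring
  · intro v hv
    rw [map_mul, norm_mul, h1 v hv, h2 v hv, mul_one]

theorem adeleNorm_pos (t : (Adele F)ˣ) : 0 < adeleNorm (t : Adele F) := by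
  obtain ⟨S, hS⟩ := exists_finEval_eq_one t
  rw [adeleNorm_eq_prod hS]
  exact mul_pos (Finset.prod_pos fun v _ => pow_pos (norm_pos_iff.2 (infEval_units_ne_zero v t)) _)
    (Finset.prod_pos fun v _ => norm_pos_iff.2 (finEval_units_ne_zero v t))

theorem continuous_adeleNorm : Continuous fun t : (Adele F)ˣ => adeleNorm (t : Adele F) := by
  refine continuous_iff_continuousAt.2 fun t => ?_
  obtain ⟨S, hS⟩ := exists_finEval_eq_one t
  have hc : Continuous fun t : (Adele F)ˣ => (∏ v : InfinitePlace F,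
      ‖infEval v (t : Adele F)‖ ^ v.mult) * ∏ v ∈ S, ‖finEval v (t : Adele F)‖ := by
    refine .mul (continuous_finsetProd _ fun v _ => .pow (.norm ?_) _)
      (continuous_finsetProd _ fun v _ => .norm ?_)
    · exact (continuous_infEval v).comp Units.continuous_val
    · exact (continuous_finEval v).comp Units.continuous_val
  refine hc.continuousAt.congr ?_
  filter_upwards [(isOpen_forall_imp_finEval_eq_one fun v => v ∉ S).mem_nhds hS] with t' ht'
  exact (adeleNorm_eq_prod ht').symm

/-- The product formula. -/
theorem adeleNorm_algebraMap {x : F} (hx : x ≠ 0) : adeleNorm (algebraMap F (Adele F) x) = 1 := by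
  rw [← prod_abs_eq_one hx, adeleNorm]
  simp only [← finprod_comp_equiv FinitePlace.equivHeightOneSpectrum.symm,
    FinitePlace.equivHeightOneSpectrum_symm_apply, norm_infEval_algebraMap]
  rfl

theorem eq_zero_of_norm_lt_one {x : F} (h1 : ∀ v : InfinitePlace F, v x < 1)
    (h2 : ∀ v : HeightOneSpectrum (𝓞 F), ‖algebraMap F (v.adicCompletion F) x‖ ≤ 1) : x = 0 := by
  by_contra hx
  have h := adeleNorm_algebraMap hx
  obtain ⟨S, hS⟩ := exists_finEval_eq_one (Units.map (algebraMap F (Adele F)).toMonoidHom (Units.mk0 x hx))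
  have hS' : ∀ v ∉ S, ‖finEval v (algebraMap F (Adele F) x)‖ = 1 := hS
  rw [adeleNorm_eq_prod hS'] at h
  simp only [norm_infEval_algebraMap, finEval_algebraMap] at h
  have h3 : ∏ v : InfinitePlace F, v x ^ v.mult < 1 := by
    have hlt : ∀ v : InfinitePlace F, v x ^ v.mult < 1 := fun v =>
      pow_lt_one₀ (apply_nonneg v x) (h1 v) InfinitePlace.mult_ne_zero
    obtain ⟨w⟩ : Nonempty (InfinitePlace F) := inferInstance
    classical
    rw [← Finset.mul_prod_erase _ _ (Finset.mem_univ w)]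
    exact mul_lt_one_of_nonneg_of_lt_one_left (pow_nonneg (apply_nonneg w x) _) (hlt w)
      (Finset.prod_le_one (fun v _ => pow_nonneg (apply_nonneg v x) _) fun v _ => (hlt v).le)
  have h4 : ∏ v ∈ S, ‖algebraMap F (v.adicCompletion F) x‖ ≤ 1 :=
    Finset.prod_le_one (fun _ _ => norm_nonneg _) fun v _ => h2 v
  have h5 : 0 ≤ ∏ v ∈ S, ‖algebraMap F (v.adicCompletion F) x‖ :=
    Finset.prod_nonneg fun _ _ => norm_nonneg _
  have h6 : 0 ≤ ∏ v : InfinitePlace F, v x ^ v.mult :=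
    Finset.prod_nonneg fun v _ => pow_nonneg (apply_nonneg v x) _
  nlinarith

instance countable_principalSubgroup : Countable (AdeleRing.principalSubgroup (𝓞 F) F) :=
  Set.Countable.to_subtype (Set.countable_range (algebraMap F (Adele F)))

instance countable_principalIdeles : Countable (principalIdeles F) :=
  have : Countable Fˣ := Units.val_injective.countable
  Set.Countable.to_subtype (Set.countable_range _)

variable (F)

theorem exists_isAddFundamentalDomain_adele (μ : Measure (Adele F)) : ∃ D : Set (Adele F),
    IsAddFundamentalDomain (AdeleRing.principalSubgroup (𝓞 F) F) D μ := by
  refine exists_fundamentalDomain_addCommGroup _ μ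
    (U := (⋂ v : InfinitePlace F, {x | ‖infEval v x‖ < 1 / 2}) ∩ {x | ∀ v, True → ‖finEval v x‖ ≤ 1})
    ?_ ?_ ?_
  · exact (isOpen_iInter_of_finite fun v => isOpen_lt (continuous_infEval v).norm
      continuous_const).inter (isOpen_forall_imp_finEval_le_one _)
  · simp
  · rintro x ⟨hx1, hx2⟩ y ⟨hy1, hy2⟩ ⟨ξ, hξ⟩
    have hξ' : algebraMap F (Adele F) ξ = x - y := hξ
    simp only [Set.mem_iInter, Set.mem_ofPred_eq] at hx1 hy1
    have : ξ = 0 := by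
      refine eq_zero_of_norm_lt_one (fun v => ?_) fun v => ?_
      · rw [← norm_infEval_algebraMap, hξ', map_sub]
        linarith [norm_sub_le (infEval v x) (infEval v y), hx1 v, hy1 v]
      · rw [← finEval_algebraMap, hξ', map_sub]
        exact (norm_sub_le_max _ _).trans
          (max_le (hx2 v trivial) (hy2 v trivial))
    rw [this, map_zero] at hξ'
    exact sub_eq_zero.1 hξ'.symm

theorem exists_isFundamentalDomain_idele (μ : Measure (Adele F)ˣ) : ∃ D : Set (Adele F)ˣ,
    IsFundamentalDomain (principalIdeles F) D μ := by
  refine exists_fundamentalDomain_commGroup _ μ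
    (U := (⋂ v : InfinitePlace F, {x | ‖infEval v (x : Adele F) - 1‖ < 1 / 4}) ∩
      {x | ∀ v, True → ‖finEval v (x : Adele F)‖ = 1}) ?_ ?_ ?_
  · exact (isOpen_iInter_of_finite fun v => isOpen_lt
      (((continuous_infEval v).comp Units.continuous_val).sub continuous_const).norm
      continuous_const).inter (isOpen_forall_imp_finEval_eq_one _)
  · simp
  · rintro x ⟨hx1, hx2⟩ y ⟨hy1, hy2⟩ ⟨ξ, hξ⟩
    have hξ' : algebraMap F (Adele F) ξ * y = x := by
      have := congrArg (fun t : (Adele F)ˣ => ((t * y : (Adele F)ˣ) : Adele F)) hξ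
      simpa using! this
    simp only [Set.mem_iInter, Set.mem_ofPred_eq] at hx1 hy1
    have h0 : (ξ : F) - 1 = 0 := by
      refine eq_zero_of_norm_lt_one (fun v => ?_) fun v => ?_
      · rw [← norm_infEval_algebraMap, map_sub, map_one]
        have h1 : infEval v (algebraMap F (Adele F) ξ - 1) * infEval v (y : Adele F) =
            (infEval v (x : Adele F) - 1) - (infEval v (y : Adele F) - 1) := by
          rw [← map_mul, sub_mul, hξ', one_mul, map_sub]
          ring
        have h2 := norm_sub_le (infEval v (x : Adele F) - 1) (infEval v (y : Adele F) - 1)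
        rw [← h1, norm_mul] at h2
        have h3 := norm_sub_norm_le (1 : v.Completion) (1 - infEval v (y : Adele F))
        rw [sub_sub_cancel, norm_one, norm_sub_rev] at h3
        have h4 := hx1 v
        have h5 := hy1 v
        have h6 := norm_nonneg (infEval v (algebraMap F (Adele F) ξ - 1))
        nlinarith
      · rw [← finEval_algebraMap, map_sub, map_one]
        refine (norm_sub_le_max _ _).trans (max_le (le_of_eq ?_) norm_one.le)
        have h1 : ‖finEval v (algebraMap F (Adele F) ξ)‖ * ‖finEval v (y : Adele F)‖ = 1 := by
          rw [← norm_mul, ← map_mul, hξ', hx2 v trivial]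
        rwa [hy2 v trivial, mul_one] at h1
    rw [sub_eq_zero.1 h0, map_one, one_mul] at hξ'
    exact (Units.ext hξ').symm

/-- A compact box contains representatives of all adeles modulo `F`. -/
theorem exists_sub_mem_adeleBox : ∃ r : ℝ, ∀ x : Adele F, ∃ ξ : F,
    x - algebraMap F (Adele F) ξ ∈ adeleBox r fun _ => 1 := by
  let b := integralBasis F
  refine ⟨1 + ∑ v : InfinitePlace F, ∑ i, v (b i), fun x => ?_⟩
  obtain ⟨α, hα⟩ := exists_norm_sub_algebraMap_le_one x.2
  have hd := InfiniteAdeleRing.denseRange_algebraMap F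
  obtain ⟨β, hβ⟩ : ∃ β : F, ∀ v : InfinitePlace F,
      ‖infEval v (x - algebraMap F (Adele F) α) - infEval v (algebraMap F (Adele F) β)‖ < 1 := by
    have hopen : IsOpen {y : InfiniteAdeleRing F | ∀ v : InfinitePlace F,
        ‖infEval v (x - algebraMap F (Adele F) α) - y v‖ < 1} := by
      simp only [Set.ofPred_forall]
      exact isOpen_iInter_of_finite fun v =>
        isOpen_lt (continuous_const.sub (continuous_apply v)).norm continuous_const
    obtain ⟨β, hβ⟩ := hd.exists_mem_open hopen ⟨(x - algebraMap F (Adele F) α).1, fun v => by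
      change ‖infEval v (x - algebraMap F (Adele F) α) - infEval v (x - algebraMap F (Adele F) α)‖ < 1
      simp⟩
    exact ⟨β, hβ⟩
  have hint : ∀ i, IsIntegral ℤ (b i) := fun i => by
    rw [integralBasis_apply]; exact RingOfIntegers.isIntegral_coe _
  let γ : 𝓞 F := ∑ i, ⌊b.repr β i⌋ • RingOfIntegers.basis F i
  have hγ : β - (γ : F) = ∑ i, (Int.fract (b.repr β i) : ℚ) • b i := by
    conv_lhs => rw [← b.sum_repr β]
    simp only [γ, map_sum, ← Finset.sum_sub_distrib]
    refine Finset.sum_congr rfl fun i _ => ?_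
    rw [Int.fract, sub_smul, integralBasis_apply, zsmul_eq_mul, map_mul, map_intCast]
    congr 1
    rw [Algebra.smul_def, eq_ratCast, Rat.cast_intCast]
  refine ⟨α + γ, fun v => ?_, fun v => ?_⟩
  · have h1 : infEval v (x - algebraMap F (Adele F) (α + γ)) =
        (infEval v (x - algebraMap F (Adele F) α) - infEval v (algebraMap F (Adele F) β)) +
          infEval v (algebraMap F (Adele F) (β - γ)) := by
      simp only [map_sub, map_add]
      ring
    rw [h1]
    refine (norm_add_le _ _).trans (add_le_add (hβ v).le ?_)
    rw [norm_infEval_algebraMap, hγ]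
    have h2 : v (∑ i, (Int.fract (b.repr β i) : ℚ) • b i) ≤ ∑ i, v (b i) := by
      refine (AbsoluteValue.sum_le v.1 Finset.univ _).trans (Finset.sum_le_sum fun i _ => ?_)
      change v _ ≤ v _
      have h3 : v (((Int.fract (b.repr β i) : ℚ)) : F) ≤ 1 := by
        rw [InfinitePlace.map_ratCast]
        have h4 := Int.fract_nonneg (b.repr β i)
        have h5 := (Int.fract_lt_one (b.repr β i)).le
        rw [show ‖Int.fract (b.repr β i)‖ = ‖((Int.fract (b.repr β i) : ℚ) : ℝ)‖ from rfl,
          Real.norm_of_nonneg (by exact_mod_cast h4)]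
        exact_mod_cast h5
      rw [Algebra.smul_def, map_mul, eq_ratCast]
      exact mul_le_of_le_one_left (apply_nonneg v _) h3
    refine h2.trans (Finset.single_le_sum (f := fun v : InfinitePlace F => ∑ i, v (b i))
      (fun v _ => Finset.sum_nonneg fun i _ => apply_nonneg v _) (Finset.mem_univ v))
  · have h1 : finEval v (x - algebraMap F (Adele F) (α + γ)) =
        (x.2 v - algebraMap F (v.adicCompletion F) α) - algebraMap F (v.adicCompletion F) γ := by
      rw [map_add, ← sub_sub, map_sub]
      rfl
    rw [h1]
    exact (norm_sub_le_max _ _).trans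
      (max_le (hα v) (norm_algebraMap_int_le_one v γ))

theorem measure_adele_fundamentalDomain_lt_top {D : Set (Adele F)}
    (hD : IsAddFundamentalDomain (AdeleRing.principalSubgroup (𝓞 F) F) D (adeleMeasure F)) :
    adeleMeasure F D < ⊤ := by
  obtain ⟨r, hr⟩ := exists_sub_mem_adeleBox F
  refine measure_fundamentalDomain_lt_top_of_vadd_mem hD
    (isCompact_adeleBox r (R := fun _ => 1) (by simp)).measure_lt_top fun x => ?_
  obtain ⟨ξ, hξ⟩ := hr x
  refine ⟨-⟨algebraMap F (Adele F) ξ, ξ, rfl⟩, ?_⟩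
  convert! hξ using 1
  exact neg_add_eq_sub _ _

end AdeleNorm


section RatNorm

theorem norm_ratCast_le_one_iff {K : Type*} [NormedField K] [CharZero K] {p : ℕ} (hp : p.Prime)
    (h1 : ∀ n : ℕ, ‖(n : K)‖ ≤ 1) (h2 : ∀ n : ℕ, ‖(n : K)‖ < 1 ↔ p ∣ n) (q : ℚ) :
    ‖(q : K)‖ ≤ 1 ↔ ¬ p ∣ q.den := by
  have hden : (0 : ℝ) < ‖(q.den : K)‖ := norm_pos_iff.2 (Nat.cast_ne_zero.2 q.den_ne_zero)
  have hnum : ‖(q.num : K)‖ = ‖(q.num.natAbs : K)‖ := by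
    rcases Int.natAbs_eq q.num with h | h
    · conv_lhs => rw [h, Int.cast_natCast]
    · conv_lhs => rw [h, Int.cast_neg, Int.cast_natCast, norm_neg]
  rw [Rat.cast_def, norm_div, hnum, div_le_one hden]
  constructor
  · intro h hd
    have h3 := (h2 _).1 (h.trans_lt ((h2 _).2 hd))
    exact hp.one_lt.ne' (Nat.dvd_one.1 (q.reduced ▸ Nat.dvd_gcd h3 hd))
  · intro h
    have : ‖(q.den : K)‖ = 1 := le_antisymm (h1 _) (not_lt.1 fun h' => h ((h2 _).1 h'))
    rw [this]
    exact h1 _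

end RatNorm

section Padic

variable (F : Type*) [Field F] [NumberField F] (p : ℕ)

/-- The finite places of `F` above `p`. -/
abbrev PlacesOver : Type _ := {v : HeightOneSpectrum (𝓞 F) // (p : 𝓞 F) ∈ v.asIdeal}

noncomputable instance fintypePlacesOver [hp : Fact p.Prime] : Fintype (PlacesOver F p) :=
  (finite_mem_asIdeal (Nat.cast_ne_zero.2 hp.out.ne_zero)).fintype

variable {F p} [hp : Fact p.Prime]

theorem natCast_mem_asIdeal_iff (v : PlacesOver F p) (n : ℕ) :
    (n : 𝓞 F) ∈ v.1.asIdeal ↔ p ∣ n := by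
  refine ⟨fun h => ?_, fun ⟨k, hk⟩ => hk ▸ by
    rw [Nat.cast_mul]; exact Ideal.mul_mem_right _ _ v.2⟩
  by_contra hn
  have hco : IsCoprime (p : ℤ) (n : ℤ) :=
    Nat.isCoprime_iff_coprime.2 ((Nat.Prime.coprime_iff_not_dvd hp.out).2 hn)
  obtain ⟨a, b, hab⟩ := hco
  refine v.1.isPrime.ne_top ((Ideal.eq_top_iff_one _).2 ?_)
  have := congrArg (Int.cast : ℤ → 𝓞 F) hab
  push_cast at this
  rw [← this]
  exact Ideal.add_mem _ (Ideal.mul_mem_left _ _ v.2) (Ideal.mul_mem_left _ _ h)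

theorem norm_natCast_le_one (v : HeightOneSpectrum (𝓞 F)) (n : ℕ) :
    ‖(n : v.adicCompletion F)‖ ≤ 1 := by
  have := norm_algebraMap_int_le_one v (n : 𝓞 F)
  simpa using this

theorem norm_natCast_lt_one_iff (v : PlacesOver F p) (n : ℕ) :
    ‖(n : v.1.adicCompletion F)‖ < 1 ↔ p ∣ n := by
  rw [← natCast_mem_asIdeal_iff v, ← norm_algebraMap_int_lt_one_iff]
  simp

instance charZero_adicCompletion (v : HeightOneSpectrum (𝓞 F)) : CharZero (v.adicCompletion F) :=
  charZero_of_injective_algebraMap (algebraMap F (v.adicCompletion F)).injective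

theorem norm_ratCast_completion_le_one_iff (v : PlacesOver F p) (q : ℚ) :
    ‖(q : v.1.adicCompletion F)‖ ≤ 1 ↔ ¬ p ∣ q.den :=
  norm_ratCast_le_one_iff hp.out (norm_natCast_le_one v.1) (norm_natCast_lt_one_iff v) q

theorem norm_ratCast_padic_le_one_iff (q : ℚ) : ‖(q : ℚ_[p])‖ ≤ 1 ↔ ¬ p ∣ q.den :=
  norm_ratCast_le_one_iff hp.out (fun n => by simpa using Padic.norm_int_le_one (p := p) n)
    (fun _ => Padic.norm_natCast_lt_one_iff) q

theorem norm_prime_lt_one (v : PlacesOver F p) : ‖(p : v.1.adicCompletion F)‖ < 1 :=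
  (norm_natCast_lt_one_iff v p).2 dvd_rfl

/-- The rational numbers in `ℚ_p`, as a map to a completion of `F` above `p`. -/
noncomputable def ratMap (v : PlacesOver F p) :
    (Rat.castHom ℚ_[p]).range →+* v.1.adicCompletion F :=
  (Rat.castHom (v.1.adicCompletion F)).comp
    (RingEquiv.ofBijective (Rat.castHom ℚ_[p]).rangeRestrict
      ⟨fun _ _ h => (Rat.castHom ℚ_[p]).injective (congrArg Subtype.val h),
        (Rat.castHom ℚ_[p]).rangeRestrict_surjective⟩).symm.toRingHom

theorem ratMap_apply (v : PlacesOver F p) (q : ℚ) :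
    ratMap v ((Rat.castHom ℚ_[p]).rangeRestrict q) = q := by
  exact congrArg (Rat.castHom (v.1.adicCompletion F)) (RingEquiv.symm_apply_apply _ q)

theorem continuous_ratMap (v : PlacesOver F p) : Continuous (ratMap v) := by
  refine continuous_of_continuousAt_zero (ratMap v) ?_
  rw [ContinuousAt, map_zero, Metric.tendsto_nhds_nhds]
  intro ε hε
  obtain ⟨N, hN⟩ := exists_pow_lt_of_lt_one hε (norm_prime_lt_one v)
  refine ⟨(p : ℝ) ^ (-N : ℤ), zpow_pos (by exact_mod_cast hp.out.pos) _, ?_⟩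
  rintro ⟨_, q, rfl⟩ hq
  rw [dist_zero_right] at hq ⊢
  have hq1 : ‖(q : ℚ_[p])‖ < (p : ℝ) ^ (-N : ℤ) := hq
  have h0 : (p : v.1.adicCompletion F) ≠ 0 := Nat.cast_ne_zero.2 hp.out.ne_zero
  have h1 : ‖((q / p ^ N : ℚ) : ℚ_[p])‖ ≤ 1 := by
    push_cast
    rw [norm_div, norm_pow, Padic.norm_p, inv_pow, div_inv_eq_mul]
    have : (0 : ℝ) < p ^ N := pow_pos (by exact_mod_cast hp.out.pos) _
    rw [_root_.zpow_neg, zpow_natCast] at hq1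
    exact ((mul_lt_mul_of_pos_right hq1 this).trans_eq (inv_mul_cancel₀ this.ne')).le
  rw [norm_ratCast_padic_le_one_iff, ← norm_ratCast_completion_le_one_iff v] at h1
  push_cast at h1
  have h2 := ratMap_apply v q
  have h3 : ratMap v ⟨(Rat.castHom ℚ_[p]) q, q, rfl⟩ = q := h2
  rw [h3]
  rw [norm_div, norm_pow, div_le_one (pow_pos (norm_pos_iff.2 h0) _)] at h1
  exact h1.trans_lt hN

theorem denseRange_padic_subtype (p : ℕ) [Fact p.Prime] :
    DenseRange ((Rat.castHom ℚ_[p]).range.subtype) :=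
  (Padic.denseRange_ratCast p).mono <| by
    rintro _ ⟨q, rfl⟩
    exact ⟨⟨q, q, rfl⟩, rfl⟩

/-- The embedding of `ℚ_p` in a completion of `F` above `p`. -/
noncomputable def padicMap (v : PlacesOver F p) : ℚ_[p] →+* v.1.adicCompletion F :=
  IsDenseInducing.extendRingHom (i := (Rat.castHom ℚ_[p]).range.subtype) (f := ratMap v)
    (isUniformEmbedding_subtype_val.isUniformInducing)
    (denseRange_padic_subtype p)
    (uniformContinuous_addMonoidHom_of_continuous (continuous_ratMap v))

theorem continuous_padicMap (v : PlacesOver F p) : Continuous (padicMap v) :=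
  (uniformContinuous_uniformly_extend (isUniformEmbedding_subtype_val.isUniformInducing)
    (denseRange_padic_subtype p)
    (uniformContinuous_addMonoidHom_of_continuous (continuous_ratMap v))).continuous

noncomputable instance padicAlgebra (v : PlacesOver F p) : Algebra ℚ_[p] (v.1.adicCompletion F) :=
  (padicMap v).toAlgebra

theorem algebraMap_padic_eq (v : PlacesOver F p) :
    algebraMap ℚ_[p] (v.1.adicCompletion F) = padicMap v := rfl

instance continuousSMul_padic (v : PlacesOver F p) :
    ContinuousSMul ℚ_[p] (v.1.adicCompletion F) :=
  ⟨by
    simp only [Algebra.smul_def, algebraMap_padic_eq]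
    exact ((continuous_padicMap v).comp continuous_fst).mul continuous_snd⟩

theorem norm_padicMap_le_one (v : PlacesOver F p) {z : ℚ_[p]} (hz : ‖z‖ ≤ 1) :
    ‖padicMap v z‖ ≤ 1 := by
  have hc : Continuous fun z : ℤ_[p] => ‖padicMap v z‖ :=
    ((continuous_padicMap v).comp continuous_subtype_val).norm
  have : ∀ z : ℤ_[p], ‖padicMap v z‖ ≤ 1 := fun z =>
    PadicInt.denseRange_natCast.induction_on (p := fun z : ℤ_[p] => ‖padicMap v z‖ ≤ 1) z
      (isClosed_le hc continuous_const) fun n => by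
        simpa using norm_natCast_le_one v.1 n
  exact this ⟨z, hz⟩

theorem range_padicMap (v : PlacesOver F p) :
    Set.range (padicMap v) = (padicSubfield v.1 : Set (v.1.adicCompletion F)) := by
  have hbot : ((⊥ : Subfield (v.1.adicCompletion F)) : Set (v.1.adicCompletion F)) =
      Set.range ((↑) : ℚ → v.1.adicCompletion F) := by
    rw [Subfield.bot_eq_of_charZero]
    ext x
    simp
  have hcl : (padicSubfield v.1 : Set (v.1.adicCompletion F)) =
      closure (Set.range ((↑) : ℚ → v.1.adicCompletion F)) := by
    rw [← hbot]; rfl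
  rw [hcl]
  refine subset_antisymm ?_ ?_
  · refine ((continuous_padicMap v).range_subset_closure_image_dense
      (Padic.denseRange_ratCast p)).trans (closure_mono ?_)
    rintro _ ⟨_, ⟨q, rfl⟩, rfl⟩
    exact ⟨q, (map_ratCast _ q).symm⟩
  · refine closure_minimal ?_ ?_
    · rintro _ ⟨q, rfl⟩
      exact ⟨q, map_ratCast _ q⟩
    · have h := Submodule.closed_of_finiteDimensional
        (Submodule.span ℚ_[p] {(1 : v.1.adicCompletion F)})
      convert! h using 1
      ext x
      simp [Submodule.mem_span_singleton, Algebra.smul_def, algebraMap_padic_eq]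

end Padic


section Trace

theorem trace_pi_single {R ι : Type*} [Field R] [Fintype ι] [DecidableEq ι] {A : ι → Type*}
    [∀ i, CommRing (A i)] [∀ i, Algebra R (A i)] [∀ i, FiniteDimensional R (A i)] (i : ι) (a : A i) :
    Algebra.trace R (∀ i, A i) (Pi.single i a) = Algebra.trace R (A i) a := by
  rw [Algebra.trace_apply, Algebra.trace_apply]
  have h1 : Algebra.lmul R (∀ i, A i) (Pi.single i a) =
      (LinearMap.single R A i) ∘ₗ (Algebra.lmul R (A i) a ∘ₗ LinearMap.proj i) := by
    refine LinearMap.ext fun x => ?_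
    simp [Pi.single_mul_left]
  rw [h1, LinearMap.trace_comp_comm', LinearMap.comp_assoc]
  congr 1
  ext x
  simp

theorem trace_pi {R ι : Type*} [Field R] [Fintype ι] {A : ι → Type*}
    [∀ i, CommRing (A i)] [∀ i, Algebra R (A i)] [∀ i, FiniteDimensional R (A i)] (x : ∀ i, A i) :
    Algebra.trace R (∀ i, A i) x = ∑ i, Algebra.trace R (A i) (x i) := by
  classical
  conv_lhs => rw [← Finset.univ_sum_single x]
  simp [trace_pi_single]

end Trace

section Padic

variable {F : Type*} [Field F] [NumberField F] {p : ℕ} [hp : Fact p.Prime]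

/-- The diagonal embedding of `F` in the product of its completions above `p`. -/
noncomputable def diagonalMap (F : Type*) [Field F] [NumberField F] (p : ℕ) :
    F →+* ∀ v : PlacesOver F p, v.1.adicCompletion F :=
  RingHom.pi fun v => algebraMap F (v.1.adicCompletion F)

theorem exists_norm_sub_lt (x : ∀ v : PlacesOver F p, v.1.adicCompletion F) {ε : ℝ} (hε : 0 < ε) :
    ∃ a : F, ∀ v, ‖x v - diagonalMap F p a v‖ < ε := by
  classical
  have hN : ∃ N : ℕ, ∀ v : PlacesOver F p, ‖(p : v.1.adicCompletion F)‖ ^ N < ε := by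
    have : ∀ᶠ N : ℕ in Filter.atTop, ∀ v : PlacesOver F p, ‖(p : v.1.adicCompletion F)‖ ^ N < ε :=
      Filter.eventually_all.2 fun v => (tendsto_pow_atTop_nhds_zero_of_lt_one (norm_nonneg _)
        (norm_prime_lt_one v)).eventually_lt_const hε
    exact this.exists
  obtain ⟨N, hN⟩ := hN
  let S : Finset (HeightOneSpectrum (𝓞 F)) :=
    (finite_mem_asIdeal (N := (p : 𝓞 F)) (Nat.cast_ne_zero.2 hp.out.ne_zero)).toFinset
  have hS : ∀ v, v ∈ S ↔ (p : 𝓞 F) ∈ v.asIdeal := fun v => by simp [S]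
  obtain ⟨a, ha⟩ := exists_norm_sub_algebraMap_le_one (adeleOfFinset S (F := F) (fun _ => 0)
    fun v => x ⟨v.1, (hS v.1).1 v.2⟩ / (p : v.1.adicCompletion F) ^ N).2
  refine ⟨p ^ N * a, fun v => ?_⟩
  have h1 := ha v.1
  have h2 := finEval_adeleOfFinset_mem S (F := F) (fun _ => 0)
    (fun v => x ⟨v.1, (hS v.1).1 v.2⟩ / (p : v.1.adicCompletion F) ^ N) ⟨v.1, (hS v.1).2 v.2⟩
  change (adeleOfFinset S (F := F) (fun _ => 0)
    fun v => x ⟨v.1, (hS v.1).1 v.2⟩ / (p : v.1.adicCompletion F) ^ N).2 v.1 = _ at h2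
  rw [h2] at h1
  have h0 : (p : v.1.adicCompletion F) ≠ 0 := Nat.cast_ne_zero.2 hp.out.ne_zero
  have h3 : x v - diagonalMap F p (p ^ N * a) v = (p : v.1.adicCompletion F) ^ N *
      (x v / (p : v.1.adicCompletion F) ^ N - algebraMap F (v.1.adicCompletion F) a) := by
    simp only [diagonalMap, RingHom.pi_apply, map_mul, map_pow, map_natCast]
    field_simp
  rw [h3, norm_mul, norm_pow]
  exact (mul_le_of_le_one_right (by positivity) h1).trans_lt (hN v)

theorem exists_int_of_norm_le_one {x : F}
    (h : ∀ v : HeightOneSpectrum (𝓞 F), ‖algebraMap F (v.adicCompletion F) x‖ ≤ 1) :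
    ∃ a : 𝓞 F, (a : F) = x := by
  refine HeightOneSpectrum.mem_integers_of_valuation_le_one F x fun v => ?_
  have := (norm_le_one_iff v _).1 (h v)
  rwa [HeightOneSpectrum.mem_adicCompletionIntegers,
    show algebraMap F (v.adicCompletion F) x = (x : v.adicCompletion F) from rfl,
    HeightOneSpectrum.valuedAdicCompletion_eq_valuation'] at this

theorem smul_padic_apply (c : ℚ_[p]) (x : ∀ v : PlacesOver F p, v.1.adicCompletion F) (v) :
    (c • x) v = padicMap v c * x v := rfl

theorem diagonalMap_smul (q : ℚ) (x : F) :
    diagonalMap F p (q • x) = ((q : ℚ_[p])) • diagonalMap F p x := by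
  refine funext fun v => ?_
  have h : algebraMap F (v.1.adicCompletion F) (q : F) = q :=
    map_ratCast (algebraMap F (v.1.adicCompletion F)) q
  rw [smul_padic_apply, map_ratCast, Algebra.smul_def, eq_ratCast, ← h]
  exact map_mul (algebraMap F (v.1.adicCompletion F)) _ _

variable (F p) in
theorem linearIndependent_diagonalMap :
    LinearIndependent ℚ_[p] fun i => diagonalMap F p (integralBasis F i) := by
  rw [Fintype.linearIndependent_iff]
  by_contra! hcon
  obtain ⟨g, hg, i₀, hi₀⟩ := hcon
  obtain ⟨j, -, hj⟩ := Finset.exists_max_image Finset.univ (fun i => ‖g i‖) ⟨i₀, Finset.mem_univ _⟩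
  have hj0 : g j ≠ 0 := norm_pos_iff.1 ((norm_pos_iff.2 hi₀).trans_le (hj i₀ (Finset.mem_univ _)))
  let c : _ → ℚ_[p] := fun i => g i / g j
  have hc1 : ∀ i, ‖c i‖ ≤ 1 := fun i => by
    rw [norm_div, div_le_one (norm_pos_iff.2 hj0)]
    exact hj i (Finset.mem_univ _)
  have hcj : c j = 1 := div_self hj0
  have hc : ∀ v, ∑ i, padicMap v (c i) * algebraMap F (v.1.adicCompletion F) (integralBasis F i) = 0 := by
    intro v
    have := congrFun hg v
    rw [Finset.sum_apply] at this
    simp only [smul_padic_apply, Pi.zero_apply] at this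
    simp only [c, map_div₀, div_mul_eq_mul_div]
    rw [← Finset.sum_div]
    rw [div_eq_zero_iff]
    exact .inl this
  have happ : ∀ i, ∃ a : ℕ, ‖c i - (a : ℚ_[p])‖ ≤ (p : ℝ)⁻¹ := fun i => by
    obtain ⟨z, hz⟩ : ∃ z : ℤ_[p], (z : ℚ_[p]) = c i := ⟨⟨c i, hc1 i⟩, rfl⟩
    obtain ⟨a, ha⟩ := PadicInt.denseRange_natCast.exists_dist_lt z (ε := 1) one_pos
    refine ⟨a, ?_⟩
    rw [dist_eq_norm, PadicInt.norm_def, PadicInt.coe_sub, PadicInt.coe_natCast, hz] at ha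
    have h3 : ‖c i - (a : ℚ_[p])‖ < 1 := ha
    simpa using (Padic.norm_lt_pow_iff_norm_le_pow_sub_one (c i - (a : ℚ_[p])) 0).1 (by simpa using h3)
  choose a ha using happ
  let α : F := ∑ i, a i • integralBasis F i
  have hα : ∀ v : HeightOneSpectrum (𝓞 F), ‖algebraMap F (v.adicCompletion F) (α / p)‖ ≤ 1 := by
    intro v
    by_cases hv : (p : 𝓞 F) ∈ v.asIdeal
    · let w : PlacesOver F p := ⟨v, hv⟩
      have hsum : algebraMap F (v.adicCompletion F) (α / p) =
          -∑ i, padicMap w ((c i - a i) / p) *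
            algebraMap F (v.adicCompletion F) (integralBasis F i) := by
        have h0 := hc w
        simp only [map_div₀, map_sub, map_natCast, sub_div, sub_mul, Finset.sum_sub_distrib,
          div_mul_eq_mul_div]
        rw [← Finset.sum_div, ← Finset.sum_div, h0, zero_div, zero_sub, neg_neg]
        simp [α, map_sum, nsmul_eq_mul]
      rw [hsum, norm_neg]
      refine IsUltrametricDist.norm_sum_le_of_forall_le_of_nonneg zero_le_one fun i _ => ?_
      rw [norm_mul]
      refine mul_le_one₀ (norm_padicMap_le_one w ?_) (norm_nonneg _) ?_
      · rw [norm_div, Padic.norm_p]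
        exact div_le_one_of_le₀ (ha i) (by positivity)
      · rw [integralBasis_apply]
        exact norm_algebraMap_int_le_one v _
    · have h1 : ‖(p : v.adicCompletion F)‖ = 1 := by
        have := (norm_algebraMap_int_eq_one_iff v (p : 𝓞 F)).2 hv
        simpa using this
      rw [map_div₀, map_natCast, norm_div, h1, div_one]
      have : α = ((∑ i, a i • RingOfIntegers.basis F i : 𝓞 F) : F) := by
        simp [α, integralBasis_apply, map_sum]
      rw [this]
      exact norm_algebraMap_int_le_one v _
  obtain ⟨β, hβ⟩ : ∃ β : 𝓞 F, (β : F) = α / p :=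
    exists_int_of_norm_le_one hα
  have h2 : (integralBasis F).repr (α / p) j = (a j : ℚ) / p := by
    have : α / p = ∑ i, ((a i : ℚ) / p) • integralBasis F i := by
      simp only [α, Finset.sum_div]
      refine Finset.sum_congr rfl fun i _ => ?_
      rw [Algebra.smul_def (R := ℚ), nsmul_eq_mul]
      simp [div_mul_eq_mul_div]
    rw [this, Module.Basis.repr_sum_self]
  have h3 : (integralBasis F).repr (α / p) j = ((RingOfIntegers.basis F).repr β j : ℚ) := by
    rw [← hβ, integralBasis_repr_apply]; rfl
  have hdvd : p ∣ a j := by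
    rw [h2, div_eq_iff (Nat.cast_ne_zero.2 hp.out.ne_zero)] at h3
    have : (a j : ℤ) = (RingOfIntegers.basis F).repr β j * p := by exact_mod_cast h3
    exact Int.natCast_dvd_natCast.1 ⟨_, this.trans (mul_comm _ _)⟩
  have h4 : ‖(a j : ℚ_[p])‖ < 1 := Padic.norm_natCast_lt_one_iff.2 hdvd
  have h5 : ‖c j - a j‖ < 1 :=
    (ha j).trans_lt (inv_lt_one_of_one_lt₀ (by exact_mod_cast hp.out.one_lt))
  have h6 := IsUltrametricDist.norm_add_le_max (c j - a j) (a j : ℚ_[p])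
  rw [sub_add_cancel, hcj, norm_one] at h6
  rw [hcj] at h5
  exact absurd h6 (not_le.2 (max_lt h5 h4))

variable (F p) in
theorem span_diagonalMap :
    ⊤ ≤ Submodule.span ℚ_[p] (Set.range fun i => diagonalMap F p (integralBasis F i)) := by
  set N := Submodule.span ℚ_[p] (Set.range fun i => diagonalMap F p (integralBasis F i)) with hN
  have hfd : FiniteDimensional ℚ_[p] N := FiniteDimensional.span_of_finite _ (Set.finite_range _)
  have hcl : IsClosed (N : Set (∀ v : PlacesOver F p, v.1.adicCompletion F)) :=
    N.closed_of_finiteDimensional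
  have hmem : ∀ x : F, diagonalMap F p x ∈ N := fun x => by
    rw [← (integralBasis F).sum_repr x, map_sum]
    refine N.sum_mem fun i _ => ?_
    rw [diagonalMap_smul]
    exact N.smul_mem _ (Submodule.subset_span ⟨i, rfl⟩)
  intro x _
  rw [← SetLike.mem_coe, ← hcl.closure_eq, Metric.mem_closure_iff]
  intro ε hε
  obtain ⟨a, ha⟩ := exists_norm_sub_lt x hε
  refine ⟨_, hmem a, ?_⟩
  rw [dist_eq_norm, pi_norm_lt_iff hε]
  exact ha

variable (F p) in
/-- An integral basis of `F` is a basis over `ℚ_p` of the product of the completions above `p`. -/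
noncomputable def padicBasis : Module.Basis (Module.Free.ChooseBasisIndex ℤ (𝓞 F)) ℚ_[p]
    (∀ v : PlacesOver F p, v.1.adicCompletion F) :=
  .mk (linearIndependent_diagonalMap F p) (span_diagonalMap F p)

theorem padicBasis_apply (i) : padicBasis F p i = diagonalMap F p (integralBasis F i) :=
  Module.Basis.mk_apply _ _ i

instance finiteDimensional_padic_pi :
    FiniteDimensional ℚ_[p] (∀ v : PlacesOver F p, v.1.adicCompletion F) :=
  (padicBasis F p).finiteDimensional_of_finite

instance finiteDimensional_padic (v : PlacesOver F p) :
    FiniteDimensional ℚ_[p] (v.1.adicCompletion F) := by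
  classical
  exact Module.Finite.of_surjective (LinearMap.proj v :
    (∀ v : PlacesOver F p, v.1.adicCompletion F) →ₗ[ℚ_[p]] v.1.adicCompletion F)
    (LinearMap.proj_surjective v)

/-- The global trace is the sum of the local traces. -/
theorem sum_trace_padic (x : F) :
    ∑ v : PlacesOver F p, Algebra.trace ℚ_[p] (v.1.adicCompletion F)
      (algebraMap F (v.1.adicCompletion F) x) = ((Algebra.trace ℚ F x : ℚ) : ℚ_[p]) := by
  classical
  have h := trace_pi (R := ℚ_[p]) (diagonalMap F p x)
  refine h.symm.trans ?_
  rw [Algebra.trace_eq_matrix_trace (padicBasis F p), Algebra.trace_eq_matrix_trace (integralBasis F)]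
  have : Algebra.leftMulMatrix (padicBasis F p) (diagonalMap F p x) =
      (Algebra.leftMulMatrix (integralBasis F) x).map ((↑) : ℚ → ℚ_[p]) := by
    ext i j
    rw [Algebra.leftMulMatrix_eq_repr_mul, Matrix.map_apply, Algebra.leftMulMatrix_eq_repr_mul,
      padicBasis_apply, ← map_mul]
    conv_lhs => rw [← (integralBasis F).sum_repr (x * integralBasis F j), map_sum]
    simp_rw [diagonalMap_smul, ← padicBasis_apply]
    rw [Module.Basis.repr_sum_self]
  rw [this]
  simp [Matrix.trace]

theorem continuous_trace_padic (v : PlacesOver F p) :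
    Continuous (Algebra.trace ℚ_[p] (v.1.adicCompletion F)) :=
  LinearMap.continuous_of_finiteDimensional _

theorem norm_trace_le_one (v : PlacesOver F p) {x : v.1.adicCompletion F} (hx : ‖x‖ ≤ 1) :
    ‖Algebra.trace ℚ_[p] (v.1.adicCompletion F) x‖ ≤ 1 := by
  have hcl : IsClosed {x : v.1.adicCompletion F |
      ‖Algebra.trace ℚ_[p] (v.1.adicCompletion F) x‖ ≤ 1} :=
    isClosed_le (continuous_trace_padic v).norm continuous_const
  refine closure_minimal (s := Set.range fun a : 𝓞 F =>
    algebraMap F (v.1.adicCompletion F) (a : F)) ?_ hcl (Metric.mem_closure_iff.2 fun ε hε => ?_)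
  · rintro _ ⟨a, rfl⟩
    have h1 : IsIntegral ℤ (algebraMap F (v.1.adicCompletion F) (a : F)) :=
      (RingOfIntegers.isIntegral_coe a).algebraMap
    have h2 := (Algebra.isIntegral_trace (L := ℚ_[p]) h1).tower_top (A := ℤ_[p])
    obtain ⟨y, hy⟩ := IsIntegrallyClosed.isIntegral_iff.1 h2
    rw [Set.mem_ofPred_eq, ← hy]
    exact y.2
  · obtain ⟨a, ha⟩ := exists_int_norm_sub_lt v.1 hx hε
    exact ⟨_, ⟨a, rfl⟩, by rwa [dist_eq_norm]⟩

/-- The local trace through `ℚ_p`. -/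
theorem localTrace_eq (v : PlacesOver F p) (x : v.1.adicCompletion F) :
    localTrace v.1 x = padicMap v (Algebra.trace ℚ_[p] (v.1.adicCompletion F) x) := by
  let e : ℚ_[p] ≃+* padicSubfield v.1 :=
    RingEquiv.ofBijective ((padicMap v).codRestrict (padicSubfield v.1) fun z => by
      rw [← SetLike.mem_coe, ← range_padicMap]; exact ⟨z, rfl⟩)
      ⟨fun _ _ h => (padicMap v).injective (congrArg Subtype.val h), fun ⟨y, hy⟩ => by
        rw [← SetLike.mem_coe, ← range_padicMap] at hy
        obtain ⟨z, hz⟩ := hy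
        exact ⟨z, Subtype.ext hz⟩⟩
  have h := Algebra.trace_eq_of_equiv_equiv e (RingEquiv.refl (v.1.adicCompletion F)) rfl x
  rw [h]
  have : ∀ y, padicMap v (e.symm y) = y := fun y => congrArg Subtype.val (e.apply_symm_apply y)
  exact (this _).symm

end Padic


section RationalExponential

theorem den_sub_dvd_pow {p : ℕ} {r r' : ℚ} (h : ∃ n : ℕ, r.den ∣ p ^ n)
    (h' : ∃ n : ℕ, r'.den ∣ p ^ n) : ∃ n : ℕ, (r - r').den ∣ p ^ n := by
  obtain ⟨n, hn⟩ := h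
  obtain ⟨m, hm⟩ := h'
  exact ⟨n + m, (Rat.sub_den_dvd _ _).trans (pow_add p n m ▸ mul_dvd_mul hn hm)⟩

theorem den_add_dvd_pow {p : ℕ} {r r' : ℚ} (h : ∃ n : ℕ, r.den ∣ p ^ n)
    (h' : ∃ n : ℕ, r'.den ∣ p ^ n) : ∃ n : ℕ, (r + r').den ∣ p ^ n := by
  obtain ⟨n, hn⟩ := h
  obtain ⟨m, hm⟩ := h'
  exact ⟨n + m, (Rat.add_den_dvd _ _).trans (pow_add p n m ▸ mul_dvd_mul hn hm)⟩

theorem exp_ratCast_eq_of_sub_int {r r' : ℚ} {n : ℤ} (h : r - r' = n) :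
    Complex.exp (-2 * Complex.I * Real.pi * (r : ℂ)) =
      Complex.exp (-2 * Complex.I * Real.pi * (r' : ℂ)) := by
  rw [Complex.exp_eq_exp_iff_exists_int]
  refine ⟨-n, ?_⟩
  have : (r : ℂ) - r' = n := by exact_mod_cast congrArg (Rat.cast : ℚ → ℂ) h
  rw [← sub_eq_iff_eq_add', ← mul_sub, this]
  push_cast
  ring

end RationalExponential

section Characters

variable {F : Type*} [Field F] [NumberField F] {p : ℕ} [hp : Fact p.Prime]

theorem exists_prime_mem_asIdeal (v : HeightOneSpectrum (𝓞 F)) :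
    ∃ p : ℕ, p.Prime ∧ (p : 𝓞 F) ∈ v.asIdeal := by
  have h : ∃ n : ℕ, n ≠ 0 ∧ (n : 𝓞 F) ∈ v.asIdeal :=
    ⟨_, by exact_mod_cast NumberField.HeightOneSpectrum.absNorm_ne_zero v, Ideal.absNorm_mem _⟩
  classical
  set n := Nat.find h with hn
  obtain ⟨h0, hmem⟩ := Nat.find_spec h
  rw [← hn] at h0 hmem
  have h1 : n ≠ 1 := by
    intro h1
    rw [h1, Nat.cast_one] at hmem
    exact v.isPrime.ne_top ((Ideal.eq_top_iff_one _).2 hmem)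
  refine ⟨n.minFac, Nat.minFac_prime h1, ?_⟩
  obtain ⟨k, hk⟩ := n.minFac_dvd
  rw [hk, Nat.cast_mul] at hmem
  refine (v.isPrime.mem_or_mem hmem).resolve_right fun hk' => ?_
  have hk0 : k ≠ 0 := by rintro rfl; exact h0 (by simpa using hk)
  have := Nat.find_min' h ⟨hk0, hk'⟩
  rw [← hn] at this
  have h2 := (Nat.minFac_prime h1).two_le
  nlinarith [Nat.pos_of_ne_zero hk0]

theorem exists_absNorm_eq_pow (v : PlacesOver F p) :
    ∃ f : ℕ, f ≠ 0 ∧ Ideal.absNorm v.1.asIdeal = p ^ f := by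
  have : v.1.asIdeal.LiesOver (Ideal.span {(p : ℤ)}) := ⟨by
    ext n
    rw [Ideal.mem_span_singleton, Ideal.mem_comap]
    have h1 : (p : ℤ) ∣ n ↔ p ∣ n.natAbs := by rw [Int.natCast_dvd]
    rw [h1, ← natCast_mem_asIdeal_iff v]
    rcases Int.natAbs_eq n with h | h
    · conv_rhs => rw [h]
      simp
    · conv_rhs => rw [h]
      simp⟩
  have h := Ideal.absNorm_eq_pow_inertiaDeg v.1.asIdeal (Nat.prime_iff_prime_int.1 hp.out)
  rw [Int.natAbs_natCast] at h
  refine ⟨_, fun h0 => ?_, h⟩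
  rw [h0, pow_zero] at h
  have := Ideal.absNorm_mem v.1.asIdeal
  rw [h, Nat.cast_one] at this
  exact v.1.isPrime.ne_top ((Ideal.eq_top_iff_one _).2 this)

theorem dvd_absNorm_pow_iff (v : PlacesOver F p) (d : ℕ) :
    (∃ n : ℕ, d ∣ Ideal.absNorm v.1.asIdeal ^ n) ↔ ∃ n : ℕ, d ∣ p ^ n := by
  obtain ⟨f, hf, h⟩ := exists_absNorm_eq_pow v
  rw [h]
  refine ⟨fun ⟨n, hn⟩ => ⟨f * n, by rwa [pow_mul]⟩, fun ⟨n, hn⟩ => ⟨n, hn.trans ?_⟩⟩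
  rw [← pow_mul]
  exact pow_dvd_pow _ (Nat.le_mul_of_pos_left _ (Nat.pos_of_ne_zero hf))

theorem padicExp_eq (v : PlacesOver F p) {y : v.1.adicCompletion F} {r : ℚ}
    (hr : ∃ n : ℕ, r.den ∣ p ^ n) (h : ‖y - r‖ ≤ 1) :
    padicExp v.1 y = Complex.exp (-2 * Complex.I * Real.pi * (r : ℂ)) := by
  have hex : ∃ r : ℚ, (∃ n : ℕ, r.den ∣ Ideal.absNorm v.1.asIdeal ^ n) ∧
      y - (r : v.1.adicCompletion F) ∈ v.1.adicCompletionIntegers F :=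
    ⟨r, (dvd_absNorm_pow_iff v _).2 hr, (norm_le_one_iff v.1 _).1 h⟩
  rw [padicExp, dif_pos hex]
  obtain ⟨h1, h2⟩ := hex.choose_spec
  set r' := hex.choose
  rw [dvd_absNorm_pow_iff v] at h1
  rw [← norm_le_one_iff v.1] at h2
  have h3 : ‖((r' - r : ℚ) : v.1.adicCompletion F)‖ ≤ 1 := by
    have := (norm_sub_le_max (y - r) (y - r')).trans (max_le h h2)
    rw [sub_sub_sub_cancel_left] at this
    simpa using this
  rw [norm_ratCast_completion_le_one_iff v] at h3
  obtain ⟨n, hn⟩ := den_sub_dvd_pow h1 hr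
  have hden : (r' - r).den = 1 := by
    rcases n with _ | n
    · simpa using hn
    · obtain ⟨k, -, hk⟩ := (Nat.dvd_prime_pow hp.out).1 hn
      rcases k with _ | k
      · simpa using hk
      · exact absurd (hk ▸ dvd_pow_self p k.succ_ne_zero) h3
  exact exp_ratCast_eq_of_sub_int (Rat.den_eq_one_iff _ |>.1 hden).symm

theorem exists_rat_norm_sub_le_one (z : ℚ_[p]) :
    ∃ r : ℚ, (∃ n : ℕ, r.den ∣ p ^ n) ∧ ‖z - r‖ ≤ 1 := by
  have hp1 : (1 : ℝ) < p := by exact_mod_cast hp.out.one_lt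
  obtain ⟨n, hn⟩ := pow_unbounded_of_one_lt ‖z‖ hp1
  have hz : ‖(p : ℚ_[p]) ^ n * z‖ ≤ 1 := by
    rw [norm_mul, norm_pow, Padic.norm_p, inv_pow, inv_mul_le_one₀ (by positivity)]
    exact hn.le
  obtain ⟨w, hw⟩ : ∃ w : ℤ_[p], (w : ℚ_[p]) = (p : ℚ_[p]) ^ n * z := ⟨⟨_, hz⟩, rfl⟩
  obtain ⟨a, ha⟩ := PadicInt.denseRange_natCast.exists_dist_lt w (ε := (p : ℝ) ^ (-n : ℤ))
    (by positivity)
  rw [dist_eq_norm, PadicInt.norm_def, PadicInt.coe_sub, PadicInt.coe_natCast, hw] at ha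
  have hp0 : (p : ℚ_[p]) ≠ 0 := Nat.cast_ne_zero.2 hp.out.ne_zero
  refine ⟨a / p ^ n, ⟨n, ?_⟩, ?_⟩
  · have h := Rat.den_dvd a ((p ^ n : ℕ) : ℤ)
    rw [Rat.divInt_eq_div, Int.natCast_dvd_natCast] at h
    simpa using h
  have h1 : z - ((a / p ^ n : ℚ) : ℚ_[p]) = ((p : ℚ_[p]) ^ n * z - a) / p ^ n := by
    push_cast
    field_simp
  rw [h1, norm_div, norm_pow, Padic.norm_p, div_le_one (by positivity)]
  refine ha.le.trans_eq ?_
  rw [inv_pow, _root_.zpow_neg, zpow_natCast]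

theorem finChar_eq (v : PlacesOver F p) {x : v.1.adicCompletion F} {r : ℚ}
    (hr : ∃ n : ℕ, r.den ∣ p ^ n)
    (h : ‖Algebra.trace ℚ_[p] (v.1.adicCompletion F) x - r‖ ≤ 1) :
    finChar v.1 x = Complex.exp (-2 * Complex.I * Real.pi * (r : ℂ)) := by
  refine padicExp_eq v hr ?_
  rw [localTrace_eq v, ← map_ratCast (padicMap v), ← map_sub]
  exact norm_padicMap_le_one v h

theorem finChar_add (v : HeightOneSpectrum (𝓞 F)) (x y : v.adicCompletion F) :
    finChar v (x + y) = finChar v x * finChar v y := by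
  obtain ⟨p, hp, hv⟩ := exists_prime_mem_asIdeal v
  have := Fact.mk hp
  obtain ⟨w, rfl⟩ : ∃ w : PlacesOver F p, w.1 = v := ⟨⟨v, hv⟩, rfl⟩
  obtain ⟨r, hr, h⟩ := exists_rat_norm_sub_le_one (Algebra.trace ℚ_[p] (w.1.adicCompletion F) x)
  obtain ⟨r', hr', h'⟩ := exists_rat_norm_sub_le_one (Algebra.trace ℚ_[p] (w.1.adicCompletion F) y)
  rw [finChar_eq w hr h, finChar_eq w hr' h', finChar_eq w (den_add_dvd_pow hr hr'),
    ← Complex.exp_add]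
  · push_cast; ring_nf
  · rw [map_add, Rat.cast_add, add_sub_add_comm]
    exact (IsUltrametricDist.norm_add_le_max _ _).trans (max_le h h')

theorem finChar_eq_one (v : HeightOneSpectrum (𝓞 F)) {x : v.adicCompletion F} (hx : ‖x‖ ≤ 1) :
    finChar v x = 1 := by
  obtain ⟨p, hp, hv⟩ := exists_prime_mem_asIdeal v
  have := Fact.mk hp
  rw [finChar_eq (⟨v, hv⟩ : PlacesOver F p) (r := 0) ⟨0, by simp⟩]
  · simp
  · rw [Rat.cast_zero, sub_zero]
    exact norm_trace_le_one (⟨v, hv⟩ : PlacesOver F p) hx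

theorem norm_finChar (v : HeightOneSpectrum (𝓞 F)) (x : v.adicCompletion F) :
    ‖finChar v x‖ = 1 := by
  obtain ⟨p, hp, hv⟩ := exists_prime_mem_asIdeal v
  have := Fact.mk hp
  obtain ⟨w, rfl⟩ : ∃ w : PlacesOver F p, w.1 = v := ⟨⟨v, hv⟩, rfl⟩
  obtain ⟨r, hr, h⟩ := exists_rat_norm_sub_le_one (Algebra.trace ℚ_[p] (w.1.adicCompletion F) x)
  rw [finChar_eq w hr h, Complex.norm_exp]
  simp

theorem continuous_finChar (v : HeightOneSpectrum (𝓞 F)) : Continuous (finChar v) := by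
  refine IsLocallyConstant.continuous ((IsLocallyConstant.iff_eventually_eq _).2 fun x => ?_)
  have : ∀ᶠ y in nhds x, ‖y - x‖ ≤ 1 := by
    filter_upwards [Metric.closedBall_mem_nhds x one_pos] with y hy
    rwa [← dist_eq_norm]
  filter_upwards [this] with y hy
  rw [← sub_add_cancel y x, finChar_add, finChar_eq_one v hy, one_mul]

theorem exists_prod_finChar (x : F) (p : ℕ) [Fact p.Prime] :
    ∃ r : ℚ, (∃ n : ℕ, r.den ∣ p ^ n) ∧ ¬ p ∣ (Algebra.trace ℚ F x - r).den ∧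
      ∏ v : PlacesOver F p, finChar v.1 (algebraMap F (v.1.adicCompletion F) x) =
        Complex.exp (-2 * Complex.I * Real.pi * (r : ℂ)) := by
  have hp : Fact p.Prime := inferInstance
  choose r hr h using fun v : PlacesOver F p => exists_rat_norm_sub_le_one
    (Algebra.trace ℚ_[p] (v.1.adicCompletion F) (algebraMap F (v.1.adicCompletion F) x))
  refine ⟨∑ v, r v, ?_, ?_, ?_⟩
  · exact Finset.sum_induction _ (fun r : ℚ => ∃ n : ℕ, r.den ∣ p ^ n)
      (fun _ _ => den_add_dvd_pow) ⟨0, by simp⟩ fun v _ => hr v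
  · rw [← norm_ratCast_padic_le_one_iff, Rat.cast_sub, ← sum_trace_padic, Rat.cast_sum,
      ← Finset.sum_sub_distrib]
    exact IsUltrametricDist.norm_sum_le_of_forall_le_of_nonneg zero_le_one fun v _ => h v
  · simp_rw [fun v => finChar_eq v (hr v) (h v)]
    rw [← Complex.exp_sum, Rat.cast_sum, Finset.mul_sum]

theorem finprod_finChar (x : F) :
    ∏ᶠ v : HeightOneSpectrum (𝓞 F), finChar v (algebraMap F (v.adicCompletion F) x) =
      Complex.exp (-2 * Complex.I * Real.pi * ((Algebra.trace ℚ F x : ℚ) : ℂ)) := by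
  classical
  choose q hq hqv using exists_prime_mem_asIdeal (F := F)
  have hfin : {v : HeightOneSpectrum (𝓞 F) |
      ¬ ‖algebraMap F (v.adicCompletion F) x‖ ≤ 1}.Finite :=
    Filter.eventually_cofinite.1 (eventually_finEval_le_one (algebraMap F (Adele F) x))
  let T : Finset Nat.Primes := hfin.toFinset.image fun v => ⟨q v, hq v⟩
  have : ∀ l : Nat.Primes, Fact l.1.Prime := fun l => ⟨l.2⟩
  choose r hr hr' hprod using fun l : Nat.Primes => exists_prod_finChar x l.1
  let P : Nat.Primes → Finset (HeightOneSpectrum (𝓞 F)) := fun l =>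
    (finite_mem_asIdeal (N := (l.1 : 𝓞 F)) (Nat.cast_ne_zero.2 l.2.ne_zero)).toFinset
  have hP : ∀ l v, v ∈ P l ↔ (l.1 : 𝓞 F) ∈ v.asIdeal := fun l v => by simp [P]
  have huniq : ∀ (l l' : Nat.Primes) v, v ∈ P l → v ∈ P l' → l = l' := by
    intro l l' v h h'
    rw [hP] at h h'
    exact Subtype.ext ((Nat.prime_dvd_prime_iff_eq l.2 l'.2).1
      ((natCast_mem_asIdeal_iff (p := l.1) ⟨v, h⟩ l'.1).1 h'))
  rw [finprod_eq_prod_of_mulSupport_subset _ (s := T.biUnion P), Finset.prod_biUnion]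
  · have h1 : ∀ l : Nat.Primes, ∏ v ∈ P l, finChar v (algebraMap F (v.adicCompletion F) x) =
        Complex.exp (-2 * Complex.I * Real.pi * (r l : ℂ)) := fun l => by
      rw [← hprod l]
      exact Finset.prod_subtype _ (hP l) fun v => finChar v (algebraMap F (v.adicCompletion F) x)
    rw [Finset.prod_congr rfl fun l _ => h1 l, ← Complex.exp_sum, ← Finset.mul_sum,
      ← Rat.cast_sum]
    have hden : (∑ l ∈ T, r l - Algebra.trace ℚ F x).den = 1 := by
      by_contra hne
      obtain ⟨l, hl, hdvd⟩ := Nat.exists_prime_and_dvd hne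
      have := Fact.mk hl
      rw [← not_not (a := l ∣ _), ← norm_ratCast_padic_le_one_iff] at hdvd
      apply hdvd
      have hout : ∀ l' : Nat.Primes, l'.1 ≠ l → ‖((r l' : ℚ) : ℚ_[l])‖ ≤ 1 := by
        intro l' hl'
        rw [norm_ratCast_padic_le_one_iff]
        obtain ⟨n, hn⟩ := hr l'
        intro h
        exact hl' ((Nat.prime_dvd_prime_iff_eq hl l'.2).1 (hl.dvd_of_dvd_pow (h.trans hn))).symm
      have hin : ‖((Algebra.trace ℚ F x - r ⟨l, hl⟩ : ℚ) : ℚ_[l])‖ ≤ 1 := by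
        rw [norm_ratCast_padic_le_one_iff]
        exact hr' ⟨l, hl⟩
      by_cases hlT : (⟨l, hl⟩ : Nat.Primes) ∈ T
      · rw [← Finset.add_sum_erase T r hlT, add_comm, add_sub_assoc, Rat.cast_add, Rat.cast_sum]
        refine (IsUltrametricDist.norm_add_le_max _ _).trans (max_le
          (IsUltrametricDist.norm_sum_le_of_forall_le_of_nonneg zero_le_one fun l' hl' =>
            hout l' fun h => (Finset.mem_erase.1 hl').1 (Subtype.ext h)) ?_)
        rwa [← norm_neg, ← Rat.cast_neg, neg_sub]
      · rw [Rat.cast_sub, Rat.cast_sum]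
        refine (norm_sub_le_max _ _).trans (max_le
          (IsUltrametricDist.norm_sum_le_of_forall_le_of_nonneg zero_le_one fun l' hl' =>
            hout l' fun h => hlT (by rwa [← show l' = ⟨l, hl⟩ from Subtype.ext h])) ?_)
        rw [← sum_trace_padic]
        refine IsUltrametricDist.norm_sum_le_of_forall_le_of_nonneg zero_le_one fun v _ =>
          norm_trace_le_one v ?_
        by_contra hv
        refine hlT (Finset.mem_image.2 ⟨v.1, hfin.mem_toFinset.2 hv, ?_⟩)
        exact huniq _ _ v.1 ((hP _ _).2 (hqv v.1)) ((hP _ _).2 v.2)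
    exact exp_ratCast_eq_of_sub_int (Rat.den_eq_one_iff _ |>.1 hden).symm
  · intro l _ l' _ hll'
    rw [Function.onFun, Finset.disjoint_left]
    exact fun v hv hv' => hll' (huniq l l' v hv hv')
  · intro v hv
    have hv' : ¬ ‖algebraMap F (v.adicCompletion F) x‖ ≤ 1 := fun h => hv (finChar_eq_one v h)
    rw [Finset.mem_coe, Finset.mem_biUnion]
    exact ⟨⟨q v, hq v⟩, Finset.mem_image.2 ⟨v, hfin.mem_toFinset.2 hv', rfl⟩, (hP _ _).2 (hqv v)⟩

end Characters


section AdeleChar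

variable {F : Type*} [Field F] [NumberField F]

theorem finite_mulSupport_finChar (x : Adele F) :
    (Function.mulSupport fun v : HeightOneSpectrum (𝓞 F) => finChar v (finEval v x)).Finite :=
  (Filter.eventually_cofinite.1 (eventually_finEval_le_one x)).subset fun v hv h =>
    hv (finChar_eq_one v h)

theorem finChar_zero (v : HeightOneSpectrum (𝓞 F)) : finChar v (0 : v.adicCompletion F) = 1 :=
  finChar_eq_one v (by simp)

variable [IsTotallyReal F]

theorem isometry_realEmb (v : InfinitePlace F) : Isometry (realEmb v) :=
  InfinitePlace.Completion.isometry_extensionEmbeddingOfIsReal (IsTotallyReal.isReal v)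

theorem continuous_realEmb (v : InfinitePlace F) : Continuous (realEmb v) :=
  (isometry_realEmb v).continuous

theorem norm_realEmb (v : InfinitePlace F) (x : v.Completion) : ‖realEmb v x‖ = ‖x‖ := by
  simpa using (isometry_realEmb v).dist_eq x 0

theorem surjective_realEmb (v : InfinitePlace F) : Function.Surjective (realEmb v) :=
  InfinitePlace.Completion.surjective_extensionEmbeddingOfIsReal (IsTotallyReal.isReal v)

theorem sum_realEmb (x : F) :
    ∑ v : InfinitePlace F, realEmb v (infEval v (algebraMap F (Adele F) x)) =
      ((Algebra.trace ℚ F x : ℚ) : ℝ) := by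
  have h := trace_eq_sum_embeddings (K := ℚ) ℂ (x := x)
  rw [eq_ratCast] at h
  apply Complex.ofReal_injective
  rw [Complex.ofReal_ratCast, h, Complex.ofReal_sum]
  refine Fintype.sum_bijective (fun v : InfinitePlace F => v.embedding.toRatAlgHom) ⟨?_, ?_⟩ _ _ ?_
  · intro v w hvw
    have : v.embedding = w.embedding := congrArg (fun f : F →ₐ[ℚ] ℂ => (f : F →+* ℂ)) hvw
    rw [← v.mk_embedding, this, w.mk_embedding]
  · intro φ
    refine ⟨InfinitePlace.mk (φ : F →+* ℂ), ?_⟩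
    have := InfinitePlace.embedding_mk_eq_of_isReal
      (IsTotallyReal.complexEmbedding_isReal (φ : F →+* ℂ))
    ext y
    exact RingHom.congr_fun this y
  · intro v
    have h1 : realEmb v (infEval v (algebraMap F (Adele F) x)) =
        InfinitePlace.embedding_of_isReal (IsTotallyReal.isReal v) x :=
      InfinitePlace.Completion.extensionEmbeddingOfIsReal_coe (IsTotallyReal.isReal v)
        (WithAbs.toAbs _ x)
    rw [h1]
    exact InfinitePlace.embedding_of_isReal_apply (IsTotallyReal.isReal v) x

theorem infChar_add (v : InfinitePlace F) (x y : v.Completion) :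
    infChar v (x + y) = infChar v x * infChar v y := by
  rw [infChar, infChar, infChar, ← Complex.exp_add, map_add]
  push_cast
  ring_nf

theorem norm_infChar (v : InfinitePlace F) (x : v.Completion) : ‖infChar v x‖ = 1 := by
  rw [infChar, Complex.norm_exp]
  simp

theorem continuous_infChar (v : InfinitePlace F) : Continuous (infChar v) := by
  have := continuous_realEmb v
  unfold infChar
  fun_prop

theorem adeleChar_add (x y : Adele F) : adeleChar (x + y) = adeleChar x * adeleChar y := by
  simp only [adeleChar, map_add, infChar_add, finChar_add, Finset.prod_mul_distrib]
  rw [finprod_mul_distrib (finite_mulSupport_finChar x) (finite_mulSupport_finChar y)]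
  ring

theorem norm_adeleChar (x : Adele F) : ‖adeleChar x‖ = 1 := by
  rw [adeleChar, norm_mul, norm_prod, finprod_eq_prod _ (finite_mulSupport_finChar x), norm_prod]
  simp [norm_infChar, norm_finChar]

theorem continuous_adeleChar : Continuous (adeleChar : Adele F → ℂ) := by
  refine continuous_iff_continuousAt.2 fun x => ?_
  have hc : Continuous fun y : Adele F => (∏ v : InfinitePlace F, infChar v (infEval v y)) *
      ∏ᶠ v : HeightOneSpectrum (𝓞 F), finChar v (finEval v x) :=
    (continuous_finsetProd _ fun v _ => (continuous_infChar v).comp (continuous_infEval v)).mul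
      continuous_const
  refine hc.continuousAt.congr ?_
  have hopen : IsOpen {y : Adele F | ∀ v, True → ‖finEval v (y - x)‖ ≤ 1} :=
    (isOpen_forall_imp_finEval_le_one fun _ => True).preimage (continuous_sub_right x)
  filter_upwards [hopen.mem_nhds (by simp)] with y hy
  rw [adeleChar]
  congr 1
  refine finprod_congr fun v => ?_
  have : finEval v y = finEval v (y - x) + finEval v x := by rw [← map_add, sub_add_cancel]
  rw [this, finChar_add, finChar_eq_one v (hy v trivial), one_mul]

/-- The standard character is trivial on `F`. -/
theorem adeleChar_algebraMap (x : F) : adeleChar (algebraMap F (Adele F) x) = 1 := by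
  simp only [adeleChar, finEval_algebraMap, finprod_finChar, infChar]
  rw [← Complex.exp_sum, ← Finset.mul_sum, ← Complex.ofReal_sum, sum_realEmb, ← Complex.exp_add]
  simp

theorem exists_adeleChar_mul_ne_one {ξ : F} (hξ : ξ ≠ 0) :
    ∃ c : Adele F, adeleChar (algebraMap F (Adele F) ξ * c) ≠ 1 := by
  classical
  obtain ⟨w⟩ : Nonempty (InfinitePlace F) := inferInstance
  obtain ⟨y, hy⟩ := surjective_realEmb w (1 / 2)
  let b : Adele F := (Pi.single w y, 0)
  refine ⟨algebraMap F (Adele F) ξ⁻¹ * b, ?_⟩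
  rw [← mul_assoc, ← map_mul, mul_inv_cancel₀ hξ, map_one, one_mul, adeleChar]
  have h1 : ∀ v, finEval v b = 0 := fun v => rfl
  have h2 : ∀ v, infEval v b = (Pi.single w y : ∀ v : InfinitePlace F, v.Completion) v := fun v => rfl
  simp only [h1, finChar_zero, finprod_one, mul_one]
  rw [Finset.prod_eq_single w]
  · rw [h2, Pi.single_eq_same, infChar, hy]
    have : (2 * Complex.I * Real.pi * ((1 / 2 : ℝ) : ℂ)) = Real.pi * Complex.I := by
      push_cast; ring
    rw [this, Complex.exp_pi_mul_I]
    norm_num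
  · intro v _ hv
    rw [h2, Pi.single_eq_of_ne hv, infChar, map_zero]
    simp
  · simp

omit [IsTotallyReal F] in
theorem exists_int_trace {x : F} (h : ∀ v : HeightOneSpectrum (𝓞 F),
    finChar v (algebraMap F (v.adicCompletion F) x) = 1) : ∃ n : ℤ, Algebra.trace ℚ F x = n := by
  have h1 := finprod_finChar x
  simp only [h, finprod_one] at h1
  obtain ⟨n, hn⟩ := Complex.exp_eq_one_iff.1 h1.symm
  refine ⟨-n, ?_⟩
  have h2 : ((Algebra.trace ℚ F x : ℚ) : ℂ) = -n := by
    have h0 : (2 * Real.pi * Complex.I : ℂ) ≠ 0 := Complex.two_pi_I_ne_zero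
    apply mul_left_cancel₀ h0
    linear_combination -hn
  exact_mod_cast h2

/-- Almost all local characters have conductor `𝓞_v`. -/
theorem eventually_exists_finChar_ne_one : ∀ᶠ v : HeightOneSpectrum (𝓞 F) in Filter.cofinite,
    ∃ x : v.adicCompletion F, ‖x‖ ≤ residueCard v ∧ finChar v x ≠ 1 := by
  rw [Filter.eventually_cofinite]
  have hne : differentIdeal ℤ (𝓞 F) ≠ ⊥ := differentIdeal_ne_bot
  refine (Ideal.finite_factors hne).subset fun v hv => ?_
  simp only [Set.mem_ofPred_eq, not_exists, not_and, not_not] at hv ⊢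
  have hv0 : (v.asIdeal : FractionalIdeal (nonZeroDivisors (𝓞 F)) F) ≠ 0 :=
    FractionalIdeal.coeIdeal_ne_zero.2 v.ne_bot
  have key : (v.asIdeal : FractionalIdeal (nonZeroDivisors (𝓞 F)) F)⁻¹ ≤
      FractionalIdeal.dual ℤ ℚ 1 := by
    intro x hx
    rw [FractionalIdeal.mem_dual (by simp)]
    intro a ha
    obtain ⟨a, rfl⟩ := (FractionalIdeal.mem_one_iff _).1 ha
    rw [Algebra.traceForm_apply]
    have hx' : ∀ y ∈ v.asIdeal, ∃ z : 𝓞 F, (z : F) = x * y := fun y hy =>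
      (FractionalIdeal.mem_one_iff _).1 ((FractionalIdeal.mem_inv_iff hv0).1 hx _
        (FractionalIdeal.mem_coeIdeal_of_mem _ hy))
    obtain ⟨n, hn⟩ := exists_int_trace (x := x * algebraMap (𝓞 F) F a) fun w => by
      by_cases hw : w = v
      · subst hw
        refine hv _ ?_
        obtain ⟨π, hπ0, hπ⟩ := exists_norm_eq w (-1)
        have hq := residueCard_pos w
        have hq1 := one_lt_residueCard w
        have hπ1 : ‖π‖ < 1 := by
          rw [hπ, _root_.zpow_neg_one]; exact inv_lt_one_of_one_lt₀ hq1
        obtain ⟨y, hy⟩ := exists_int_norm_sub_lt w hπ1.le (norm_pos_iff.2 hπ0)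
        have hyn : ‖algebraMap F (w.adicCompletion F) (y : F)‖ = ‖π‖ := by
          rw [sub_eq_add_neg] at hy
          rw [IsUltrametricDist.norm_eq_of_add_norm_lt_max (hy.trans_le (le_max_left _ _)),
            norm_neg]
        obtain ⟨z, hz⟩ := hx' y ((norm_algebraMap_int_lt_one_iff w y).1 (hyn ▸ hπ1))
        have h1 := norm_algebraMap_int_le_one w z
        rw [hz, map_mul, norm_mul, hyn, hπ, _root_.zpow_neg_one, ← div_eq_mul_inv, div_le_one hq] at h1
        rw [map_mul, norm_mul]
        exact (mul_le_of_le_one_right (norm_nonneg _) (norm_algebraMap_int_le_one w a)).trans h1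
      · refine finChar_eq_one w ?_
        obtain ⟨y, hyv, hyw⟩ : ∃ y ∈ v.asIdeal, y ∉ w.asIdeal := by
          by_contra! hle
          exact hw (HeightOneSpectrum.ext
            ((v.isMaximal.eq_of_le w.isPrime.ne_top hle).symm))
        obtain ⟨z, hz⟩ := hx' y hyv
        have h1 := norm_algebraMap_int_le_one w z
        rw [hz, map_mul, norm_mul, (norm_algebraMap_int_eq_one_iff w y).2 hyw, mul_one] at h1
        rw [map_mul, norm_mul]
        exact mul_le_one₀ h1 (norm_nonneg _) (norm_algebraMap_int_le_one w a)
    exact ⟨n, by rw [hn]; rfl⟩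
  have hd := coeIdeal_differentIdeal ℤ ℚ F (𝓞 F)
  rw [Ideal.dvd_iff_le, ← FractionalIdeal.coeIdeal_le_coeIdeal F, hd,
    FractionalIdeal.inv_le_comm (by simp) hv0]
  exact key

end AdeleChar


open scoped ENNReal NNReal Pointwise

section Scaling

theorem lintegral_units_mul {R : Type*} [CommRing R] [TopologicalSpace R] [IsTopologicalRing R]
    [LocallyCompactSpace R] [MeasurableSpace R] [BorelSpace R] [SecondCountableTopology R]
    (μ : Measure R) [μ.IsAddHaarMeasure] [μ.Regular] (t : Rˣ) (f : R → ℝ≥0∞) :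
    ∫⁻ x, f (t * x) ∂μ = (distribHaarChar R t : ℝ≥0∞)⁻¹ * ∫⁻ x, f x ∂μ := by
  let e : R ≃ᵐ R := (Homeomorph.smul t).toMeasurableEquiv
  have he : μ.map e = (distribHaarChar R t : ℝ≥0∞)⁻¹ • μ := by
    refine Measure.ext fun s hs => ?_
    have h1 : e ⁻¹' s = t⁻¹ • s := by
      rw [← Set.preimage_smul]; rfl
    rw [Measure.map_apply e.measurable hs, h1, ← distribHaarChar_mul μ, map_inv,
      ENNReal.coe_inv distribHaarChar_pos.ne']
    rfl
  calc ∫⁻ x, f (t * x) ∂μ = ∫⁻ x, f x ∂(μ.map e) := (lintegral_map_equiv f e).symm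
    _ = _ := by rw [he, lintegral_smul_measure, smul_eq_mul]

end Scaling

section FiniteScaling

variable {F : Type*} [Field F] [NumberField F] (v : HeightOneSpectrum (𝓞 F))

/-- The integral elements are a union of `q_v` translates of the maximal ideal. -/
theorem finMeasure_integers_eq :
    finMeasure v {x | ‖x‖ ≤ 1} = ENNReal.ofReal (residueCard v) * finMeasure v {x | ‖x‖ < 1} := by
  have : Finite (𝓞 F ⧸ v.asIdeal) := Ideal.finiteQuotientOfFreeOfNeBot _ v.ne_bot
  let r : 𝓞 F ⧸ v.asIdeal → 𝓞 F := Quotient.out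
  have hr : ∀ c, Ideal.Quotient.mk v.asIdeal (r c) = c := fun c => Quotient.out_eq c
  have hset : {x : v.adicCompletion F | ‖x‖ ≤ 1} =
      ⋃ c, (fun x => -algebraMap F (v.adicCompletion F) (r c : F) + x) ⁻¹' {x | ‖x‖ < 1} := by
    ext x
    simp only [Set.mem_ofPred_eq, Set.mem_iUnion, Set.mem_preimage]
    constructor
    · intro hx
      obtain ⟨a, ha⟩ := exists_int_norm_sub_lt v hx one_pos
      refine ⟨Ideal.Quotient.mk _ a, ?_⟩
      have h1 : ‖algebraMap F (v.adicCompletion F)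
          ((a - r (Ideal.Quotient.mk _ a) : 𝓞 F) : F)‖ < 1 := by
        rw [norm_algebraMap_int_lt_one_iff, ← Ideal.Quotient.eq, hr]
      have h3 : ((a - r (Ideal.Quotient.mk _ a) : 𝓞 F) : F) = a - r (Ideal.Quotient.mk _ a) :=
        map_sub (algebraMap (𝓞 F) F) a _
      rw [h3, map_sub] at h1
      have h2 := (IsUltrametricDist.norm_add_le_max _ _).trans_lt (max_lt ha h1)
      rw [sub_add_sub_cancel] at h2
      rwa [neg_add_eq_sub]
    · rintro ⟨c, hc⟩
      rw [← add_neg_cancel_left (algebraMap F (v.adicCompletion F) (r c : F)) x]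
      exact (IsUltrametricDist.norm_add_le_max _ _).trans
        (max_le (norm_algebraMap_int_le_one v _) hc.le)
  have hmeas : ∀ c, MeasurableSet ((fun x => -algebraMap F (v.adicCompletion F) (r c : F) + x) ⁻¹'
      {x : v.adicCompletion F | ‖x‖ < 1}) := fun c =>
    ((isOpen_lt continuous_norm continuous_const).preimage
      (continuous_const_add _)).measurableSet
  rw [hset, measure_iUnion _ hmeas]
  · simp_rw [measure_preimage_add]
    rw [ENNReal.tsum_const]
    congr 1
    rw [residueCard, ENNReal.ofReal_natCast, Ideal.absNorm_apply, Submodule.cardQuot_apply,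
      ENat.card_eq_coe_natCard]
    rfl
  · intro c c' hcc'
    rw [Function.onFun, Set.disjoint_left]
    intro x hx hx'
    apply hcc'
    simp only [Set.mem_preimage, Set.mem_ofPred_eq] at hx hx'
    have h1 := (norm_sub_le_max _ _).trans_lt (max_lt hx' hx)
    have h3 : ((r c - r c' : 𝓞 F) : F) = r c - r c' := map_sub (algebraMap (𝓞 F) F) _ _
    rw [add_sub_add_right_eq_sub, neg_sub_neg, ← map_sub, ← h3, norm_algebraMap_int_lt_one_iff, ← Ideal.Quotient.eq, hr, hr] at h1
    exact h1

theorem distribHaarChar_adicCompletion (t : (v.adicCompletion F)ˣ) :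
    (distribHaarChar (v.adicCompletion F) t : ℝ) = ‖(t : v.adicCompletion F)‖ := by
  have h0 : finMeasure v {x | ‖x‖ ≤ 1} ≠ 0 := by
    rw [(isAddHaarMeasure_finMeasure_and v).2]; exact integersVolume_ne_zero v
  have h1 : finMeasure v {x | ‖x‖ ≤ 1} ≠ ⊤ := by
    rw [(isAddHaarMeasure_finMeasure_and v).2]; exact integersVolume_ne_top v
  have hsmul : ∀ t : (v.adicCompletion F)ˣ, t • {x : v.adicCompletion F | ‖x‖ ≤ 1} =
      {x | ‖x‖ ≤ ‖(t : v.adicCompletion F)‖} := by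
    intro t
    ext x
    rw [Set.mem_smul_set_iff_inv_smul_mem, Units.smul_def, Set.mem_ofPred_eq, smul_eq_mul, norm_mul,
      Units.val_inv_eq_inv_val, norm_inv, inv_mul_le_one₀ (norm_pos_iff.2 t.ne_zero)]
    rfl
  have hunit : ∀ u : (v.adicCompletion F)ˣ, ‖(u : v.adicCompletion F)‖ = 1 →
      distribHaarChar (v.adicCompletion F) u = 1 := fun u hu =>
    distribHaarChar_eq_of_measure_smul_eq_mul h0 h1 (by rw [hsmul, hu, ENNReal.coe_one, one_mul])
  obtain ⟨π, hπ0, hπ⟩ := exists_norm_eq v (-1)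
  have hq := one_lt_residueCard v
  have hq0 := residueCard_pos v
  have huni : distribHaarChar (v.adicCompletion F) (Units.mk0 π hπ0) =
      (residueCard v).toNNReal⁻¹ := by
    refine distribHaarChar_eq_of_measure_smul_eq_mul h0 h1 ?_
    have hset : {x : v.adicCompletion F | ‖x‖ ≤ ‖π‖} = {x | ‖x‖ < 1} := by
      ext x
      simp only [Set.mem_ofPred_eq]
      constructor
      · intro h
        refine h.trans_lt ?_
        rw [hπ, _root_.zpow_neg_one]
        exact inv_lt_one_of_one_lt₀ hq
      · intro h
        rcases eq_or_ne x 0 with rfl | hx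
        · simp
        · obtain ⟨n, hn⟩ := exists_norm_eq_zpow v hx
          rw [hn, hπ]
          rw [hn, zpow_lt_one_iff_right₀ hq] at h
          exact zpow_le_zpow_right₀ hq.le (by omega)
    rw [hsmul, Units.val_mk0, hset, finMeasure_integers_eq, ← mul_assoc,
      ENNReal.ofReal, ← ENNReal.coe_mul, inv_mul_cancel₀ (by simpa using hq0), ENNReal.coe_one,
      one_mul]
  obtain ⟨n, hn⟩ := exists_norm_eq_zpow v t.ne_zero
  have h2 : distribHaarChar (v.adicCompletion F) (t * Units.mk0 π hπ0 ^ n) = 1 := by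
    refine hunit _ ?_
    rw [Units.val_mul, norm_mul, Units.val_zpow_eq_zpow_val, norm_zpow, Units.val_mk0, hn, hπ,
      ← _root_.zpow_mul, ← zpow_add₀ hq0.ne', neg_one_mul, add_neg_cancel, zpow_zero]
  rw [map_mul, map_zpow, huni] at h2
  have h3 : distribHaarChar (v.adicCompletion F) t = (residueCard v).toNNReal ^ n := by
    rw [eq_comm, ← one_mul (_ ^ n), ← h2, mul_assoc, ← mul_zpow,
      inv_mul_cancel₀ (by simpa using hq0), _root_.one_zpow, mul_one]
  rw [h3, hn, NNReal.coe_zpow, Real.coe_toNNReal _ hq0.le]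

end FiniteScaling

section InfiniteScaling

variable {F : Type*} [Field F] [NumberField F] [IsTotallyReal F] (v : InfinitePlace F)

theorem map_realEmb_infMeasure : (infMeasure v).map (realEmb v) = volume := by
  let e : v.Completion ≃+ ℝ := AddEquiv.ofBijective (realEmb v).toAddMonoidHom
    ⟨(isometry_realEmb v).injective, surjective_realEmb v⟩
  have he : Continuous e := continuous_realEmb v
  have hes : Continuous e.symm :=
    ((isometry_realEmb v).isUniformInducing.isInducing.continuous_iff).2 <| by
      have : realEmb v ∘ e.symm = id := funext fun x => e.apply_symm_apply x
      rw [this]; exact continuous_id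
  have h : ((infMeasure v).map e).IsAddHaarMeasure := e.isAddHaarMeasure_map _ he hes
  have h1 := Measure.isAddLeftInvariant_eq_smul ((infMeasure v).map e) (volume : Measure ℝ)
  have h2 : (infMeasure v).map e (Metric.closedBall 0 1) = 2 := by
    rw [Measure.map_apply he.measurable Metric.isClosed_closedBall.measurableSet,
      ← (isAddHaarMeasure_infMeasure_and v).2]
    congr 1
    ext x
    simp only [Set.mem_preimage, mem_closedBall_zero_iff, Set.mem_ofPred_eq]
    rw [← norm_realEmb v x]
    rfl
  rw [h1, Measure.smul_apply, Real.volume_closedBall, mul_one, ENNReal.smul_def, smul_eq_mul] at h2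
  have h3 : (((infMeasure v).map e).addHaarScalarFactor volume : ℝ≥0∞) = 1 := by
    rw [show ENNReal.ofReal 2 = 2 by simp] at h2
    exact (ENNReal.mul_eq_right (by simp) (by simp)).1 h2
  have h4 : ((infMeasure v).map e).addHaarScalarFactor (volume : Measure ℝ) = 1 := by
    exact_mod_cast h3
  rw [h4, one_smul] at h1
  exact h1

theorem infMeasure_norm_le {r : ℝ} : infMeasure v {x | ‖x‖ ≤ r} = ENNReal.ofReal (2 * r) := by
  rw [← Real.volume_closedBall 0 r, ← map_realEmb_infMeasure v,
    Measure.map_apply (continuous_realEmb v).measurable Metric.isClosed_closedBall.measurableSet]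
  congr 1
  ext x
  simp only [Set.mem_preimage, mem_closedBall_zero_iff, Set.mem_ofPred_eq, norm_realEmb]

theorem lintegral_infMeasure {f : ℝ → ℝ≥0∞} (hf : Measurable f) :
    ∫⁻ x, f (realEmb v x) ∂(infMeasure v) = ∫⁻ x, f x := by
  rw [← map_realEmb_infMeasure v, lintegral_map hf (continuous_realEmb v).measurable]

theorem distribHaarChar_completion (t : v.Completionˣ) :
    (distribHaarChar v.Completion t : ℝ) = ‖(t : v.Completion)‖ := by
  have h0 := (isAddHaarMeasure_infMeasure_and v).2
  rw [distribHaarChar_eq_of_measure_smul_eq_mul (μ := infMeasure v) (s := {x | ‖x‖ ≤ 1})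
    (by rw [h0]; simp) (by rw [h0]; simp) (r := ‖(t : v.Completion)‖₊), coe_nnnorm]
  have hsmul : t • {x : v.Completion | ‖x‖ ≤ 1} = {x | ‖x‖ ≤ ‖(t : v.Completion)‖} := by
    ext x
    rw [Set.mem_smul_set_iff_inv_smul_mem, Units.smul_def, Set.mem_ofPred_eq, smul_eq_mul, norm_mul,
      Units.val_inv_eq_inv_val, norm_inv, inv_mul_le_one₀ (norm_pos_iff.2 t.ne_zero)]
    rfl
  rw [hsmul, infMeasure_norm_le, h0, mul_comm, ENNReal.ofReal_mul (norm_nonneg _),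
    ofReal_norm, ENNReal.ofReal_ofNat]
  rfl

end InfiniteScaling


open scoped ENNReal NNReal Pointwise

section PrimeZeta

variable (F : Type*) [Field F] [NumberField F]

theorem card_placesOver_le (p : ℕ) [Fact p.Prime] :
    Fintype.card (PlacesOver F p) ≤ Module.finrank ℚ F := by
  have h1 : Module.finrank ℚ_[p] (∀ v : PlacesOver F p, v.1.adicCompletion F) =
      Module.finrank ℚ F := by
    rw [Module.finrank_eq_card_basis (padicBasis F p), ← RingOfIntegers.rank F,
      ← Module.finrank_eq_card_chooseBasisIndex]
  rw [← h1, Module.finrank_pi_fintype, Fintype.card, Finset.card_eq_sum_ones]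
  exact Finset.sum_le_sum fun v _ => Module.finrank_pos

theorem summable_residueCard_rpow {σ : ℝ} (hσ : 1 < σ) :
    Summable fun v : HeightOneSpectrum (𝓞 F) => residueCard v ^ (-σ) := by
  classical
  choose p hp hpv using fun v : HeightOneSpectrum (𝓞 F) => exists_prime_mem_asIdeal v
  have hle : ∀ v, (p v : ℝ) ≤ residueCard v := fun v => by
    have : Fact (p v).Prime := ⟨hp v⟩
    obtain ⟨f, hf, hv⟩ := exists_absNorm_eq_pow (F := F) (p := p v) ⟨v, hpv v⟩
    rw [residueCard]
    exact_mod_cast (Nat.le_self_pow hf _).trans hv.ge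
  have hsum : Summable fun n : ℕ => (n : ℝ) ^ (-σ) := Real.summable_nat_rpow.2 (by linarith)
  refine summable_of_sum_le (c := Module.finrank ℚ F * ∑' n : ℕ, (n : ℝ) ^ (-σ))
    (fun v => (Real.rpow_pos_of_pos (residueCard_pos v) _).le) fun u => ?_
  calc ∑ v ∈ u, residueCard v ^ (-σ) ≤ ∑ v ∈ u, (p v : ℝ) ^ (-σ) :=
        Finset.sum_le_sum fun v _ => Real.rpow_le_rpow_of_nonpos
          (by exact_mod_cast (hp v).pos) (hle v) (by linarith)
    _ = ∑ n ∈ u.image p, {v ∈ u | p v = n}.card • (n : ℝ) ^ (-σ) :=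
        Finset.sum_comp (fun n : ℕ => (n : ℝ) ^ (-σ)) p
    _ ≤ ∑ n ∈ u.image p, Module.finrank ℚ F * (n : ℝ) ^ (-σ) := by
        refine Finset.sum_le_sum fun n hn => ?_
        obtain ⟨w, -, rfl⟩ := Finset.mem_image.1 hn
        have : Fact (p w).Prime := ⟨hp w⟩
        rw [nsmul_eq_mul]
        refine mul_le_mul_of_nonneg_right ?_ (by positivity)
        refine Nat.cast_le.2 (le_trans ?_ (card_placesOver_le F (p w)))
        refine Finset.card_le_card_of_forall_subsingleton
          (fun (v : HeightOneSpectrum (𝓞 F)) (w : PlacesOver F _) => w.1 = v) ?_ ?_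
        · intro v hv
          rw [Finset.mem_filter] at hv
          exact ⟨⟨v, hv.2 ▸ hpv v⟩, Finset.mem_univ _, rfl⟩
        · intro w _ v hv v' hv'
          exact hv.2.symm.trans hv'.2
    _ ≤ _ := by
        rw [← Finset.mul_sum]
        exact mul_le_mul_of_nonneg_left
          (hsum.sum_le_tsum _ fun n _ => by positivity) (by positivity)

theorem exists_prod_eulerFactor_le {σ : ℝ} (hσ : 1 < σ) : ∃ M : ℝ≥0∞, M ≠ ⊤ ∧
    ∀ S : Finset (HeightOneSpectrum (𝓞 F)),
      ∏ v ∈ S, ENNReal.ofReal (1 - residueCard v ^ (-σ))⁻¹ ≤ M := by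
  have hsum := summable_residueCard_rpow F hσ
  refine ⟨ENNReal.ofReal (Real.exp (2 * ∑' v : HeightOneSpectrum (𝓞 F), residueCard v ^ (-σ))),
    ENNReal.ofReal_ne_top, fun S => ?_⟩
  calc ∏ v ∈ S, ENNReal.ofReal (1 - residueCard v ^ (-σ))⁻¹
      ≤ ∏ v ∈ S, ENNReal.ofReal (Real.exp (2 * residueCard v ^ (-σ))) := by
        refine Finset.prod_le_prod' fun v _ => ENNReal.ofReal_le_ofReal ?_
        set x := residueCard v ^ (-σ) with hx
        have h0 : 0 ≤ x := (Real.rpow_pos_of_pos (residueCard_pos v) _).le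
        have h2 : (2 : ℝ) ≤ residueCard v := by
          have := one_lt_residueCard v
          unfold residueCard at this ⊢
          exact_mod_cast Nat.succ_le_of_lt (by exact_mod_cast this)
        have h1 : x ≤ 1 / 2 := by
          calc x ≤ residueCard v ^ (-1 : ℝ) :=
                Real.rpow_le_rpow_of_exponent_le (by linarith) (by linarith)
            _ = (residueCard v)⁻¹ := Real.rpow_neg_one _
            _ ≤ 2⁻¹ := inv_anti₀ two_pos h2
            _ = 1 / 2 := by norm_num
        have h3 := Real.add_one_le_exp (2 * x)
        rw [inv_le_iff_one_le_mul₀ (by linarith)]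
        nlinarith
    _ = ENNReal.ofReal (Real.exp (2 * ∑ v ∈ S, residueCard v ^ (-σ))) := by
        rw [← ENNReal.ofReal_prod_of_nonneg fun v _ => (Real.exp_pos _).le, ← Real.exp_sum,
          Finset.mul_sum]
    _ ≤ _ := by
        refine ENNReal.ofReal_le_ofReal (Real.exp_le_exp.2 ?_)
        exact mul_le_mul_of_nonneg_left (hsum.sum_le_tsum _ fun v _ =>
          (Real.rpow_pos_of_pos (residueCard_pos v) _).le) two_pos.le

end PrimeZeta

section LocalZeta

variable {K : Type*} [NormedField K] [MeasurableSpace Kˣ] [BorelSpace Kˣ]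

/-- Integration over the annuli `‖c‖ ^ n ≤ ‖t‖ < ‖c‖ ^ (n + 1)`. -/
theorem lintegral_units_eq_tsum (ν : Measure Kˣ) [ν.IsMulLeftInvariant] {c : Kˣ}
    (hc : 1 < ‖(c : K)‖) (f : Kˣ → ℝ≥0∞) :
    ∫⁻ t, f t ∂ν = ∑' n : ℤ, ∫⁻ t in {t | 1 ≤ ‖(t : K)‖ ∧ ‖(t : K)‖ < ‖(c : K)‖},
      f (c ^ n * t) ∂ν := by
  have hc0 : 0 < ‖(c : K)‖ := one_pos.trans hc
  set A : Set Kˣ := {t | 1 ≤ ‖(t : K)‖ ∧ ‖(t : K)‖ < ‖(c : K)‖} with hA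
  have hAm : MeasurableSet A :=
    ((isClosed_le continuous_const (continuous_norm.comp Units.continuous_val)).measurableSet).inter
      (isOpen_lt (continuous_norm.comp Units.continuous_val) continuous_const).measurableSet
  have hmem : ∀ (n : ℤ) (t : Kˣ), t ∈ (fun t => (c ^ n)⁻¹ * t) ⁻¹' A ↔
      ‖(t : K)‖ ∈ Set.Ico (‖(c : K)‖ ^ n) (‖(c : K)‖ ^ (n + 1)) := by
    intro n t
    simp only [hA, Set.mem_preimage, Set.mem_ofPred_eq, Units.val_mul, norm_mul, Set.mem_Ico,
      Units.val_inv_eq_inv_val, norm_inv, Units.val_zpow_eq_zpow_val, norm_zpow]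
    rw [le_inv_mul_iff₀ (zpow_pos hc0 n), inv_mul_lt_iff₀ (zpow_pos hc0 n), mul_one,
      zpow_add_one₀ hc0.ne']
  have hU : ⋃ n : ℤ, (fun t => (c ^ n)⁻¹ * t) ⁻¹' A = Set.univ := by
    refine Set.eq_univ_of_forall fun t => Set.mem_iUnion.2 ?_
    obtain ⟨n, hn⟩ := exists_mem_Ico_zpow (norm_pos_iff.2 t.ne_zero) hc
    exact ⟨n, (hmem n t).2 hn⟩
  have hpm : ∀ n : ℤ, MeasurableSet ((fun t => (c ^ n)⁻¹ * t) ⁻¹' A) := fun n =>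
    (Homeomorph.mulLeft (c ^ n)⁻¹).continuous.measurable hAm
  rw [← setLIntegral_univ, ← hU, lintegral_iUnion hpm]
  · refine tsum_congr fun n => ?_
    have := (measurePreserving_mul_left ν (c ^ n)⁻¹).setLIntegral_comp_preimage_emb
      (Homeomorph.mulLeft (c ^ n)⁻¹).measurableEmbedding (fun t => f (c ^ n * t)) A
    simpa using this
  · intro m n hmn
    rw [Function.onFun, Set.disjoint_left]
    intro t hm hn
    rw [hmem] at hm hn
    apply hmn
    have h1 := (zpow_lt_zpow_iff_right₀ hc).1 (hm.1.trans_lt hn.2)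
    have h2 := (zpow_lt_zpow_iff_right₀ hc).1 (hn.1.trans_lt hm.2)
    omega

theorem lintegral_units_ne_top [ProperSpace K] (ν : Measure Kˣ) [ν.IsHaarMeasure] {c : Kˣ}
    (hc : 1 < ‖(c : K)‖) {m : K → ℝ≥0∞} {σ M : ℝ} (hσ : 0 < σ) (hM : σ < M) {C : ℝ≥0∞}
    (hC : C ≠ ⊤) (hm : ∀ x, m x ≤ C * ENNReal.ofReal ((1 + ‖x‖) ^ (-M))) :
    ∫⁻ t : Kˣ, ENNReal.ofReal (‖(t : K)‖ ^ σ) * m t ∂ν ≠ ⊤ := by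
  set r := ‖(c : K)‖ with hr
  have hr0 : 0 < r := one_pos.trans hc
  set δ := min σ (M - σ) with hδ
  have hδ0 : 0 < δ := lt_min hσ (by linarith)
  let b : ℤ → ℝ := fun n => r ^ σ * (r ^ (-δ)) ^ n.natAbs
  have hb0 : ∀ n, 0 ≤ b n := fun n => by positivity
  have hgeo : Summable fun n : ℕ => r ^ σ * (r ^ (-δ)) ^ n :=
    (summable_geometric_of_lt_one (by positivity)
      (Real.rpow_lt_one_of_one_lt_of_neg hc (by linarith))).mul_left _
  have hb : Summable b := by
    rw [summable_int_iff_summable_nat_and_neg]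
    constructor
    · simpa [b] using hgeo
    · simpa [b] using hgeo
  have hkey : ∀ (n : ℤ) (y : ℝ), r ^ n ≤ y → y ≤ r ^ (n + 1) →
      y ^ σ * (1 + y) ^ (-M) ≤ b n := by
    intro n y h1 h2
    have hy : 0 < y := (zpow_pos hr0 n).trans_le h1
    rcases le_or_gt 0 n with hn | hn
    · have hb' : (r ^ n) ^ (-δ) ≤ b n := by
        obtain ⟨k, rfl⟩ := Int.eq_ofNat_of_zero_le hn
        simp only [b, Int.natAbs_natCast, zpow_natCast]
        rw [← Real.rpow_natCast, ← Real.rpow_mul hr0.le, ← Real.rpow_natCast (r ^ (-δ)),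
          ← Real.rpow_mul hr0.le, mul_comm (k : ℝ)]
        exact le_mul_of_one_le_left (by positivity) (Real.one_le_rpow hc.le hσ.le)
      have h1y : 1 ≤ y := (one_le_zpow₀ hc.le hn).trans h1
      calc y ^ σ * (1 + y) ^ (-M) ≤ y ^ σ * y ^ (-M) :=
            mul_le_mul_of_nonneg_left (Real.rpow_le_rpow_of_nonpos hy (by linarith)
              (by linarith)) (by positivity)
        _ = y ^ (σ - M) := by rw [← Real.rpow_add hy]; rfl
        _ ≤ y ^ (-δ) := Real.rpow_le_rpow_of_exponent_le h1y
            (by have := min_le_right σ (M - σ); linarith)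
        _ ≤ (r ^ n) ^ (-δ) := Real.rpow_le_rpow_of_nonpos (zpow_pos hr0 n) h1 (by linarith)
        _ ≤ b n := hb'
    · calc y ^ σ * (1 + y) ^ (-M) ≤ y ^ σ * 1 :=
            mul_le_mul_of_nonneg_left (Real.rpow_le_one_of_one_le_of_nonpos (by linarith)
              (by linarith)) (by positivity)
        _ ≤ (r ^ (n + 1)) ^ σ := by
            rw [mul_one]; exact Real.rpow_le_rpow hy.le h2 hσ.le
        _ = r ^ σ * (r ^ n) ^ σ := by
            rw [zpow_add_one₀ hr0.ne', Real.mul_rpow (by positivity) hr0.le, mul_comm]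
        _ ≤ b n := by
            refine mul_le_mul_of_nonneg_left ?_ (by positivity)
            obtain ⟨k, rfl⟩ : ∃ k : ℕ, n = -k := ⟨n.natAbs, by omega⟩
            rw [Int.natAbs_neg, Int.natAbs_natCast, ← Real.rpow_intCast, ← Real.rpow_mul hr0.le,
              ← Real.rpow_natCast (r ^ (-δ)), ← Real.rpow_mul hr0.le]
            refine Real.rpow_le_rpow_of_exponent_le hc.le ?_
            push_cast
            have := min_le_left σ (M - σ)
            nlinarith [(Nat.cast_nonneg k : (0 : ℝ) ≤ k)]
  rw [lintegral_units_eq_tsum ν hc]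
  set A : Set Kˣ := {t | 1 ≤ ‖(t : K)‖ ∧ ‖(t : K)‖ < r} with hA
  have hAm : MeasurableSet A :=
    ((isClosed_le continuous_const (continuous_norm.comp Units.continuous_val)).measurableSet).inter
      (isOpen_lt (continuous_norm.comp Units.continuous_val) continuous_const).measurableSet
  have hAtop : ν A ≠ ⊤ := by
    refine ne_top_of_le_ne_top (isCompact_units_of_norm_le (K := K) r).measure_lt_top.ne
      (measure_mono fun t ht => ⟨ht.2.le, ?_⟩)
    rw [Units.val_inv_eq_inv_val, norm_inv]
    exact (inv_le_one_of_one_le₀ ht.1).trans hc.le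
  refine ne_top_of_le_ne_top (b := ∑' n, C * ENNReal.ofReal (b n) * ν A) ?_ ?_
  · rw [ENNReal.tsum_mul_right, ENNReal.tsum_mul_left]
    exact ENNReal.mul_ne_top (ENNReal.mul_ne_top hC hb.tsum_ofReal_ne_top) hAtop
  · refine ENNReal.tsum_le_tsum fun n => ?_
    rw [← setLIntegral_const]
    refine setLIntegral_mono' hAm fun t ht => ?_
    refine (mul_le_mul_right (hm _) _).trans ?_
    rw [mul_left_comm]
    refine mul_le_mul_right ?_ _
    rw [← ENNReal.ofReal_mul (by positivity)]
    refine ENNReal.ofReal_le_ofReal (hkey n _ ?_ ?_)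
    · rw [Units.val_mul, norm_mul, Units.val_zpow_eq_zpow_val, norm_zpow]
      exact le_mul_of_one_le_right (zpow_pos hr0 n).le ht.1
    · rw [Units.val_mul, norm_mul, Units.val_zpow_eq_zpow_val, norm_zpow, zpow_add_one₀ hr0.ne']
      exact mul_le_mul_of_nonneg_left ht.2.le (zpow_pos hr0 n).le

theorem lintegral_prod_units_mul [MeasurableSpace K] [BorelSpace K] [ProperSpace K]
    [SecondCountableTopology K] (μ : Measure K) [μ.IsAddHaarMeasure] (ν : Measure Kˣ) [SFinite ν]
    (hK : ∀ t : Kˣ, (distribHaarChar K t : ℝ) = ‖(t : K)‖)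
    {m : K → ℝ≥0∞} (hm : Measurable m) (σ : ℝ) :
    ∫⁻ p : K × Kˣ, ENNReal.ofReal (‖(p.2 : K)‖ ^ σ) * (m (p.2 * p.1) * m p.2) ∂(μ.prod ν) =
      (∫⁻ x, m x ∂μ) * ∫⁻ t : Kˣ, ENNReal.ofReal (‖(t : K)‖ ^ (σ - 1)) * m t ∂ν := by
  have hv : Measurable fun t : Kˣ => (t : K) := Units.continuous_val.measurable
  rw [lintegral_prod_symm _ (by fun_prop)]
  rw [← lintegral_const_mul _ (by fun_prop)]
  refine lintegral_congr fun t => ?_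
  have ht : 0 < ‖(t : K)‖ := norm_pos_iff.2 t.ne_zero
  dsimp only
  rw [lintegral_const_mul _ (by fun_prop), lintegral_mul_const _ (by fun_prop),
    lintegral_units_mul μ t m]
  have h1 : (distribHaarChar K t : ℝ≥0∞) = ENNReal.ofReal ‖(t : K)‖ := by
    rw [← hK t, ENNReal.ofReal_coe_nnreal]
  rw [h1, ← ENNReal.ofReal_inv_of_pos ht, Real.rpow_sub ht, Real.rpow_one, div_eq_mul_inv,
    ENNReal.ofReal_mul (by positivity)]
  ring

end LocalZeta

section UnramifiedZeta

variable {F : Type*} [Field F] [NumberField F] (v : HeightOneSpectrum (𝓞 F))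

theorem exists_unit_norm_eq_residueCard :
    ∃ c : (v.adicCompletion F)ˣ, ‖(c : v.adicCompletion F)‖ = residueCard v := by
  obtain ⟨x, hx, h⟩ := exists_norm_eq v 1
  exact ⟨Units.mk0 x hx, by simpa using h⟩

theorem norm_eq_one_iff_mem_Ico {x : v.adicCompletion F} :
    ‖x‖ = 1 ↔ 1 ≤ ‖x‖ ∧ ‖x‖ < residueCard v := by
  have hq := one_lt_residueCard v
  constructor
  · intro h
    rw [h]
    exact ⟨le_rfl, hq⟩
  · rintro ⟨h1, h2⟩
    obtain ⟨n, hn⟩ := exists_norm_eq_zpow v (norm_pos_iff.1 (one_pos.trans_le h1))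
    rw [hn] at h1 h2 ⊢
    have h3 : 0 ≤ n := (one_le_zpow_iff_right₀ hq).1 h1
    have h4 : n < 1 := (zpow_lt_zpow_iff_right₀ hq).1 (by rwa [zpow_one])
    rw [show n = 0 by omega, zpow_zero]

theorem lintegral_units_indicator {σ : ℝ} (hσ : 0 < σ) :
    ∫⁻ t : (v.adicCompletion F)ˣ, ENNReal.ofReal (‖(t : v.adicCompletion F)‖ ^ σ) *
      Set.indicator {x | ‖x‖ ≤ 1} 1 (t : v.adicCompletion F) ∂(finMulMeasure v) =
      integersVolume v * ENNReal.ofReal (1 - residueCard v ^ (-σ))⁻¹ := by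
  obtain ⟨c, hc⟩ := exists_unit_norm_eq_residueCard v
  have hq := one_lt_residueCard v
  have hq0 := residueCard_pos v
  have hx1 : residueCard v ^ (-σ) < 1 := Real.rpow_lt_one_of_one_lt_of_neg hq (by linarith)
  have hx0 : 0 ≤ residueCard v ^ (-σ) := (Real.rpow_pos_of_pos hq0 _).le
  rw [lintegral_units_eq_tsum (finMulMeasure v) (hc ▸ hq)]
  simp_rw [hc, ← norm_eq_one_iff_mem_Ico]
  have hAm : MeasurableSet {t : (v.adicCompletion F)ˣ | ‖(t : v.adicCompletion F)‖ = 1} :=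
    (isOpen_units_norm_eq_one v).measurableSet
  have h1 : ∀ n : ℤ, ∫⁻ t in {t : (v.adicCompletion F)ˣ | ‖(t : v.adicCompletion F)‖ = 1},
      ENNReal.ofReal (‖((c ^ n * t : (v.adicCompletion F)ˣ) : v.adicCompletion F)‖ ^ σ) *
      Set.indicator {x | ‖x‖ ≤ 1} 1 ((c ^ n * t : (v.adicCompletion F)ˣ) : v.adicCompletion F)
        ∂(finMulMeasure v) =
      if n ≤ 0 then integersVolume v * ENNReal.ofReal ((residueCard v ^ (-σ)) ^ n.natAbs)
        else 0 := by
    intro n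
    have h2 : ∀ t : (v.adicCompletion F)ˣ, ‖(t : v.adicCompletion F)‖ = 1 →
        ‖((c ^ n * t : (v.adicCompletion F)ˣ) : v.adicCompletion F)‖ = residueCard v ^ n := by
      intro t ht
      rw [Units.val_mul, norm_mul, ht, mul_one, Units.val_zpow_eq_zpow_val, norm_zpow, hc]
    split_ifs with hn
    · rw [setLIntegral_congr_fun hAm (g := fun _ =>
        ENNReal.ofReal ((residueCard v ^ (-σ)) ^ n.natAbs)), setLIntegral_const,
        (isHaarMeasure_finMulMeasure_and v).2, mul_comm]
      intro t ht
      dsimp only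
      rw [Set.indicator_of_mem (show _ ∈ {x : v.adicCompletion F | ‖x‖ ≤ 1} by
        rw [Set.mem_ofPred_eq, h2 t ht]; exact zpow_le_one_of_nonpos₀ hq.le hn), Pi.one_apply,
        mul_one, h2 t ht]
      obtain ⟨k, rfl⟩ : ∃ k : ℕ, n = -k := ⟨n.natAbs, by omega⟩
      rw [Int.natAbs_neg, Int.natAbs_natCast, ← Real.rpow_intCast, ← Real.rpow_mul hq0.le,
        ← Real.rpow_natCast (residueCard v ^ (-σ)), ← Real.rpow_mul hq0.le]
      congr 2
      push_cast
      ring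
    · rw [setLIntegral_congr_fun hAm (g := fun _ => 0), lintegral_zero]
      intro t ht
      dsimp only
      rw [Set.indicator_of_notMem, mul_zero]
      rw [Set.mem_ofPred_eq, h2 t ht, not_le]
      exact one_lt_zpow₀ hq (by omega)
  simp_rw [h1]
  rw [← Function.Injective.tsum_eq (g := fun k : ℕ => -(k : ℤ)) (fun a b h => by simpa using h)]
  · simp only [Left.neg_nonpos_iff, Nat.cast_nonneg, if_true, Int.natAbs_neg, Int.natAbs_natCast]
    rw [ENNReal.tsum_mul_left, ← ENNReal.ofReal_tsum_of_nonneg (fun n => pow_nonneg hx0 n)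
      (summable_geometric_of_lt_one hx0 hx1), tsum_geometric_of_lt_one hx0 hx1]
  · intro n hn
    have : n ≤ 0 := by
      by_contra h
      simp [h] at hn
    exact ⟨n.natAbs, by dsimp only; omega⟩

end UnramifiedZeta


open scoped ENNReal NNReal

section Generic

variable {R : Type*} [CommRing R]

theorem act_apply (g : GL (Fin 2) R) (φ : (Fin 2 → R) → ℂ) (x : Fin 2 → R) :
    act g φ x = φ (((g⁻¹ : GL (Fin 2) R) : Matrix (Fin 2) (Fin 2) R) *ᵥ x) := rfl

theorem mulVec_inv_mulVec (g : GL (Fin 2) R) (x : Fin 2 → R) :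
    (g : Matrix (Fin 2) (Fin 2) R) *ᵥ
      (((g⁻¹ : GL (Fin 2) R) : Matrix (Fin 2) (Fin 2) R) *ᵥ x) = x := by
  rw [mulVec_mulVec, ← Units.val_mul, mul_inv_cancel, Units.val_one, one_mulVec]

theorem integrable_whittakerIntegrand [MeasurableSpace R] {nm : R → ℝ} {ψ : R → ℂ} {χ : Rˣ → ℂ}
    {s : ℂ} {φ : (Fin 2 → R) → ℂ} {g : GL (Fin 2) R} {μ : Measure R} {ν : Measure Rˣ}
    (hmeas : AEStronglyMeasurable (whittakerIntegrand nm ψ χ s φ g) (μ.prod ν))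
    (hpos : ∀ t : Rˣ, 0 < nm t) (hψ : ∀ x, ‖ψ x‖ ≤ 1) (hχ : ∀ t, ‖χ t‖ ≤ 1)
    {m : R → ℝ≥0∞} {C : ℝ≥0∞} (hC : C ≠ ⊤) (hm : ∀ x, ‖act g φ x‖ₑ ≤ C * (m (x 0) * m (x 1)))
    (hfin : ∫⁻ p : R × Rˣ, ENNReal.ofReal (nm p.2 ^ (2 * s.re)) * (m (p.2 * p.1) * m p.2)
      ∂(μ.prod ν) ≠ ⊤) :
    Integrable (whittakerIntegrand nm ψ χ s φ g) (μ.prod ν) := by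
  refine ⟨hmeas, lt_of_le_of_lt (b := ∫⁻ p : R × Rˣ, C * (ENNReal.ofReal (nm p.2 ^ (2 * s.re)) *
    (m (p.2 * p.1) * m p.2)) ∂(μ.prod ν)) (lintegral_mono fun p => ?_) ?_⟩
  · have h1 : ‖((nm (p.2 : R) : ℝ) : ℂ) ^ (2 * s)‖ₑ = ENNReal.ofReal (nm p.2 ^ (2 * s.re)) := by
      rw [← ofReal_norm, Complex.norm_cpow_eq_rpow_re_of_pos (hpos p.2)]
      simp
    have h2 : ∀ z : ℂ, ‖z‖ ≤ 1 → ‖z‖ₑ ≤ 1 := fun z hz => by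
      rw [← ofReal_norm]; exact ENNReal.ofReal_le_one.2 hz
    unfold whittakerIntegrand
    simp only [enorm_mul, h1]
    refine (mul_le_of_le_one_right' (h2 _ (hψ _))).trans ?_
    rw [mul_assoc]
    refine (mul_le_of_le_one_left' (h2 _ (hχ _))).trans ?_
    rw [mul_left_comm]
    refine mul_le_mul_right ((hm _).trans_eq ?_) _
    simp
  · rw [lintegral_const_mul' _ _ hC]
    exact (ENNReal.mul_ne_top hC hfin).lt_top

variable [TopologicalSpace R] [IsTopologicalRing R]

theorem continuous_act (g : GL (Fin 2) R) {φ : (Fin 2 → R) → ℂ} (hφ : Continuous φ) :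
    Continuous (act g φ) :=
  hφ.comp (continuous_const.matrix_mulVec continuous_id)

theorem continuous_whittakerIntegrand {nm : R → ℝ} {ψ : R → ℂ} {χ : Rˣ → ℂ} {s : ℂ}
    {φ : (Fin 2 → R) → ℂ} {g : GL (Fin 2) R} (hnm : Continuous fun t : Rˣ => nm t)
    (hpos : ∀ t : Rˣ, 0 < nm t) (hψ : Continuous ψ) (hχ : Continuous χ) (hφ : Continuous φ) :
    Continuous (whittakerIntegrand nm ψ χ s φ g) := by
  unfold whittakerIntegrand
  refine ((((hχ.comp continuous_snd).mul ?_).mul ?_).mul (hψ.comp continuous_fst))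
  · refine Continuous.cpow (Complex.continuous_ofReal.comp (hnm.comp continuous_snd))
      continuous_const fun p => Or.inl ?_
    exact hpos p.2
  · refine (continuous_act g hφ).comp (continuous_pi fun i => ?_)
    have h2 : Continuous fun p : R × Rˣ => (p.2 : R) := Units.continuous_val.comp continuous_snd
    fin_cases i
    · exact h2.mul continuous_fst
    · simpa using h2

end Generic

section SchwartzBruhat

variable {F : Type*} [Field F] [NumberField F]

theorem exists_norm_le_of_isCompact {K : Set (FiniteAdeleRing (𝓞 F) F)} (hK : IsCompact K) :
    ∃ R : HeightOneSpectrum (𝓞 F) → ℝ, (∀ᶠ v in Filter.cofinite, R v = 1) ∧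
      ∀ x ∈ K, ∀ v, ‖x v‖ ≤ R v := by
  classical
  obtain ⟨S, hS⟩ := hK.elim_directed_cover
    (fun S : Finset (HeightOneSpectrum (𝓞 F)) => {x | ∀ v, v ∉ S → ‖x v‖ ≤ 1})
    (fun S => isOpen_forall_imp_norm_le_one fun v => v ∉ S)
    (fun x _ => Set.mem_iUnion.2 ⟨(finite_one_lt_norm x).toFinset, fun v hv => by
      simpa using hv⟩)
    (Monotone.directed_le fun S T hST x hx v hv => hx v fun h => hv (Finset.mem_of_subset hST h))
  choose B hB using fun v : HeightOneSpectrum (𝓞 F) =>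
    hK.exists_bound_of_continuousOn (continuous_finiteAdele_apply v).continuousOn
  refine ⟨fun v => if v ∈ S then B v else 1, ?_, fun x hx v => ?_⟩
  · filter_upwards [S.finite_toSet.compl_mem_cofinite] with v hv
    exact if_neg hv
  · dsimp only
    split_ifs with h
    · exact hB v x hx
    · exact hS hx v h

variable [IsTotallyReal F]

/-- The archimedean component of a vector of adeles. -/
noncomputable def infVec (x : Fin 2 → Adele F) : Fin 2 → InfinitePlace F → ℝ :=
  fun i v => realEmb v (infEval v (x i))

theorem norm_infEval_le_norm_infVec (x : Fin 2 → Adele F) (i : Fin 2) (v : InfinitePlace F) :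
    ‖infEval v (x i)‖ ≤ ‖infVec x‖ := by
  rw [← norm_realEmb]
  exact (norm_le_pi_norm (infVec x i) v).trans (norm_le_pi_norm (infVec x) i)

/-- Continuous functions on `𝔸²` that decay rapidly at the infinite places, and have bounded support
at the finite places. -/
structure IsRapidlyDecreasing (Φ : (Fin 2 → Adele F) → ℂ) : Prop where
  continuous : Continuous Φ
  support : ∃ R : HeightOneSpectrum (𝓞 F) → ℝ, (∀ᶠ v in Filter.cofinite, R v = 1) ∧
    ∀ x, Φ x ≠ 0 → ∀ i v, ‖finEval v (x i)‖ ≤ R v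
  decay : ∀ k : ℕ, ∃ C : ℝ, ∀ x, (1 + ‖infVec x‖) ^ k * ‖Φ x‖ ≤ C

theorem isRapidlyDecreasing_of_mem_schwartzBruhat {φ : (Fin 2 → Adele F) → ℂ}
    (hφ : φ ∈ SchwartzBruhat F) : IsRapidlyDecreasing φ := by
  unfold SchwartzBruhat at hφ
  induction hφ using Submodule.span_induction with
  | mem φ h =>
    obtain ⟨φf, f, h1, h2, h3⟩ := h
    have hcf : Continuous fun x : Fin 2 → Adele F => φf fun i => (x i).2 :=
      h1.continuous.comp (continuous_pi fun i => (continuous_snd (X := InfiniteAdeleRing F)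
        (Y := FiniteAdeleRing (𝓞 F) F)).comp (continuous_apply i))
    have hci : Continuous fun x : Fin 2 → Adele F => f (infVec x) :=
      f.continuous.comp (continuous_pi fun i => continuous_pi fun v =>
        (continuous_realEmb v).comp ((continuous_infEval v).comp (continuous_apply i)))
    have h3' : φ = fun x => φf (fun i => (x i).2) * f (infVec x) := funext h3
    refine ⟨h3' ▸ hcf.mul hci, ?_, fun k => ?_⟩
    · have hK : ∀ i : Fin 2, IsCompact ((fun x : Fin 2 → FiniteAdeleRing (𝓞 F) F => x i) ''
          tsupport φf) := fun i => IsCompact.image h2 (continuous_apply i)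
      obtain ⟨R, hR, hR'⟩ := exists_norm_le_of_isCompact ((hK 0).union (hK 1))
      refine ⟨R, hR, fun x hx i v => ?_⟩
      have hx' : (fun i => (x i).2) ∈ tsupport φf := by
        refine subset_tsupport _ fun h => hx ?_
        rw [h3, h, zero_mul]
      refine hR' (x i).2 ?_ v
      fin_cases i
      · exact Or.inl ⟨_, hx', rfl⟩
      · exact Or.inr ⟨_, hx', rfl⟩
    · obtain ⟨B, hB⟩ := h2.exists_bound_of_continuous h1.continuous
      refine ⟨B * (2 ^ k * ((Finset.Iic (k, 0)).sup fun m =>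
        SchwartzMap.seminorm ℝ m.1 m.2) f), fun x => ?_⟩
      have h4 := SchwartzMap.one_add_le_sup_seminorm_apply (𝕜 := ℝ) (m := (k, 0)) le_rfl le_rfl f
        (infVec x)
      rw [norm_iteratedFDeriv_zero] at h4
      rw [h3', norm_mul, mul_left_comm]
      exact mul_le_mul (hB _) h4 (by positivity) ((norm_nonneg _).trans (hB (fun i => (x i).2)))
  | zero =>
    exact ⟨continuous_const, ⟨1, by simp, by simp⟩, fun k => ⟨0, by simp⟩⟩
  | add φ φ' _ _ h h' =>
    obtain ⟨R, hR, hR1⟩ := h.support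
    obtain ⟨R', hR', hR1'⟩ := h'.support
    refine ⟨h.continuous.add h'.continuous, ⟨fun v => max (R v) (R' v), ?_, ?_⟩, fun k => ?_⟩
    · filter_upwards [hR, hR'] with v h1 h2
      rw [h1, h2, max_self]
    · intro x hx i v
      by_cases h0 : φ x = 0
      · refine (hR1' x (fun h1 => hx ?_) i v).trans (le_max_right _ _)
        simp [h0, h1]
      · exact (hR1 x h0 i v).trans (le_max_left _ _)
    · obtain ⟨C, hC⟩ := h.decay k
      obtain ⟨C', hC'⟩ := h'.decay k
      refine ⟨C + C', fun x => ?_⟩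
      refine le_trans ?_ (add_le_add (hC x) (hC' x))
      rw [← mul_add]
      exact mul_le_mul_of_nonneg_left (norm_add_le _ _) (by positivity)
  | smul a φ _ h =>
    obtain ⟨R, hR, hR1⟩ := h.support
    refine ⟨h.continuous.const_smul a, ⟨R, hR, fun x hx => hR1 x fun h0 => hx ?_⟩, fun k => ?_⟩
    · simp [h0]
    · obtain ⟨C, hC⟩ := h.decay k
      refine ⟨‖a‖ * C, fun x => ?_⟩
      rw [Pi.smul_apply, norm_smul, mul_left_comm]
      exact mul_le_mul_of_nonneg_left (hC x) (norm_nonneg a)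

theorem exists_norm_mulVec_le (A : Matrix (Fin 2) (Fin 2) (Adele F)) :
    ∃ B : ℝ, 0 ≤ B ∧ ∀ x, ‖infVec (A *ᵥ x)‖ ≤ B * ‖infVec x‖ := by
  refine ⟨∑ v : InfinitePlace F, ∑ i, ∑ j, ‖infEval v (A i j)‖, by positivity, fun x => ?_⟩
  have h0 : 0 ≤ (∑ v : InfinitePlace F, ∑ i, ∑ j, ‖infEval v (A i j)‖) * ‖infVec x‖ := by positivity
  refine (pi_norm_le_iff_of_nonneg h0).2 fun i => (pi_norm_le_iff_of_nonneg h0).2 fun v => ?_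
  rw [infVec, norm_realEmb]
  calc ‖infEval v ((A *ᵥ x) i)‖ = ‖∑ j, infEval v (A i j) * infEval v (x j)‖ := by
        rw [mulVec, dotProduct, map_sum]
        simp_rw [map_mul]
    _ ≤ ∑ j, ‖infEval v (A i j)‖ * ‖infVec x‖ := by
        refine (norm_sum_le _ _).trans (Finset.sum_le_sum fun j _ => ?_)
        rw [norm_mul]
        exact mul_le_mul_of_nonneg_left (norm_infEval_le_norm_infVec x j v) (norm_nonneg _)
    _ = (∑ j, ‖infEval v (A i j)‖) * ‖infVec x‖ := (Finset.sum_mul _ _ _).symm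
    _ ≤ _ := by
        refine mul_le_mul_of_nonneg_right ?_ (norm_nonneg _)
        refine le_trans ?_ (Finset.single_le_sum (f := fun v : InfinitePlace F =>
          ∑ i, ∑ j, ‖infEval v (A i j)‖) (fun v _ => by positivity) (Finset.mem_univ v))
        exact Finset.single_le_sum (f := fun i => ∑ j, ‖infEval v (A i j)‖)
          (fun v _ => by positivity) (Finset.mem_univ i)

theorem IsRapidlyDecreasing.act {Φ : (Fin 2 → Adele F) → ℂ} (h : IsRapidlyDecreasing Φ)
    (g : GL (Fin 2) (Adele F)) : IsRapidlyDecreasing (act g Φ) := by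
  refine ⟨continuous_act g h.continuous, ?_, fun k => ?_⟩
  · obtain ⟨R, hR, hR1⟩ := h.support
    refine ⟨fun v => max 1 (∑ i, ∑ j, if ‖finEval v (g i j)‖ ≤ 1 then 0 else ‖finEval v (g i j)‖) *
      R v, ?_, fun x hx i v => ?_⟩
    · filter_upwards [hR, Filter.eventually_all.2 fun i => Filter.eventually_all.2 fun j =>
        eventually_finEval_le_one (g i j)] with v h1 h2
      simp [h1, h2]
    · have h1 := hR1 _ hx
      set y := ((g⁻¹ : GL (Fin 2) (Adele F)) : Matrix (Fin 2) (Fin 2) (Adele F)) *ᵥ x with hy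
      set G := max 1 (∑ i, ∑ j, if ‖finEval v (g i j)‖ ≤ 1 then 0 else ‖finEval v (g i j)‖) with hG
      have hgG : ∀ i j, ‖finEval v (g i j)‖ ≤ G := by
        intro i j
        by_cases hij : ‖finEval v (g i j)‖ ≤ 1
        · exact hij.trans (le_max_left _ _)
        · refine le_trans ?_ (le_max_right _ _)
          have hnn : ∀ i j, 0 ≤ if ‖finEval v (g i j)‖ ≤ 1 then 0 else ‖finEval v (g i j)‖ :=
            fun i j => by split_ifs <;> positivity
          refine le_trans ?_ (Finset.single_le_sum (f := fun i => ∑ j,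
            if ‖finEval v (g i j)‖ ≤ 1 then 0 else ‖finEval v (g i j)‖)
            (fun i _ => Finset.sum_nonneg fun j _ => hnn i j) (Finset.mem_univ i))
          refine le_trans ?_ (Finset.single_le_sum (f := fun j =>
            if ‖finEval v (g i j)‖ ≤ 1 then 0 else ‖finEval v (g i j)‖)
            (fun j _ => hnn i j) (Finset.mem_univ j))
          simp [hij]
      have hG0 : 0 ≤ G := zero_le_one.trans (le_max_left _ _)
      have h2 : ∀ j, ‖finEval v (g i j) * finEval v (y j)‖ ≤ G * R v := fun j => by
        rw [norm_mul]
        exact mul_le_mul (hgG i j) (h1 j v) (norm_nonneg _) hG0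
      have hxy : x i = g i 0 * y 0 + g i 1 * y 1 := by
        conv_lhs => rw [← mulVec_inv_mulVec g x, ← hy]
        simp [mulVec, dotProduct]
      rw [hxy, map_add, map_mul, map_mul]
      exact (IsUltrametricDist.norm_add_le_max _ _).trans (max_le (h2 0) (h2 1))
  · obtain ⟨C, hC⟩ := h.decay k
    obtain ⟨B, hB, hB'⟩ := exists_norm_mulVec_le (g : Matrix (Fin 2) (Fin 2) (Adele F))
    refine ⟨(1 + B) ^ k * C, fun x => ?_⟩
    have h1 := hB' (((g⁻¹ : GL (Fin 2) (Adele F)) : Matrix (Fin 2) (Fin 2) (Adele F)) *ᵥ x)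
    rw [mulVec_inv_mulVec] at h1
    refine le_trans ?_ (mul_le_mul_of_nonneg_left
      (hC (((g⁻¹ : GL (Fin 2) (Adele F)) : Matrix (Fin 2) (Fin 2) (Adele F)) *ᵥ x))
      (by positivity))
    rw [← mul_assoc, ← mul_pow, act_apply]
    refine mul_le_mul_of_nonneg_right (pow_le_pow_left₀ (by positivity) ?_ k) (norm_nonneg _)
    nlinarith [norm_nonneg (infVec (((g⁻¹ : GL (Fin 2) (Adele F)) :
      Matrix (Fin 2) (Fin 2) (Adele F)) *ᵥ x))]

open scoped Classical in
/-- The function `∏_{v ∣ ∞} (1 + |x_v|)^{-M} ∏_{v ∤ ∞} 1_{|x_v| ≤ R_v}`. -/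
noncomputable def adeleMajorant (M : ℕ) (R : HeightOneSpectrum (𝓞 F) → ℝ) (x : Adele F) : ℝ≥0∞ :=
  (∏ v : InfinitePlace F, ENNReal.ofReal ((1 + ‖infEval v x‖) ^ (-(M : ℝ)))) *
    if ∀ v, ‖finEval v x‖ ≤ R v then 1 else 0

theorem IsRapidlyDecreasing.exists_majorant {Φ : (Fin 2 → Adele F) → ℂ}
    (h : IsRapidlyDecreasing Φ) : ∃ R : HeightOneSpectrum (𝓞 F) → ℝ,
      (∀ᶠ v in Filter.cofinite, R v = 1) ∧ ∀ M : ℕ, ∃ C : ℝ≥0∞, C ≠ ⊤ ∧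
        ∀ x, ‖Φ x‖ₑ ≤ C * (adeleMajorant M R (x 0) * adeleMajorant M R (x 1)) := by
  classical
  obtain ⟨R, hR, hR1⟩ := h.support
  refine ⟨R, hR, fun M => ?_⟩
  obtain ⟨C, hC⟩ := h.decay (M * Fintype.card (InfinitePlace F) + M * Fintype.card (InfinitePlace F))
  refine ⟨ENNReal.ofReal C, ENNReal.ofReal_ne_top, fun x => ?_⟩
  rcases eq_or_ne (Φ x) 0 with h0 | h0
  · simp [h0]
  unfold adeleMajorant
  rw [if_pos fun v => hR1 x h0 0 v, if_pos fun v => hR1 x h0 1 v, mul_one, mul_one,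
    ← ENNReal.ofReal_prod_of_nonneg fun v _ => by positivity,
    ← ENNReal.ofReal_prod_of_nonneg fun v _ => by positivity,
    ← ENNReal.ofReal_mul (Finset.prod_nonneg fun v _ => by positivity),
    ← ENNReal.ofReal_mul ((by positivity : (0 : ℝ) ≤ _).trans (hC x)), ← ofReal_norm]
  refine ENNReal.ofReal_le_ofReal ?_
  have h1 : ∀ i, ∏ v : InfinitePlace F, (1 + ‖infEval v (x i)‖) ^ (-(M : ℝ)) =
      (∏ v : InfinitePlace F, (1 + ‖infEval v (x i)‖) ^ M)⁻¹ := fun i => by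
    rw [← Finset.prod_inv_distrib]
    exact Finset.prod_congr rfl fun v _ => by
      rw [Real.rpow_neg (by positivity), Real.rpow_natCast]
  have h2 : ∀ i, ∏ v : InfinitePlace F, (1 + ‖infEval v (x i)‖) ^ M ≤
      (1 + ‖infVec x‖) ^ (M * Fintype.card (InfinitePlace F)) := fun i => by
    rw [pow_mul, ← Finset.card_univ, ← Finset.prod_const]
    refine Finset.prod_le_prod (fun v _ => by positivity) fun v _ => ?_
    exact pow_le_pow_left₀ (by positivity)
      (add_le_add_right (norm_infEval_le_norm_infVec x i v) 1) M
  have h3 : ∀ i, 0 < ∏ v : InfinitePlace F, (1 + ‖infEval v (x i)‖) ^ M := fun i =>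
    Finset.prod_pos fun v _ => by positivity
  rw [h1, h1, ← mul_inv, ← div_eq_mul_inv, le_div_iff₀ (mul_pos (h3 0) (h3 1)), mul_comm]
  refine le_trans (mul_le_mul_of_nonneg_right ?_ (norm_nonneg _)) (hC x)
  rw [pow_add]
  exact mul_le_mul (h2 0) (h2 1) (h3 1).le (by positivity)

end SchwartzBruhat


open scoped ENNReal NNReal

section LocalMajorants

variable {F : Type*} [Field F] [NumberField F]

theorem exists_unit_one_lt_norm (v : InfinitePlace F) :
    ∃ c : v.Completionˣ, 1 < ‖(c : v.Completion)‖ := by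
  have h := norm_completion_two v
  refine ⟨Units.mk0 2 (norm_pos_iff.1 (by rw [h]; norm_num)), ?_⟩
  rw [Units.val_mk0, h]
  norm_num

theorem lintegral_infMeasure_ne_top [IsTotallyReal F] (v : InfinitePlace F) {M : ℝ} (hM : 1 < M) :
    ∫⁻ x, ENNReal.ofReal ((1 + ‖x‖) ^ (-M)) ∂(infMeasure v) ≠ ⊤ := by
  have h1 : ∫⁻ x : ℝ, ENNReal.ofReal ((1 + ‖x‖) ^ (-M)) < ⊤ :=
    finite_integral_one_add_norm (by simpa using hM)
  have h2 := lintegral_infMeasure v (f := fun x => ENNReal.ofReal ((1 + ‖x‖) ^ (-M))) (by fun_prop)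
  simp only [norm_realEmb] at h2
  rw [h2]
  exact h1.ne

theorem lintegral_infMulMeasure_ne_top (v : InfinitePlace F) {σ M : ℝ} (hσ : 0 < σ) (hM : σ < M) :
    ∫⁻ t : v.Completionˣ, ENNReal.ofReal (‖(t : v.Completion)‖ ^ σ) *
      ENNReal.ofReal ((1 + ‖(t : v.Completion)‖) ^ (-M)) ∂(infMulMeasure v) ≠ ⊤ := by
  obtain ⟨c, hc⟩ := exists_unit_one_lt_norm v
  exact lintegral_units_ne_top (infMulMeasure v) hc
    (m := fun x => ENNReal.ofReal ((1 + ‖x‖) ^ (-M))) hσ hM ENNReal.one_ne_top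
    fun x => by rw [one_mul]

theorem measurable_indicator_norm_le (v : HeightOneSpectrum (𝓞 F)) (R : ℝ) :
    Measurable (Set.indicator {x : v.adicCompletion F | ‖x‖ ≤ R} (1 : v.adicCompletion F → ℝ≥0∞)) :=
  measurable_one.indicator (isClosed_le continuous_norm continuous_const).measurableSet

theorem lintegral_finMeasure_ne_top (v : HeightOneSpectrum (𝓞 F)) (R : ℝ) :
    ∫⁻ x, Set.indicator {x : v.adicCompletion F | ‖x‖ ≤ R} 1 x ∂(finMeasure v) ≠ ⊤ := by
  rw [lintegral_indicator_one (isClosed_le continuous_norm continuous_const).measurableSet]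
  refine ne_top_of_le_ne_top (isCompact_closedBall (0 : v.adicCompletion F) R).measure_lt_top.ne
    (measure_mono fun x hx => ?_)
  exact mem_closedBall_zero_iff.2 hx

theorem lintegral_finMulMeasure_ne_top (v : HeightOneSpectrum (𝓞 F)) (R : ℝ) {σ : ℝ} (hσ : 0 < σ) :
    ∫⁻ t : (v.adicCompletion F)ˣ, ENNReal.ofReal (‖(t : v.adicCompletion F)‖ ^ σ) *
      Set.indicator {x : v.adicCompletion F | ‖x‖ ≤ R} 1 (t : v.adicCompletion F)
        ∂(finMulMeasure v) ≠ ⊤ := by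
  obtain ⟨c, hc⟩ := exists_unit_norm_eq_residueCard v
  refine lintegral_units_ne_top (finMulMeasure v) (hc ▸ one_lt_residueCard v) hσ (lt_add_one σ)
    (C := ENNReal.ofReal ((1 + |R|) ^ (σ + 1))) ENNReal.ofReal_ne_top fun x => ?_
  by_cases hx : ‖x‖ ≤ R
  · rw [Set.indicator_of_mem (by exact hx), Pi.one_apply, ← ENNReal.ofReal_mul (by positivity),
      ENNReal.one_le_ofReal, Real.rpow_neg (by positivity), ← div_eq_mul_inv,
      one_le_div (by positivity)]
    refine Real.rpow_le_rpow (by positivity) ?_ (by linarith)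
    have := le_abs_self R
    linarith
  · rw [Set.indicator_of_notMem (by exact hx)]
    exact zero_le

end LocalMajorants

section GlobalIntegrability

variable {F : Type*} [Field F] [NumberField F] [IsTotallyReal F]

theorem adeleMajorant_eq_prod {M : ℕ} {R : HeightOneSpectrum (𝓞 F) → ℝ}
    {S : Finset (HeightOneSpectrum (𝓞 F))} (hR : ∀ v ∉ S, R v = 1) {x : Adele F}
    (hx : ∀ v ∉ S, ‖finEval v x‖ ≤ 1) :
    adeleMajorant M R x =
      (∏ v : InfinitePlace F, ENNReal.ofReal ((1 + ‖infEval v x‖) ^ (-(M : ℝ)))) *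
        ∏ v ∈ S, Set.indicator {x : v.adicCompletion F | ‖x‖ ≤ R v} 1 (finEval v x) := by
  classical
  unfold adeleMajorant
  congr 1
  split_ifs with h
  · exact (Finset.prod_eq_one fun v _ => Set.indicator_of_mem
      (s := {x : v.adicCompletion F | ‖x‖ ≤ R v}) (h v) _).symm
  · push Not at h
    obtain ⟨v, hv⟩ := h
    refine (Finset.prod_eq_zero (i := v) ?_ (Set.indicator_of_notMem ?_ _)).symm
    · by_contra hvS
      exact absurd (hx v hvS) (by rw [hR v hvS] at hv; exact not_le.2 hv)
    · exact not_le.2 hv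

theorem adeleNorm_rpow_eq_prod {t : (Adele F)ˣ} {S : Finset (HeightOneSpectrum (𝓞 F))}
    (h : ∀ v ∉ S, ‖finEval v (t : Adele F)‖ = 1) (σ : ℝ) :
    ENNReal.ofReal (adeleNorm (t : Adele F) ^ σ) =
      (∏ v : InfinitePlace F, ENNReal.ofReal (‖infEval v (t : Adele F)‖ ^ σ)) *
        ∏ v ∈ S, ENNReal.ofReal (‖finEval v (t : Adele F)‖ ^ σ) := by
  rw [adeleNorm_eq_prod h, Real.mul_rpow (by positivity) (by positivity),
    ENNReal.ofReal_mul (by positivity), ← Real.finsetProd_rpow _ _ fun v _ => by positivity,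
    ← Real.finsetProd_rpow _ _ fun v _ => by positivity,
    ENNReal.ofReal_prod_of_nonneg fun v _ => by positivity,
    ENNReal.ofReal_prod_of_nonneg fun v _ => by positivity]
  simp_rw [IsTotallyReal.mult_eq, pow_one]

theorem prod_le_prod_mul_of_eq_one_mul {J : Type*} [DecidableEq J] {S₁ S : Finset J} (h : S₁ ⊆ S)
    {k e : J → ℝ≥0∞} (hk : ∀ j ∉ S₁, k j = e j) {B : ℝ≥0∞} (hB : ∀ S : Finset J, ∏ j ∈ S, e j ≤ B) :
    ∏ j ∈ S, k j ≤ (∏ j ∈ S₁, k j) * B := by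
  rw [← Finset.prod_sdiff h, mul_comm]
  refine mul_le_mul_right ?_ _
  rw [Finset.prod_congr rfl fun j hj => hk j (Finset.mem_sdiff.1 hj).2]
  exact hB _

theorem lintegral_idele_majorant_ne_top {σ : ℝ} (hσ : 1 < σ) {M : ℕ} (hM : σ < M)
    {R : HeightOneSpectrum (𝓞 F) → ℝ} (hR : ∀ᶠ v in Filter.cofinite, R v = 1) :
    ∫⁻ t : (Adele F)ˣ, ENNReal.ofReal (adeleNorm (t : Adele F) ^ σ) *
      adeleMajorant M R (t : Adele F) ∂(ideleMeasure F) ≠ ⊤ := by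
  classical
  have hR' := hR.and (Filter.eventually_cofinite.2 (finite_integersVolume_ne_one (F := F)))
  let S₁ := (Filter.eventually_cofinite.1 hR').toFinset
  have hS₁ : ∀ v ∉ S₁, R v = 1 ∧ integersVolume v = 1 := fun v hv => by
    by_contra h
    exact hv ((Set.Finite.mem_toFinset _).2 h)
  obtain ⟨B, hB, hB'⟩ := exists_prod_eulerFactor_le F hσ
  have hval : ∀ v : HeightOneSpectrum (𝓞 F), Measurable fun t : (v.adicCompletion F)ˣ =>
    (t : v.adicCompletion F) := fun v => Units.continuous_val.measurable
  have hval' : ∀ v : InfinitePlace F, Measurable fun t : v.Completionˣ =>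
    (t : v.Completion) := fun v => Units.continuous_val.measurable
  refine ((isRestrictedProductMeasure_idele F).lintegral_lt_top (S₁ := S₁)
    (f := fun v t => ENNReal.ofReal (‖(t : v.Completion)‖ ^ σ) *
      ENNReal.ofReal ((1 + ‖(t : v.Completion)‖) ^ (-(M : ℝ))))
    (k := fun v t => ENNReal.ofReal (‖(t : v.adicCompletion F)‖ ^ σ) *
      Set.indicator {x : v.adicCompletion F | ‖x‖ ≤ R v} 1 (t : v.adicCompletion F))
    (fun v => ?_) (fun v => ?_) (fun S hS t ht => ?_) (fun v => ?_)
    (M := (∏ v ∈ S₁, ∫⁻ t : (v.adicCompletion F)ˣ,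
      ENNReal.ofReal (‖(t : v.adicCompletion F)‖ ^ σ) *
      Set.indicator {x : v.adicCompletion F | ‖x‖ ≤ R v} 1 (t : v.adicCompletion F)
        ∂(finMulMeasure v)) * B) ?_ fun S hS => ?_).ne
  · have := hval' v; fun_prop
  · exact ((hval v).norm.pow_const σ).ennreal_ofReal.mul
      ((measurable_indicator_norm_le v (R v)).comp (hval v))
  · have h1 : ∀ v ∉ S, ‖finEval v (t : Adele F)‖ = 1 := ht
    rw [adeleNorm_rpow_eq_prod h1,
      adeleMajorant_eq_prod (fun v hv => (hS₁ v fun h => hv (hS h)).1) fun v hv => (h1 v hv).le,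
      Finset.prod_mul_distrib, Finset.prod_mul_distrib]
    simp only [val_infUnit, val_finUnit]
    ring
  · exact lintegral_infMulMeasure_ne_top v (by linarith) hM
  · exact ENNReal.mul_ne_top (ENNReal.prod_ne_top fun v _ =>
      lintegral_finMulMeasure_ne_top v (R v) (by linarith)) hB
  · refine prod_le_prod_mul_of_eq_one_mul hS (fun v hv => ?_) hB'
    rw [(hS₁ v hv).1, lintegral_units_indicator v (by linarith), (hS₁ v hv).2, one_mul]

theorem lintegral_prod_majorant_ne_top {σ : ℝ} (hσ : 2 < σ) {M : ℕ} (hM : σ < M)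
    {R : HeightOneSpectrum (𝓞 F) → ℝ} (hR : ∀ᶠ v in Filter.cofinite, R v = 1) :
    ∫⁻ p : Adele F × (Adele F)ˣ, ENNReal.ofReal (adeleNorm (p.2 : Adele F) ^ σ) *
      (adeleMajorant M R (p.2 * p.1) * adeleMajorant M R p.2)
        ∂((adeleMeasure F).prod (ideleMeasure F)) ≠ ⊤ := by
  classical
  have hR' := hR.and (Filter.eventually_cofinite.2 (finite_integersVolume_ne_one (F := F)))
  let S₁ := (Filter.eventually_cofinite.1 hR').toFinset
  have hS₁ : ∀ v ∉ S₁, R v = 1 ∧ integersVolume v = 1 := fun v hv => by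
    by_contra h
    exact hv ((Set.Finite.mem_toFinset _).2 h)
  obtain ⟨B, hB, hB'⟩ := exists_prod_eulerFactor_le F (show 1 < σ - 1 by linarith)
  have hval : ∀ v : HeightOneSpectrum (𝓞 F), Measurable fun t : (v.adicCompletion F)ˣ =>
    (t : v.adicCompletion F) := fun v => Units.continuous_val.measurable
  have hval' : ∀ v : InfinitePlace F, Measurable fun t : v.Completionˣ =>
    (t : v.Completion) := fun v => Units.continuous_val.measurable
  let f : ∀ v : InfinitePlace F, v.Completion × v.Completionˣ → ℝ≥0∞ := fun v p =>
    ENNReal.ofReal (‖(p.2 : v.Completion)‖ ^ σ) *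
      (ENNReal.ofReal ((1 + ‖(p.2 * p.1 : v.Completion)‖) ^ (-(M : ℝ))) *
        ENNReal.ofReal ((1 + ‖(p.2 : v.Completion)‖) ^ (-(M : ℝ))))
  let k : ∀ v : HeightOneSpectrum (𝓞 F), v.adicCompletion F × (v.adicCompletion F)ˣ → ℝ≥0∞ :=
    fun v p => ENNReal.ofReal (‖(p.2 : v.adicCompletion F)‖ ^ σ) *
      (Set.indicator {x : v.adicCompletion F | ‖x‖ ≤ R v} 1 (p.2 * p.1 : v.adicCompletion F) *
        Set.indicator {x : v.adicCompletion F | ‖x‖ ≤ R v} 1 (p.2 : v.adicCompletion F))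
  have hf : ∀ v, ∫⁻ p, f v p ∂((infMeasure v).prod (infMulMeasure v)) =
      (∫⁻ x, ENNReal.ofReal ((1 + ‖x‖) ^ (-(M : ℝ))) ∂(infMeasure v)) *
        ∫⁻ t : v.Completionˣ, ENNReal.ofReal (‖(t : v.Completion)‖ ^ (σ - 1)) *
          ENNReal.ofReal ((1 + ‖(t : v.Completion)‖) ^ (-(M : ℝ))) ∂(infMulMeasure v) := fun v =>
    lintegral_prod_units_mul (infMeasure v) (infMulMeasure v) (distribHaarChar_completion v)
      (m := fun x => ENNReal.ofReal ((1 + ‖x‖) ^ (-(M : ℝ)))) (by fun_prop) σ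
  have hk : ∀ v, ∫⁻ p, k v p ∂((finMeasure v).prod (finMulMeasure v)) =
      (∫⁻ x, Set.indicator {x : v.adicCompletion F | ‖x‖ ≤ R v} 1 x ∂(finMeasure v)) *
        ∫⁻ t : (v.adicCompletion F)ˣ, ENNReal.ofReal (‖(t : v.adicCompletion F)‖ ^ (σ - 1)) *
          Set.indicator {x : v.adicCompletion F | ‖x‖ ≤ R v} 1 (t : v.adicCompletion F)
            ∂(finMulMeasure v) := fun v =>
    lintegral_prod_units_mul (finMeasure v) (finMulMeasure v) (distribHaarChar_adicCompletion v)
      (measurable_indicator_norm_le v (R v)) σ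
  refine (((isRestrictedProductMeasure_adele F).prod
    (isRestrictedProductMeasure_idele F)).lintegral_lt_top (S₁ := S₁) (f := f) (k := k)
    (fun v => ?_) (fun v => ?_) (fun S hS p hp => ?_) (fun v => ?_)
    (M := (∏ v ∈ S₁, ∫⁻ p, k v p ∂((finMeasure v).prod (finMulMeasure v))) * B) ?_
    fun S hS => ?_).ne
  · have := hval' v
    have h2 : Measurable fun p : v.Completion × v.Completionˣ => (p.2 : v.Completion) :=
      this.comp measurable_snd
    simp only [f]
    fun_prop
  · have h2 : Measurable fun p : v.adicCompletion F × (v.adicCompletion F)ˣ =>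
        (p.2 : v.adicCompletion F) := (hval v).comp measurable_snd
    exact (h2.norm.pow_const σ).ennreal_ofReal.mul
      (((measurable_indicator_norm_le v (R v)).comp (h2.mul measurable_fst)).mul
        ((measurable_indicator_norm_le v (R v)).comp h2))
  · have h1 : ∀ v ∉ S, ‖finEval v (p.2 : Adele F)‖ = 1 := fun v hv => (hp v hv).2
    have h2 : ∀ v ∉ S, ‖finEval v p.1‖ ≤ 1 := fun v hv => (hp v hv).1
    have hRS : ∀ v ∉ S, R v = 1 := fun v hv => (hS₁ v fun h => hv (hS h)).1
    rw [adeleNorm_rpow_eq_prod h1, adeleMajorant_eq_prod hRS fun v hv => (h1 v hv).le,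
      adeleMajorant_eq_prod hRS fun v hv => by rw [map_mul, norm_mul, h1 v hv, one_mul]; exact h2 v hv]
    simp only [f, k, Finset.prod_mul_distrib, val_infUnit, val_finUnit, map_mul]
    ring
  · rw [hf]
    exact ENNReal.mul_ne_top (lintegral_infMeasure_ne_top v (by linarith))
      (lintegral_infMulMeasure_ne_top v (by linarith) (by linarith))
  · refine ENNReal.mul_ne_top (ENNReal.prod_ne_top fun v _ => ?_) hB
    rw [hk]
    exact ENNReal.mul_ne_top (lintegral_finMeasure_ne_top v (R v))
      (lintegral_finMulMeasure_ne_top v (R v) (by linarith))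
  · refine prod_le_prod_mul_of_eq_one_mul hS (fun v hv => ?_) hB'
    rw [hk, (hS₁ v hv).1, lintegral_units_indicator v (by linarith),
      lintegral_indicator_one (isClosed_le continuous_norm continuous_const).measurableSet,
      (isAddHaarMeasure_finMeasure_and v).2, (hS₁ v hv).2, one_mul, one_mul]

theorem IsRapidlyDecreasing.integrable_whittakerIntegrand {φ : (Fin 2 → Adele F) → ℂ}
    (hφ : IsRapidlyDecreasing φ) (ω : (Adele F)ˣ →ₜ* Circle) {s : ℂ} (hs : 1 < s.re)
    {ψ : Adele F → ℂ} (hψ : Continuous ψ) (hψ1 : ∀ x, ‖ψ x‖ = 1) (g : GL (Fin 2) (Adele F)) :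
    Integrable (whittakerIntegrand adeleNorm ψ (fun t => (ω t : ℂ)) s φ g)
      ((adeleMeasure F).prod (ideleMeasure F)) := by
  obtain ⟨R, hR, hR'⟩ := (hφ.act g).exists_majorant
  obtain ⟨M, hM⟩ := exists_nat_gt (2 * s.re)
  obtain ⟨C, hC, hC'⟩ := hR' M
  exact EisensteinWhittaker.integrable_whittakerIntegrand
    (continuous_whittakerIntegrand continuous_adeleNorm adeleNorm_pos hψ
      (continuous_induced_dom.comp (map_continuous ω)) hφ.continuous).aestronglyMeasurable
    adeleNorm_pos (fun x => (hψ1 x).le) (fun t => (Circle.norm_coe _).le) hC hC'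
    (lintegral_prod_majorant_ne_top (by linarith) hM hR)

theorem IsRapidlyDecreasing.integrable_idele {Φ : (Fin 2 → Adele F) → ℂ}
    (hΦ : IsRapidlyDecreasing Φ) (ω : (Adele F)ˣ →ₜ* Circle) {s : ℂ} (hs : 1 < s.re) :
    Integrable (fun t : (Adele F)ˣ => (ω t : ℂ) * ((adeleNorm (t : Adele F) : ℝ) : ℂ) ^ (2 * s) *
      Φ ((t : Adele F) • ![1, 0])) (ideleMeasure F) := by
  obtain ⟨R, hR, hR'⟩ := hΦ.exists_majorant
  obtain ⟨M, hM⟩ := exists_nat_gt (2 * s.re)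
  obtain ⟨C, hC, hC'⟩ := hR' M
  refine ⟨Continuous.aestronglyMeasurable ?_, ?_⟩
  · refine .mul (.mul (continuous_induced_dom.comp (map_continuous ω)) ?_) (hΦ.continuous.comp ?_)
    · exact Continuous.cpow (Complex.continuous_ofReal.comp continuous_adeleNorm)
        continuous_const fun t => Or.inl (adeleNorm_pos t)
    · exact Units.continuous_val.smul continuous_const
  · have h0 : C * adeleMajorant M R 0 ≠ ⊤ := by
      refine ENNReal.mul_ne_top hC (ENNReal.mul_ne_top
        (ENNReal.prod_ne_top fun v _ => ENNReal.ofReal_ne_top) ?_)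
      split_ifs <;> simp
    refine lt_of_le_of_lt (b := ∫⁻ t : (Adele F)ˣ, C * adeleMajorant M R 0 *
      (ENNReal.ofReal (adeleNorm (t : Adele F) ^ (2 * s.re)) * adeleMajorant M R (t : Adele F))
        ∂(ideleMeasure F)) (lintegral_mono fun t => ?_) ?_
    · have h1 : ‖((adeleNorm (t : Adele F) : ℝ) : ℂ) ^ (2 * s)‖ₑ =
          ENNReal.ofReal (adeleNorm (t : Adele F) ^ (2 * s.re)) := by
        rw [← ofReal_norm, Complex.norm_cpow_eq_rpow_re_of_pos (adeleNorm_pos t)]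
        simp
      have h2 : ‖(ω t : ℂ)‖ₑ = 1 := by rw [← ofReal_norm, Circle.norm_coe, ENNReal.ofReal_one]
      rw [enorm_mul, enorm_mul, h1, h2, one_mul, mul_left_comm]
      refine mul_le_mul_right ((hC' _).trans_eq ?_) _
      simp [mul_comm, mul_left_comm]
    · rw [lintegral_const_mul' _ _ h0]
      exact (ENNReal.mul_ne_top h0
        (lintegral_idele_majorant_ne_top (by linarith) hM hR)).lt_top

end GlobalIntegrability


section NonzeroVectors

/-- Every nonzero vector of `K²` is a unique multiple of `(1, 0)` or of some `(-z, 1)`. -/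
def lineVector {K : Type*} [Field K] (p : Option K × Kˣ) : {v : Fin 2 → K // v ≠ 0} :=
  match p with
  | (none, y) => ⟨![y, 0], fun h => y.ne_zero (congrFun h 0)⟩
  | (some z, y) => ⟨![-(y * z), y], fun h => y.ne_zero (congrFun h 1)⟩

theorem bijective_lineVector {K : Type*} [Field K] : Function.Bijective (lineVector (K := K)) := by
  constructor
  · rintro ⟨_ | z, y⟩ ⟨_ | z', y'⟩ h
    · have h0 : (y : K) = y' := congrFun (congrArg Subtype.val h) 0
      rw [Units.ext h0]
    · have h1 : (0 : K) = y' := congrFun (congrArg Subtype.val h) 1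
      exact absurd h1.symm y'.ne_zero
    · have h1 : (y : K) = 0 := congrFun (congrArg Subtype.val h) 1
      exact absurd h1 y.ne_zero
    · have h1 : (y : K) = y' := congrFun (congrArg Subtype.val h) 1
      have h0 : -(y * z : K) = -(y' * z') := congrFun (congrArg Subtype.val h) 0
      have h2 := Units.ext h1
      subst h2
      rw [mul_left_cancel₀ y.ne_zero (neg_injective h0)]
  · rintro ⟨v, hv⟩
    by_cases h1 : v 1 = 0
    · have h0 : v 0 ≠ 0 := fun h0 => hv (by ext i; fin_cases i <;> simp [h0, h1])
      refine ⟨(none, Units.mk0 _ h0), Subtype.ext ?_⟩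
      ext i
      fin_cases i <;> simp [lineVector, h1]
    · refine ⟨(some (-(v 0 / v 1)), Units.mk0 _ h1), Subtype.ext ?_⟩
      ext i
      fin_cases i
      · simp [lineVector]
        field_simp
      · simp [lineVector]

end NonzeroVectors

section Theta

variable {F : Type*} [Field F] [NumberField F]

theorem injective_algebraMap_adele : Function.Injective (algebraMap F (Adele F)) := by
  intro x y h
  obtain ⟨w⟩ : Nonempty (InfinitePlace F) := inferInstance
  have h1 := norm_infEval_algebraMap w (x - y)
  rw [map_sub, h, sub_self, map_zero, norm_zero] at h1
  exact sub_eq_zero.1 ((map_eq_zero w).1 h1.symm)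

/-- The principal adeles, as a copy of `F`. -/
noncomputable def principalAdelesEquiv : F ≃ AdeleRing.principalSubgroup (𝓞 F) F :=
  Equiv.ofBijective (fun x => ⟨algebraMap F (Adele F) x, ⟨x, rfl⟩⟩)
    ⟨fun _ _ h => injective_algebraMap_adele (congrArg Subtype.val h),
      fun ⟨_, x, hx⟩ => ⟨x, Subtype.ext hx⟩⟩

/-- The principal ideles, as a copy of `Fˣ`. -/
noncomputable def principalIdelesEquiv : Fˣ ≃ principalIdeles F :=
  Equiv.ofBijective (fun x => ⟨Units.map (algebraMap F (Adele F)).toMonoidHom x, ⟨x, rfl⟩⟩)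
    ⟨fun _ _ h => Units.ext (injective_algebraMap_adele
      (congrArg (fun t : principalIdeles F => ((t : (Adele F)ˣ) : Adele F)) h)),
      fun ⟨_, x, hx⟩ => ⟨x, Subtype.ext hx⟩⟩

theorem coe_principalIdelesEquiv (x : Fˣ) :
    (((principalIdelesEquiv x : principalIdeles F) : (Adele F)ˣ) : Adele F) =
      algebraMap F (Adele F) x := rfl

/-- The function `t ↦ ω(t) |t|^{2s} Φ(t x)`. -/
noncomputable def ideleTerm (ω : (Adele F)ˣ →ₜ* Circle) (s : ℂ) (Φ : (Fin 2 → Adele F) → ℂ)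
    (x : Fin 2 → Adele F) (t : (Adele F)ˣ) : ℂ :=
  (ω t : ℂ) * ((adeleNorm (t : Adele F) : ℝ) : ℂ) ^ (2 * s) * Φ ((t : Adele F) • x)

theorem ideleTerm_mul {ω : (Adele F)ˣ →ₜ* Circle} (hω : ∀ t ∈ principalIdeles F, ω t = 1) (s : ℂ)
    (Φ : (Fin 2 → Adele F) → ℂ) (x : Fin 2 → Adele F) (γ : Fˣ) (t : (Adele F)ˣ) :
    ideleTerm ω s Φ x (principalIdelesEquiv γ • t) =
      (ω t : ℂ) * ((adeleNorm (t : Adele F) : ℝ) : ℂ) ^ (2 * s) *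
        Φ ((t : Adele F) • algebraMap F (Adele F) γ • x) := by
  have h1 : principalIdelesEquiv γ • t = (principalIdelesEquiv γ : (Adele F)ˣ) * t := rfl
  rw [ideleTerm, h1, map_mul, hω _ (principalIdelesEquiv γ).2, one_mul, Units.val_mul,
    adeleNorm_mul, coe_principalIdelesEquiv, adeleNorm_algebraMap γ.ne_zero, one_mul,
    mul_smul, smul_comm]

/-- The representatives of the lines of `F²`, translated by `u`. -/
noncomputable def lineRep (u : Adele F) : Option (AdeleRing.principalSubgroup (𝓞 F) F) → Fin 2 → Adele F
  | none => ![1, 0]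
  | some c => ![-(c +ᵥ u), 1]

theorem act_scalar_mul (φ : (Fin 2 → Adele F) → ℂ) (g : GL (Fin 2) (Adele F)) (t : (Adele F)ˣ)
    (u : Adele F) (x : Fin 2 → Adele F) :
    act (GeneralLinearGroup.scalar (Fin 2) t⁻¹ * (GeneralLinearGroup.upperRightHom u * g)) φ x =
      act g φ ((t : Adele F) • ![x 0 - u * x 1, x 1]) := by
  have h1 : (((GeneralLinearGroup.scalar (Fin 2) t⁻¹ *
      (GeneralLinearGroup.upperRightHom u * g))⁻¹ : GL (Fin 2) (Adele F)) :
        Matrix (Fin 2) (Fin 2) (Adele F)) *ᵥ x =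
      ((g⁻¹ : GL (Fin 2) (Adele F)) : Matrix (Fin 2) (Fin 2) (Adele F)) *ᵥ
        ((t : Adele F) • ![x 0 - u * x 1, x 1]) := by
    rw [_root_.mul_inv_rev, _root_.mul_inv_rev,
      ← map_inv (GeneralLinearGroup.scalar (Fin 2)) t⁻¹, inv_inv, Units.val_mul, Units.val_mul,
      ← mulVec_mulVec, ← mulVec_mulVec]
    congr 1
    have h2 : ((GeneralLinearGroup.scalar (Fin 2) t : GL (Fin 2) (Adele F)) :
        Matrix (Fin 2) (Fin 2) (Adele F)) *ᵥ x = (t : Adele F) • x := by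
      ext i
      simp [GeneralLinearGroup.scalar]
    have h3 : (((GeneralLinearGroup.upperRightHom u)⁻¹ : GL (Fin 2) (Adele F)) :
        Matrix (Fin 2) (Fin 2) (Adele F)) = !![1, -u; 0, 1] := rfl
    rw [h2, h3]
    ext i
    fin_cases i
    · simp [mulVec, dotProduct]
      ring
    · simp [mulVec, dotProduct]
  rw [act_apply, act_apply, h1]

theorem mul_theta_eq_tsum {ω : (Adele F)ˣ →ₜ* Circle} (hω : ∀ t ∈ principalIdeles F, ω t = 1)
    (s : ℂ) (φ : (Fin 2 → Adele F) → ℂ) (g : GL (Fin 2) (Adele F)) (u : Adele F)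
    (t : (Adele F)ˣ) :
    (ω t : ℂ) * ((adeleNorm (t : Adele F) : ℝ) : ℂ) ^ (2 * s) *
        theta φ (GeneralLinearGroup.scalar (Fin 2) t⁻¹ *
          (GeneralLinearGroup.upperRightHom u * g)) =
      ∑' p : Option (AdeleRing.principalSubgroup (𝓞 F) F) × principalIdeles F,
        ideleTerm ω s (act g φ) (lineRep u p.1) (p.2 • t) := by
  rw [theta, ← tsum_mul_left, ← (Equiv.ofBijective _ (bijective_lineVector (K := F))).tsum_eq,
    ← ((Equiv.optionCongr (principalAdelesEquiv (F := F))).prodCongr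
      (principalIdelesEquiv (F := F))).tsum_eq]
  refine tsum_congr fun p => ?_
  rw [act_scalar_mul]
  simp only [Equiv.prodCongr_apply, Prod.map_fst, Prod.map_snd]
  rw [ideleTerm_mul hω]
  congr 3
  obtain ⟨_ | z, y⟩ := p
  · ext i
    fin_cases i <;> simp [lineVector, lineRep]
  · have h : (principalAdelesEquiv z +ᵥ u : Adele F) = algebraMap F (Adele F) z + u := rfl
    ext i
    fin_cases i
    · simp [lineVector, lineRep, h]
      ring
    · simp [lineVector, lineRep]

end Theta


open scoped ENNReal Pointwise

section Sums

theorem hasSum_option {α M : Type*} [AddCommMonoid M] [TopologicalSpace M] [ContinuousAdd M]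
    {f : Option α → M} {a : M} (h : HasSum (fun x => f (some x)) a) : HasSum f (f none + a) := by
  have h1 : HasSum (fun o : Option α => o.elim (f none) fun _ => 0) (f none) :=
    hasSum_single none fun o ho => by
      cases o with
      | none => exact absurd rfl ho
      | some x => rfl
  have h2 : HasSum (fun o : Option α => o.elim 0 fun x => f (some x)) a := by
    rw [← (Option.some_injective α).hasSum_iff]
    · exact h
    · intro o ho
      cases o with
      | none => rfl
      | some x => exact absurd ⟨x, rfl⟩ ho
  convert h1.add h2 using 1
  funext o
  cases o <;> simp

theorem ae_restrict_tsum_ne_top {G α : Type*} [AddGroup G] [Countable G] [AddAction G α]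
    [MeasurableSpace α] [MeasurableConstVAdd G α] {μ : Measure α} [VAddInvariantMeasure G α μ]
    {D : Set α} (hD : IsAddFundamentalDomain G D μ) {N : α → ℝ≥0∞} (hN : Measurable N)
    (hN' : ∫⁻ x, N x ∂μ ≠ ⊤) : ∀ᵐ x ∂(μ.restrict D), ∑' c : G, N (c +ᵥ x) ≠ ⊤ := by
  have hm : ∀ c : G, Measurable fun x => N (c +ᵥ x) := fun c =>
    hN.comp (measurable_const_vadd c)
  have h : ∫⁻ x in D, ∑' c : G, N (c +ᵥ x) ∂μ ≠ ⊤ := by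
    rw [lintegral_tsum fun c => (hm c).aemeasurable, ← hD.lintegral_eq_tsum'']
    exact hN'
  filter_upwards [ae_lt_top (Measurable.tsum hm) h] with x hx using hx.ne

end Sums

section Unfolding

variable {F : Type*} [Field F] [NumberField F]

variable (F) in
theorem exists_quotientIntegral_eq : ∃ D : Set (Adele F)ˣ,
    IsFundamentalDomain (principalIdeles F) D (ideleMeasure F) ∧
      ∀ f, quotientIntegral (principalIdeles F) (ideleMeasure F) f =
        ∫ t in D, f t ∂(ideleMeasure F) := by
  classical
  have h := exists_isFundamentalDomain_idele F (ideleMeasure F)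
  exact ⟨h.choose, h.choose_spec, fun f => dif_pos h⟩

variable (F) in
theorem exists_addQuotientIntegral_eq : ∃ D : Set (Adele F),
    IsAddFundamentalDomain (AdeleRing.principalSubgroup (𝓞 F) F) D (adeleMeasure F) ∧
      ∀ f, addQuotientIntegral (AdeleRing.principalSubgroup (𝓞 F) F) (adeleMeasure F) f =
        ∫ t in D, f t ∂(adeleMeasure F) := by
  classical
  have h := exists_isAddFundamentalDomain_adele F (adeleMeasure F)
  exact ⟨h.choose, h.choose_spec, fun f => dif_pos h⟩

theorem eisenstein_upperRightHom_mul {ω : (Adele F)ˣ →ₜ* Circle}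
    (hω : ∀ t ∈ principalIdeles F, ω t = 1) (s : ℂ) (φ : (Fin 2 → Adele F) → ℂ)
    (g : GL (Fin 2) (Adele F)) (u : Adele F)
    (h0 : Integrable (ideleTerm ω s (act g φ) ![1, 0]) (ideleMeasure F))
    (h1 : ∀ c : AdeleRing.principalSubgroup (𝓞 F) F,
      Integrable (ideleTerm ω s (act g φ) ![-(c +ᵥ u), 1]) (ideleMeasure F))
    (h2 : ∑' c : AdeleRing.principalSubgroup (𝓞 F) F,
      ∫⁻ t, ‖ideleTerm ω s (act g φ) ![-(c +ᵥ u), 1] t‖ₑ ∂(ideleMeasure F) ≠ ⊤) :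
    eisenstein ω s φ (GeneralLinearGroup.upperRightHom u * g) =
      ((adeleNorm (g : Matrix (Fin 2) (Fin 2) (Adele F)).det : ℝ) : ℂ) ^ (-s) *
        (∫ t, ideleTerm ω s (act g φ) ![1, 0] t ∂(ideleMeasure F) +
          ∑' c : AdeleRing.principalSubgroup (𝓞 F) F,
            ∫ t, ideleTerm ω s (act g φ) ![-(c +ᵥ u), 1] t ∂(ideleMeasure F)) := by
  obtain ⟨D, hD, hDint⟩ := exists_quotientIntegral_eq F
  have hdet : ((GeneralLinearGroup.upperRightHom u * g : GL (Fin 2) (Adele F)) :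
      Matrix (Fin 2) (Fin 2) (Adele F)).det = (g : Matrix (Fin 2) (Fin 2) (Adele F)).det := by
    have h3 : ((GeneralLinearGroup.upperRightHom u : GL (Fin 2) (Adele F)) :
        Matrix (Fin 2) (Fin 2) (Adele F)) = !![1, u; 0, 1] := rfl
    rw [Units.val_mul, det_mul, h3, det_fin_two_of]
    simp
  rw [eisenstein, hdet, hDint]
  congr 1
  simp_rw [mul_theta_eq_tsum hω]
  have hk : ∀ j, Integrable (ideleTerm ω s (act g φ) (lineRep u j)) (ideleMeasure F) := by
    rintro (_ | c)
    · exact h0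
    · exact h1 c
  have hs : ∑' j, ∫⁻ t, ‖ideleTerm ω s (act g φ) (lineRep u j) t‖ₑ ∂(ideleMeasure F) ≠ ⊤ := by
    rw [(hasSum_option (f := fun j => ∫⁻ t, ‖ideleTerm ω s (act g φ) (lineRep u j) t‖ₑ
      ∂(ideleMeasure F)) ENNReal.summable.hasSum).tsum_eq]
    exact ENNReal.add_ne_top.2 ⟨h0.2.ne, h2⟩
  rw [(integral_tsum_smul_fundamentalDomain hD hk hs).2]
  refine (hasSum_option (f := fun j => ∫ t, ideleTerm ω s (act g φ) (lineRep u j) t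
    ∂(ideleMeasure F)) (Summable.hasSum ?_)).tsum_eq
  refine Summable.of_enorm (ne_top_of_le_ne_top h2 (ENNReal.tsum_le_tsum fun c => ?_))
  exact enorm_integral_le_lintegral_enorm _

variable [IsTotallyReal F]

theorem adeleChar_principal (x : F) (c : AdeleRing.principalSubgroup (𝓞 F) F) (u : Adele F) :
    adeleChar (algebraMap F (Adele F) x * (c +ᵥ u)) = adeleChar (algebraMap F (Adele F) x * u) := by
  obtain ⟨_, y, rfl⟩ := c
  have h : ((⟨algebraMap F (Adele F) y, ⟨y, rfl⟩⟩ : AdeleRing.principalSubgroup (𝓞 F) F) +ᵥ u :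
    Adele F) = algebraMap F (Adele F) y + u := rfl
  change adeleChar (_ * ((⟨algebraMap F (Adele F) y, ⟨y, rfl⟩⟩ :
    AdeleRing.principalSubgroup (𝓞 F) F) +ᵥ u)) = _
  rw [h, mul_add, adeleChar_add, ← map_mul, adeleChar_algebraMap, one_mul]

theorem integral_adeleChar_eq_zero {ξ : F} (hξ : ξ ≠ 0) {D : Set (Adele F)}
    (hD : IsAddFundamentalDomain (AdeleRing.principalSubgroup (𝓞 F) F) D (adeleMeasure F)) :
    ∫ u in D, adeleChar (algebraMap F (Adele F) ξ * u) ∂(adeleMeasure F) = 0 := by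
  obtain ⟨c, hc⟩ := exists_adeleChar_mul_ne_one hξ
  have h1 := hD.setIntegral_eq (hD.vadd_of_comm c)
    (f := fun u => adeleChar (algebraMap F (Adele F) ξ * u)) fun γ u => adeleChar_principal ξ γ u
  have h2 : ∫ u in c +ᵥ D, adeleChar (algebraMap F (Adele F) ξ * u) ∂(adeleMeasure F) =
      adeleChar (algebraMap F (Adele F) ξ * c) *
        ∫ u in D, adeleChar (algebraMap F (Adele F) ξ * u) ∂(adeleMeasure F) := by
    rw [← integral_const_mul]
    have := (measurePreserving_vadd c (adeleMeasure F)).setIntegral_image_emb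
      (measurableEmbedding_const_vadd c)
      (fun u => adeleChar (algebraMap F (Adele F) ξ * u)) D
    rw [Set.image_vadd] at this
    rw [this]
    refine integral_congr_ae (Filter.Eventually.of_forall fun u => ?_)
    dsimp only
    rw [vadd_eq_add, mul_add, adeleChar_add]
  rw [h2] at h1
  have h3 : (1 - adeleChar (algebraMap F (Adele F) ξ * c)) *
      ∫ u in D, adeleChar (algebraMap F (Adele F) ξ * u) ∂(adeleMeasure F) = 0 := by
    rw [sub_mul, one_mul, ← h1, sub_self]
  exact (mul_eq_zero.1 h3).resolve_left (sub_ne_zero.2 hc.symm)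

theorem fourierCoeff_eq_integral {ω : (Adele F)ˣ →ₜ* Circle}
    (hω : ∀ t ∈ principalIdeles F, ω t = 1) {s : ℂ} (hs : 1 < s.re) {φ : (Fin 2 → Adele F) → ℂ}
    (hφ : IsRapidlyDecreasing φ) {ξ : F} (hξ : ξ ≠ 0) (g : GL (Fin 2) (Adele F)) :
    fourierCoeff ω s φ ξ g =
      whittakerIntegral adeleNorm (fun u => adeleChar (algebraMap F (Adele F) ξ * u))
        (fun t => (ω t : ℂ)) (adeleMeasure F) (ideleMeasure F) s φ g := by
  obtain ⟨D, hD, hDint⟩ := exists_addQuotientIntegral_eq F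
  have hDtop : IsFiniteMeasure ((adeleMeasure F).restrict D) :=
    ⟨by simpa using measure_adele_fundamentalDomain_lt_top F hD⟩
  rw [fourierCoeff, hDint, whittakerIntegral]
  set d := ((adeleNorm (g : Matrix (Fin 2) (Fin 2) (Adele F)).det : ℝ) : ℂ) ^ (-s) with hd
  set Ψ : Adele F → ℂ := fun u => adeleChar (algebraMap F (Adele F) ξ * u) with hΨ
  have hΨc : Continuous Ψ := continuous_adeleChar.comp (continuous_const_mul _)
  have hneg : MeasurePreserving (fun p : Adele F × (Adele F)ˣ => (-p.1, p.2))
      ((adeleMeasure F).prod (ideleMeasure F)) ((adeleMeasure F).prod (ideleMeasure F)) :=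
    (Measure.measurePreserving_neg _).prod (MeasurePreserving.id _)
  have hnege : MeasurableEmbedding fun p : Adele F × (Adele F)ˣ => (-p.1, p.2) :=
    ((Homeomorph.neg (Adele F)).prodCongr (Homeomorph.refl (Adele F)ˣ)).measurableEmbedding
  let f : Adele F → (Adele F)ˣ → ℂ := fun u t => ideleTerm ω s (act g φ) ![-u, 1] t
  have hW := hφ.integrable_whittakerIntegrand ω hs hΨc (fun x => norm_adeleChar _) g
  have hfΨ : Integrable (fun p : Adele F × (Adele F)ˣ => f p.1 p.2 * Ψ (-p.1))
      ((adeleMeasure F).prod (ideleMeasure F)) :=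
    (hneg.integrable_comp_emb hnege).2 hW
  have hf : Continuous (Function.uncurry f) := by
    have h := continuous_whittakerIntegrand (s := s) (g := g) continuous_adeleNorm adeleNorm_pos
      (continuous_const (y := (1 : ℂ)) (X := Adele F))
      (continuous_induced_dom.comp (map_continuous ω)) hφ.continuous
    have h' := h.comp ((continuous_neg.comp continuous_fst).prodMk continuous_snd :
      Continuous fun p : Adele F × (Adele F)ˣ => (-p.1, p.2))
    refine h'.congr fun p => ?_
    exact mul_one _
  let N : Adele F → ℝ≥0∞ := fun u => ∫⁻ t, ‖f u t‖ₑ ∂(ideleMeasure F)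
  have hN : Measurable N :=
    Measurable.lintegral_prod_right (f := fun u t => ‖f u t‖ₑ) hf.enorm.measurable
  have hNtop : ∫⁻ u, N u ∂(adeleMeasure F) ≠ ⊤ := by
    have h := hfΨ.2.ne
    rw [lintegral_prod _ hfΨ.1.enorm] at h
    convert h using 4 with u
    funext t
    dsimp only
    rw [enorm_mul, ← ofReal_norm (Ψ _), norm_adeleChar, ENNReal.ofReal_one, mul_one]
  let K : Adele F → ℂ := fun u => (∫ t, f u t ∂(ideleMeasure F)) * Ψ (-u)
  have hK : Integrable K (adeleMeasure F) := by
    have h := hfΨ.integral_prod_left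
    simpa only [integral_mul_const] using h
  have hKs : ∑' _ : Unit, ∫⁻ u, ‖K u‖ₑ ∂(adeleMeasure F) ≠ ⊤ := by
    rw [tsum_fintype, Fintype.sum_unique]
    exact hK.2.ne
  have h0 : Integrable (ideleTerm ω s (act g φ) ![1, 0]) (ideleMeasure F) :=
    (hφ.act g).integrable_idele ω hs
  have hae : ∀ᵐ u ∂((adeleMeasure F).restrict D),
      eisenstein ω s φ (GeneralLinearGroup.upperRightHom u * g) *
        adeleChar (-(algebraMap F (Adele F) ξ * u)) =
      d * ((∫ t, ideleTerm ω s (act g φ) ![1, 0] t ∂(ideleMeasure F)) *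
        adeleChar (algebraMap F (Adele F) (-ξ) * u) +
        ∑' p : Unit × AdeleRing.principalSubgroup (𝓞 F) F, K (p.2 +ᵥ u)) := by
    filter_upwards [ae_restrict_tsum_ne_top hD hN hNtop] with u hu
    have h1 : ∀ c : AdeleRing.principalSubgroup (𝓞 F) F,
        Integrable (ideleTerm ω s (act g φ) ![-(c +ᵥ u), 1]) (ideleMeasure F) := fun c =>
      ⟨(hf.comp (Continuous.prodMk_right (c +ᵥ u))).aestronglyMeasurable,
        lt_of_le_of_lt (ENNReal.le_tsum c) hu.lt_top⟩
    rw [eisenstein_upperRightHom_mul hω s φ g u h0 h1 hu, mul_assoc, add_mul]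
    have hneg' : adeleChar (-(algebraMap F (Adele F) ξ * u)) =
        adeleChar (algebraMap F (Adele F) (-ξ) * u) := by rw [map_neg, neg_mul]
    rw [hneg']
    congr 2
    rw [← (Equiv.punitProd (AdeleRing.principalSubgroup (𝓞 F) F)).symm.tsum_eq, ← tsum_mul_right]
    refine tsum_congr fun c => ?_
    change _ = (∫ t, f (c +ᵥ u) t ∂(ideleMeasure F)) * Ψ (-(c +ᵥ u))
    have h3 : Ψ (-(c +ᵥ u)) = adeleChar (algebraMap F (Adele F) (-ξ) * (c +ᵥ u)) := by
      simp only [hΨ, map_neg, mul_neg, neg_mul]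
    rw [h3, adeleChar_principal]
  have hcn : Continuous fun u : Adele F => adeleChar (algebraMap F (Adele F) (-ξ) * u) :=
    continuous_adeleChar.comp (continuous_const_mul _)
  have hΨint : Integrable (fun u : Adele F => adeleChar (algebraMap F (Adele F) (-ξ) * u))
      ((adeleMeasure F).restrict D) :=
    Integrable.of_bound hcn.aestronglyMeasurable 1
      (Filter.Eventually.of_forall fun u => (norm_adeleChar _).le)
  obtain ⟨hU1, hU2⟩ := integral_tsum_vadd_fundamentalDomain hD (k := fun _ : Unit => K)
    (fun _ => hK) hKs
  rw [integral_congr_ae hae, integral_const_mul, integral_add (hΨint.const_mul _) hU1,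
    integral_const_mul, integral_adeleChar_eq_zero (neg_ne_zero.2 hξ) hD, mul_zero, zero_add, hU2,
    tsum_fintype, Fintype.sum_unique]
  congr 1
  refine Eq.trans ?_ ((integral_prod _ hfΨ).symm.trans (hneg.integral_comp hnege
    (whittakerIntegrand adeleNorm Ψ (fun t => (ω t : ℂ)) s φ g)))
  refine integral_congr_ae (Filter.Eventually.of_forall fun u => ?_)
  exact (integral_mul_const _ _).symm

end Unfolding


open scoped ENNReal Pointwise

section PrincipalScaling

variable {F : Type*} [Field F] [NumberField F]

theorem distribHaarChar_principal (ξ : Fˣ) :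
    distribHaarChar (Adele F) (Units.map (algebraMap F (Adele F)).toMonoidHom ξ) = 1 := by
  obtain ⟨D, hD⟩ := exists_isAddFundamentalDomain_adele F (adeleMeasure F)
  set t : (Adele F)ˣ := Units.map (algebraMap F (Adele F)).toMonoidHom ξ with ht
  have hD0 : adeleMeasure F D ≠ 0 := hD.measure_ne_zero (NeZero.ne _)
  have hDt := measure_adele_fundamentalDomain_lt_top F hD
  refine distribHaarChar_eq_of_measure_smul_eq_mul (μ := adeleMeasure F) hD0 hDt.ne ?_
  rw [ENNReal.coe_one, one_mul]
  let e : AdeleRing.principalSubgroup (𝓞 F) F ≃ AdeleRing.principalSubgroup (𝓞 F) F :=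
    principalAdelesEquiv.symm.trans ((Units.mulLeft ξ⁻¹).trans principalAdelesEquiv)
  have hq : Measure.QuasiMeasurePreserving (MulAction.toPerm t).symm
      (adeleMeasure F) (adeleMeasure F) := by
    refine ⟨(Homeomorph.smul t⁻¹).continuous.measurable, ?_⟩
    have hH : ((adeleMeasure F).map (Homeomorph.smul t⁻¹)).IsAddHaarMeasure :=
      (DistribMulAction.toAddEquiv (Adele F) t⁻¹).isAddHaarMeasure_map _
        (Homeomorph.smul t⁻¹).continuous (Homeomorph.smul t⁻¹).symm.continuous
    have hac := Measure.absolutelyContinuous_isAddHaarMeasure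
      ((adeleMeasure F).map (Homeomorph.smul t⁻¹)) (adeleMeasure F)
    exact hac
  have hsD : IsAddFundamentalDomain (AdeleRing.principalSubgroup (𝓞 F) F) (t • D)
      (adeleMeasure F) := by
    refine hD.image_of_equiv (MulAction.toPerm t) hq e fun c x => ?_
    obtain ⟨y, rfl⟩ := principalAdelesEquiv.surjective c
    have h1 : e (principalAdelesEquiv y) = principalAdelesEquiv (ξ⁻¹ * y : F) := by
      simp [e]
    rw [h1]
    change (t : Adele F) * (algebraMap F (Adele F) (ξ⁻¹ * y : F) + x) =
      algebraMap F (Adele F) y + t * x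
    have h2 : (t : Adele F) = algebraMap F (Adele F) ξ := rfl
    rw [mul_add, h2, ← map_mul, ← mul_assoc, ξ.mul_inv, one_mul]
  exact hsD.measure_eq hD

theorem measurePreserving_principal_mul (ξ : Fˣ) :
    MeasurePreserving (fun u : Adele F => algebraMap F (Adele F) ξ * u) (adeleMeasure F)
      (adeleMeasure F) := by
  set t : (Adele F)ˣ := Units.map (algebraMap F (Adele F)).toMonoidHom ξ with ht
  refine ⟨measurable_const_mul _, ?_⟩
  refine Measure.ext fun s hs => ?_
  rw [Measure.map_apply (measurable_const_mul _) hs]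
  have h1 : (fun u : Adele F => algebraMap F (Adele F) ξ * u) ⁻¹' s = t⁻¹ • s := by
    rw [← Set.preimage_smul]; rfl
  rw [h1, ← distribHaarChar_mul (adeleMeasure F), map_inv, distribHaarChar_principal, inv_one,
    ENNReal.coe_one, one_mul]

end PrincipalScaling

section FourierCoefficients

variable {F : Type*} [Field F] [NumberField F]

theorem act_diagOne_mul {R : Type*} [CommRing R] (t : Rˣ) (g : GL (Fin 2) R)
    (φ : (Fin 2 → R) → ℂ) (a b : R) :
    act (diagOne t * g) φ ![a, b] = act g φ ![(t⁻¹ : Rˣ) * a, b] := by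
  rw [act_apply, act_apply, _root_.mul_inv_rev, Units.val_mul, ← mulVec_mulVec]
  congr 2
  have h : (((diagOne t)⁻¹ : GL (Fin 2) R) : Matrix (Fin 2) (Fin 2) R) =
    !![((t⁻¹ : Rˣ) : R), 0; 0, 1] := rfl
  rw [h]
  ext i
  fin_cases i <;> simp [mulVec, dotProduct]

variable [IsTotallyReal F]

theorem whittakerIntegral_diagOne_mul (ω : (Adele F)ˣ →ₜ* Circle) (s : ℂ)
    (φ : (Fin 2 → Adele F) → ℂ) (ξ : Fˣ) (g : GL (Fin 2) (Adele F)) :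
    whittakerIntegral adeleNorm adeleChar (fun t => (ω t : ℂ)) (adeleMeasure F) (ideleMeasure F) s φ
        (diagOne (Units.map (algebraMap F (Adele F)).toMonoidHom ξ) * g) =
      whittakerIntegral adeleNorm (fun u => adeleChar (algebraMap F (Adele F) ξ * u))
        (fun t => (ω t : ℂ)) (adeleMeasure F) (ideleMeasure F) s φ g := by
  set t : (Adele F)ˣ := Units.map (algebraMap F (Adele F)).toMonoidHom ξ with ht
  have htv : (t : Adele F) = algebraMap F (Adele F) ξ := rfl
  have hdet : adeleNorm ((diagOne t * g : GL (Fin 2) (Adele F)) :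
      Matrix (Fin 2) (Fin 2) (Adele F)).det =
      adeleNorm (g : Matrix (Fin 2) (Fin 2) (Adele F)).det := by
    have h1 : ((diagOne t : GL (Fin 2) (Adele F)) : Matrix (Fin 2) (Fin 2) (Adele F)).det = t := by
      have : ((diagOne t : GL (Fin 2) (Adele F)) : Matrix (Fin 2) (Fin 2) (Adele F)) =
        !![(t : Adele F), 0; 0, 1] := rfl
      rw [this, det_fin_two_of]
      simp
    have h2 := adeleNorm_mul t (GeneralLinearGroup.det g)
    rw [GeneralLinearGroup.val_det_apply] at h2
    rw [Units.val_mul, det_mul, h1, h2, htv, adeleNorm_algebraMap ξ.ne_zero, one_mul]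
  rw [whittakerIntegral, whittakerIntegral, hdet]
  congr 1
  have hmp : MeasurePreserving (fun p : Adele F × (Adele F)ˣ => (algebraMap F (Adele F) ξ * p.1, p.2))
      ((adeleMeasure F).prod (ideleMeasure F)) ((adeleMeasure F).prod (ideleMeasure F)) :=
    (measurePreserving_principal_mul ξ).prod (MeasurePreserving.id _)
  have hme : MeasurableEmbedding fun p : Adele F × (Adele F)ˣ =>
      (algebraMap F (Adele F) ξ * p.1, p.2) :=
    ((Homeomorph.smul t).prodCongr (Homeomorph.refl (Adele F)ˣ)).measurableEmbedding
  rw [← hmp.integral_comp hme]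
  refine integral_congr_ae (Filter.Eventually.of_forall fun p => ?_)
  unfold whittakerIntegrand
  have h3 : act (diagOne t * g) φ ((p.2 : Adele F) • ![algebraMap F (Adele F) ξ * p.1, 1]) =
      act g φ ((p.2 : Adele F) • ![p.1, 1]) := by
    have h4 : (p.2 : Adele F) • ![algebraMap F (Adele F) ξ * p.1, 1] =
        ![(p.2 : Adele F) * (algebraMap F (Adele F) ξ * p.1), p.2] := by simp
    have h5 : (p.2 : Adele F) • ![p.1, 1] = ![(p.2 : Adele F) * p.1, p.2] := by simp
    rw [h4, act_diagOne_mul, h5, ← htv, mul_left_comm (p.2 : Adele F), Units.inv_mul_cancel_left]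
  dsimp only
  rw [h3]

theorem fourierCoeff_one_eq_whittakerIntegral {ω : (Adele F)ˣ →ₜ* Circle}
    (hω : ∀ t ∈ principalIdeles F, ω t = 1) {s : ℂ} (hs : 1 < s.re) {φ : (Fin 2 → Adele F) → ℂ}
    (hφ : IsRapidlyDecreasing φ) (g : GL (Fin 2) (Adele F)) :
    fourierCoeff ω s φ 1 g =
      whittakerIntegral adeleNorm adeleChar (fun t => (ω t : ℂ)) (adeleMeasure F) (ideleMeasure F)
        s φ g := by
  rw [fourierCoeff_eq_integral hω hs hφ one_ne_zero]
  simp only [map_one, one_mul]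

theorem fourierCoeff_eq_fourierCoeff_one {ω : (Adele F)ˣ →ₜ* Circle}
    (hω : ∀ t ∈ principalIdeles F, ω t = 1) {s : ℂ} (hs : 1 < s.re) {φ : (Fin 2 → Adele F) → ℂ}
    (hφ : IsRapidlyDecreasing φ) (ξ : Fˣ) (g : GL (Fin 2) (Adele F)) :
    fourierCoeff ω s φ (ξ : F) g = fourierCoeff ω s φ 1
      (diagOne (Units.map (algebraMap F (Adele F)).toMonoidHom ξ) * g) := by
  rw [fourierCoeff_one_eq_whittakerIntegral hω hs hφ, whittakerIntegral_diagOne_mul,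
    fourierCoeff_eq_integral hω hs hφ ξ.ne_zero]

end FourierCoefficients


open scoped ENNReal NNReal

section LocalDecay

variable {K : Type*} [NormedField K]

theorem exists_norm_mulVec_le_norm (A : Matrix (Fin 2) (Fin 2) K) :
    ∃ B : ℝ, 0 ≤ B ∧ ∀ x, ‖A *ᵥ x‖ ≤ B * ‖x‖ := by
  refine ⟨∑ i, ∑ j, ‖A i j‖, by positivity, fun x => ?_⟩
  refine (pi_norm_le_iff_of_nonneg (by positivity)).2 fun i => ?_
  calc ‖(A *ᵥ x) i‖ ≤ ∑ j, ‖A i j‖ * ‖x‖ := by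
        refine (norm_sum_le Finset.univ fun j => A i j * x j).trans
          (Finset.sum_le_sum fun j _ => ?_)
        rw [norm_mul]
        exact mul_le_mul_of_nonneg_left (norm_le_pi_norm x j) (norm_nonneg _)
    _ = (∑ j, ‖A i j‖) * ‖x‖ := (Finset.sum_mul _ _ _).symm
    _ ≤ _ := mul_le_mul_of_nonneg_right (Finset.single_le_sum (f := fun i => ∑ j, ‖A i j‖)
          (fun v _ => by positivity) (Finset.mem_univ i)) (norm_nonneg _)

theorem exists_act_majorant {φ : (Fin 2 → K) → ℂ} {M : ℕ}
    (hφ : ∃ C : ℝ, ∀ x, (1 + ‖x‖) ^ (M + M) * ‖φ x‖ ≤ C) (g : GL (Fin 2) K) :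
    ∃ C : ℝ≥0∞, C ≠ ⊤ ∧ ∀ x, ‖act g φ x‖ₑ ≤ C *
      (ENNReal.ofReal ((1 + ‖x 0‖) ^ (-(M : ℝ))) * ENNReal.ofReal ((1 + ‖x 1‖) ^ (-(M : ℝ)))) := by
  obtain ⟨C, hC⟩ := hφ
  obtain ⟨B, hB, hB'⟩ := exists_norm_mulVec_le_norm (g : Matrix (Fin 2) (Fin 2) K)
  refine ⟨ENNReal.ofReal ((1 + B) ^ (M + M) * C), ENNReal.ofReal_ne_top, fun x => ?_⟩
  have hC0 : 0 ≤ C := (by positivity : (0 : ℝ) ≤ _).trans (hC 0)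
  rw [← ENNReal.ofReal_mul (by positivity), ← ENNReal.ofReal_mul (by positivity), ← ofReal_norm]
  refine ENNReal.ofReal_le_ofReal ?_
  rw [Real.rpow_neg (by positivity), Real.rpow_neg (by positivity), Real.rpow_natCast,
    Real.rpow_natCast, ← mul_inv, ← div_eq_mul_inv, le_div_iff₀ (by positivity), mul_comm]
  set y := ((g⁻¹ : GL (Fin 2) K) : Matrix (Fin 2) (Fin 2) K) *ᵥ x with hy
  have h1 := hB' y
  rw [hy, mulVec_inv_mulVec, ← hy] at h1
  have h2 : 1 + ‖x‖ ≤ (1 + B) * (1 + ‖y‖) := by nlinarith [norm_nonneg y]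
  refine le_trans ?_ (mul_le_mul_of_nonneg_left (hC y) (by positivity))
  have h3 := pow_le_pow_left₀ (by positivity) h2 (M + M)
  rw [mul_pow] at h3
  rw [← mul_assoc]
  refine mul_le_mul_of_nonneg_right (le_trans ?_ h3) (norm_nonneg _)
  rw [pow_add]
  exact mul_le_mul
    (pow_le_pow_left₀ (by positivity) (add_le_add_right (norm_le_pi_norm x 0) 1) M)
    (pow_le_pow_left₀ (by positivity) (add_le_add_right (norm_le_pi_norm x 1) 1) M)
    (by positivity) (by positivity)

theorem exists_act_majorant_of_hasCompactSupport {φ : (Fin 2 → K) → ℂ} (hφ : Continuous φ)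
    (hφ' : HasCompactSupport φ) (g : GL (Fin 2) K) :
    ∃ (R : ℝ) (C : ℝ≥0∞), C ≠ ⊤ ∧ ∀ x, ‖act g φ x‖ₑ ≤ C *
      (Set.indicator {x | ‖x‖ ≤ R} 1 (x 0) * Set.indicator {x | ‖x‖ ≤ R} 1 (x 1)) := by
  obtain ⟨C, hC⟩ := hφ'.exists_bound_of_continuous hφ
  obtain ⟨r, hr⟩ := hφ'.isBounded.exists_norm_le
  obtain ⟨B, hB, hB'⟩ := exists_norm_mulVec_le_norm (g : Matrix (Fin 2) (Fin 2) K)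
  refine ⟨B * r, ENNReal.ofReal C, ENNReal.ofReal_ne_top, fun x => ?_⟩
  by_cases hx : act g φ x = 0
  · simp [hx]
  · have h1 := hr _ (subset_tsupport _ hx)
    have h2 := hB' (((g⁻¹ : GL (Fin 2) K) : Matrix (Fin 2) (Fin 2) K) *ᵥ x)
    rw [mulVec_inv_mulVec] at h2
    have h3 : ‖x‖ ≤ B * r := h2.trans (mul_le_mul_of_nonneg_left h1 hB)
    have h4 : ∀ i, x i ∈ {x : K | ‖x‖ ≤ B * r} := fun i => (norm_le_pi_norm x i).trans h3
    rw [Set.indicator_of_mem (h4 0), Set.indicator_of_mem (h4 1), Pi.one_apply, Pi.one_apply,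
      mul_one, mul_one, ← ofReal_norm]
    exact ENNReal.ofReal_le_ofReal (hC _)

end LocalDecay

section LocalComponents

variable {F : Type*} [Field F] [NumberField F]

theorem continuous_infIdele (v : InfinitePlace F) : Continuous (infIdele v) := by
  classical
  refine Continuous.units_map _ ?_
  have h1 : Continuous fun x : v.Completion =>
      (Pi.mulSingle v x : ∀ w : InfinitePlace F, w.Completion) := continuous_mulSingle v
  have h2 : Continuous fun _ : v.Completion => (1 : FiniteAdeleRing (𝓞 F) F) := continuous_const
  exact h1.prodMk h2

theorem continuous_finIdele (v : HeightOneSpectrum (𝓞 F)) : Continuous (finIdele v) := by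
  classical
  refine Continuous.units_map _ ?_
  have h1 : Continuous fun x : v.adicCompletion F => RestrictedProduct.mulSingle
        (fun w : HeightOneSpectrum (𝓞 F) => w.adicCompletionIntegers F) v x := by
    have hle : (Filter.cofinite : Filter (HeightOneSpectrum (𝓞 F))) ≤ Filter.principal {v}ᶜ :=
      Filter.le_principal_iff.2 (Set.finite_singleton v).compl_mem_cofinite
    let f : v.adicCompletion F → RestrictedProduct (fun w : HeightOneSpectrum (𝓞 F) =>
        w.adicCompletion F) (fun w => (w.adicCompletionIntegers F : Set (w.adicCompletion F)))
        (Filter.principal {v}ᶜ) := fun x => ⟨Pi.mulSingle v x, by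
      refine Filter.eventually_principal.2 fun w hw => ?_
      rw [Pi.mulSingle_eq_of_ne hw]
      exact one_mem _⟩
    have hf : Continuous f :=
      RestrictedProduct.isEmbedding_coe_of_principal.continuous_iff.2 (continuous_mulSingle v)
    exact (RestrictedProduct.continuous_inclusion hle).comp hf
  have h2 : Continuous fun _ : v.adicCompletion F => (1 : InfiniteAdeleRing F) := continuous_const
  exact h2.prodMk h1

theorem continuous_infComponent (ω : (Adele F)ˣ →ₜ* Circle) (v : InfinitePlace F) :
    Continuous (infComponent ω v) :=
  continuous_induced_dom.comp ((map_continuous ω).comp (continuous_infIdele v))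

theorem continuous_finComponent (ω : (Adele F)ˣ →ₜ* Circle) (v : HeightOneSpectrum (𝓞 F)) :
    Continuous (finComponent ω v) :=
  continuous_induced_dom.comp ((map_continuous ω).comp (continuous_finIdele v))

theorem integrable_whittakerIntegrand_completion [IsTotallyReal F] (ω : (Adele F)ˣ →ₜ* Circle)
    {s : ℂ} (hs : 1 < s.re) (v : InfinitePlace F) {φ : (Fin 2 → v.Completion) → ℂ}
    (hφ : ∃ f : 𝓢(Fin 2 → ℝ, ℂ), ∀ x, φ x = f fun i => realEmb v (x i))
    (g : GL (Fin 2) v.Completion) :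
    Continuous (whittakerIntegrand (‖·‖) (infChar v) (infComponent ω v) s φ g) ∧
    Integrable (whittakerIntegrand (‖·‖) (infChar v) (infComponent ω v) s φ g)
      ((infMeasure v).prod (infMulMeasure v)) := by
  obtain ⟨f, hf⟩ := hφ
  have hφc : Continuous φ := by
    rw [funext hf]
    exact f.continuous.comp (continuous_pi fun i =>
      (continuous_realEmb v).comp (continuous_apply i))
  have hc : Continuous (whittakerIntegrand (‖·‖) (infChar v) (infComponent ω v) s φ g) :=
    continuous_whittakerIntegrand Units.continuous_val.norm
      (fun t => norm_pos_iff.2 t.ne_zero) (continuous_infChar v) (continuous_infComponent ω v) hφc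
  refine ⟨hc, ?_⟩
  obtain ⟨M, hM⟩ := exists_nat_gt (2 * s.re)
  obtain ⟨C, hC, hC'⟩ := exists_act_majorant (M := M) (φ := φ) (by
    refine ⟨2 ^ (M + M) * ((Finset.Iic (M + M, 0)).sup fun m =>
      SchwartzMap.seminorm ℝ m.1 m.2) f, fun x => ?_⟩
    have h4 := SchwartzMap.one_add_le_sup_seminorm_apply (𝕜 := ℝ) (m := (M + M, 0)) le_rfl le_rfl f
      (fun i => realEmb v (x i))
    rw [norm_iteratedFDeriv_zero, ← hf] at h4
    have h5 : ‖fun i => realEmb v (x i)‖ = ‖x‖ := by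
      simp only [Pi.norm_def, nnnorm, norm_realEmb]
    rwa [h5] at h4) g
  refine integrable_whittakerIntegrand hc.aestronglyMeasurable
    (fun t => norm_pos_iff.2 t.ne_zero) (fun x => (norm_infChar v x).le)
    (fun t => (Circle.norm_coe _).le) hC
    (m := fun x => ENNReal.ofReal ((1 + ‖x‖) ^ (-(M : ℝ)))) hC' ?_
  rw [lintegral_prod_units_mul (infMeasure v) (infMulMeasure v) (distribHaarChar_completion v)
      (m := fun x => ENNReal.ofReal ((1 + ‖x‖) ^ (-(M : ℝ)))) (by fun_prop)]
  exact ENNReal.mul_ne_top (lintegral_infMeasure_ne_top v (by linarith))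
    (lintegral_infMulMeasure_ne_top v (by linarith) (by linarith))

theorem integrable_whittakerIntegrand_adicCompletion (ω : (Adele F)ˣ →ₜ* Circle)
    {s : ℂ} (hs : 1 < s.re) (v : HeightOneSpectrum (𝓞 F)) {φ : (Fin 2 → v.adicCompletion F) → ℂ}
    (hφ : IsLocallyConstant φ) (hφ' : HasCompactSupport φ) (g : GL (Fin 2) (v.adicCompletion F)) :
    Continuous (whittakerIntegrand (‖·‖) (finChar v) (finComponent ω v) s φ g) ∧
    Integrable (whittakerIntegrand (‖·‖) (finChar v) (finComponent ω v) s φ g)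
      ((finMeasure v).prod (finMulMeasure v)) := by
  have hc : Continuous (whittakerIntegrand (‖·‖) (finChar v) (finComponent ω v) s φ g) :=
    continuous_whittakerIntegrand Units.continuous_val.norm
      (fun t => norm_pos_iff.2 t.ne_zero) (continuous_finChar v) (continuous_finComponent ω v)
      hφ.continuous
  refine ⟨hc, ?_⟩
  obtain ⟨R, C, hC, hC'⟩ := exists_act_majorant_of_hasCompactSupport hφ.continuous hφ' g
  refine integrable_whittakerIntegrand hc.aestronglyMeasurable
    (fun t => norm_pos_iff.2 t.ne_zero) (fun x => (norm_finChar v x).le)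
    (fun t => (Circle.norm_coe _).le) hC hC' ?_
  rw [lintegral_prod_units_mul (finMeasure v) (finMulMeasure v) (distribHaarChar_adicCompletion v)
      (measurable_indicator_norm_le v R)]
  exact ENNReal.mul_ne_top (lintegral_finMeasure_ne_top v R)
    (lintegral_finMulMeasure_ne_top v R (by linarith))

end LocalComponents


section HeckeCharacters

theorem Circle.eq_one_of_forall_pow {z : Circle} (h : ∀ n : ℕ, ‖((z ^ n : Circle) : ℂ) - 1‖ < 1 / 2) :
    z = 1 := by
  have hgrow : ∀ n : ℕ, (3 / 2 : ℝ) ^ n * ‖(z : ℂ) - 1‖ ≤ ‖((z ^ 2 ^ n : Circle) : ℂ) - 1‖ := by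
    intro n
    induction n with
    | zero => simp
    | succ n ih =>
      have h1 := h (2 ^ n)
      set w : ℂ := ((z ^ 2 ^ n : Circle) : ℂ) with hw
      have h2 : ((z ^ 2 ^ (n + 1) : Circle) : ℂ) - 1 = (w - 1) * (w + 1) := by
        rw [pow_succ, pow_mul, Circle.coe_pow, ← hw]
        ring
      have h3 : 3 / 2 ≤ ‖w + 1‖ := by
        have : ‖(2 : ℂ)‖ ≤ ‖w + 1‖ + ‖w - 1‖ := by
          refine le_trans (le_of_eq ?_) (norm_sub_le _ _)
          congr 1
          ring
        rw [Complex.norm_two] at this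
        linarith
      rw [h2, norm_mul, pow_succ]
      nlinarith [norm_nonneg (w - 1)]
  by_contra hz
  have hpos : 0 < ‖(z : ℂ) - 1‖ := norm_pos_iff.2 (sub_ne_zero.2 fun h => hz (Circle.ext h))
  obtain ⟨n, hn⟩ := pow_unbounded_of_one_lt (‖(z : ℂ) - 1‖⁻¹) (show (1 : ℝ) < 3 / 2 by norm_num)
  have h1 := (hgrow n).trans_lt (h (2 ^ n))
  rw [inv_lt_iff_one_lt_mul₀ hpos] at hn
  linarith

variable {F : Type*} [Field F] [NumberField F]

theorem isCompact_unitIdeles : IsCompact {t : (Adele F)ˣ | (∀ v : InfinitePlace F,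
    infEval v (t : Adele F) = 1) ∧ ∀ v, ‖finEval v (t : Adele F)‖ = 1} := by
  refine IsCompact.of_isClosed_subset (isCompact_ideleBox (F := F) 1 (R := fun _ => 1) (by simp))
    ?_ ?_
  · have h1 : IsClosed {t : (Adele F)ˣ | ∀ v : InfinitePlace F, infEval v (t : Adele F) = 1} := by
      rw [Set.ofPred_forall]
      exact isClosed_iInter fun v => isClosed_eq
        ((continuous_infEval v).comp Units.continuous_val) continuous_const
    have h2 : IsClosed {t : (Adele F)ˣ | ∀ v, ‖finEval v (t : Adele F)‖ = 1} := by
      rw [Set.ofPred_forall]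
      exact isClosed_iInter fun v => isClosed_eq
        ((continuous_finEval v).comp Units.continuous_val).norm continuous_const
    exact h1.inter h2
  · rintro t ⟨h1, h2⟩
    refine ⟨⟨fun v => by simp [h1], fun v => (h2 v).le⟩, fun v => ?_, fun v => ?_⟩
    · simp [h1]
    · simp [h2]

/-- A Hecke character is unramified outside a finite set of places. -/
theorem exists_finset_eq_one (ω : (Adele F)ˣ →ₜ* Circle) :
    ∃ S₀ : Finset (HeightOneSpectrum (𝓞 F)), ∀ t : (Adele F)ˣ,
      (∀ v : InfinitePlace F, infEval v (t : Adele F) = 1) →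
      (∀ v, ‖finEval v (t : Adele F)‖ = 1) → (∀ v ∈ S₀, finEval v (t : Adele F) = 1) → ω t = 1 := by
  classical
  let T : Finset (HeightOneSpectrum (𝓞 F)) → Set (Adele F)ˣ := fun S =>
    {t | (∀ v ∈ S, finEval v (t : Adele F) = 1) ∧ 1 / 2 ≤ ‖(ω t : ℂ) - 1‖}
  have hωc : Continuous fun t => (ω t : ℂ) := continuous_induced_dom.comp (map_continuous ω)
  obtain ⟨S, hS⟩ := (isCompact_unitIdeles (F := F)).elim_directed_family_closed T
    (fun S => by
      have h1 : IsClosed {t : (Adele F)ˣ | ∀ v ∈ S, finEval v (t : Adele F) = 1} := by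
        simp only [Set.ofPred_forall]
        exact isClosed_iInter fun v => isClosed_iInter fun _ => isClosed_eq
          ((continuous_finEval v).comp Units.continuous_val) continuous_const
      exact h1.inter (isClosed_le continuous_const (hωc.sub continuous_const).norm))
    (by
      refine Set.eq_empty_of_forall_notMem fun t ⟨⟨h1, _⟩, h2⟩ => ?_
      rw [Set.mem_iInter] at h2
      have h3 : t = 1 := Units.ext (adele_ext (fun v => by rw [h1 v]; simp)
        fun v => by rw [(h2 {v}).1 v (Finset.mem_singleton_self v)]; simp)
      have h4 := (h2 ∅).2
      rw [h3] at h4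
      norm_num at h4)
    (fun S S' => ⟨S ∪ S', fun t ht => ⟨fun v hv => ht.1 v (Finset.mem_union_left _ hv), ht.2⟩,
      fun t ht => ⟨fun v hv => ht.1 v (Finset.mem_union_right _ hv), ht.2⟩⟩)
  refine ⟨S, fun t h1 h2 h3 => Circle.eq_one_of_forall_pow fun n => ?_⟩
  by_contra hn
  have : t ^ n ∈ {t : (Adele F)ˣ | (∀ v : InfinitePlace F, infEval v (t : Adele F) = 1) ∧
      ∀ v, ‖finEval v (t : Adele F)‖ = 1} ∩ T S := by
    refine ⟨⟨fun v => ?_, fun v => ?_⟩, fun v hv => ?_, ?_⟩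
    · rw [Units.val_pow_eq_pow_val, map_pow, h1, one_pow]
    · rw [Units.val_pow_eq_pow_val, map_pow, norm_pow, h2, one_pow]
    · rw [Units.val_pow_eq_pow_val, map_pow, h3 v hv, one_pow]
    · rw [map_pow]
      exact not_lt.1 hn
  rw [hS] at this
  exact this

theorem infEval_infIdele (v : InfinitePlace F) (x : v.Completionˣ) :
    infEval v (infIdele v x : Adele F) = x := by
  classical
  exact Pi.mulSingle_eq_same (M := fun w : InfinitePlace F => w.Completion) v (x : v.Completion)

theorem infEval_infIdele_of_ne {v w : InfinitePlace F} (h : w ≠ v) (x : v.Completionˣ) :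
    infEval w (infIdele v x : Adele F) = 1 := by
  classical
  exact Pi.mulSingle_eq_of_ne (M := fun w : InfinitePlace F => w.Completion) h (x : v.Completion)

theorem finEval_infIdele (v : InfinitePlace F) (w : HeightOneSpectrum (𝓞 F)) (x : v.Completionˣ) :
    finEval w (infIdele v x : Adele F) = 1 := rfl

theorem infEval_finIdele (w : InfinitePlace F) (v : HeightOneSpectrum (𝓞 F))
    (x : (v.adicCompletion F)ˣ) : infEval w (finIdele v x : Adele F) = 1 := rfl

theorem finEval_finIdele (v : HeightOneSpectrum (𝓞 F)) (x : (v.adicCompletion F)ˣ) :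
    finEval v (finIdele v x : Adele F) = x := by
  classical
  exact RestrictedProduct.mulSingle_eq_same
    (fun w : HeightOneSpectrum (𝓞 F) => w.adicCompletionIntegers F) v (x : v.adicCompletion F)

theorem finEval_finIdele_of_ne {v w : HeightOneSpectrum (𝓞 F)} (h : w ≠ v)
    (x : (v.adicCompletion F)ˣ) : finEval w (finIdele v x : Adele F) = 1 := by
  classical
  exact RestrictedProduct.mulSingle_eq_of_ne
    (fun w : HeightOneSpectrum (𝓞 F) => w.adicCompletionIntegers F) (x : v.adicCompletion F) h

/-- A Hecke character is the product of its local components. -/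
theorem exists_finset_eq_prod (ω : (Adele F)ˣ →ₜ* Circle) :
    ∃ S₀ : Finset (HeightOneSpectrum (𝓞 F)),
      (∀ v ∉ S₀, ∀ t : (v.adicCompletion F)ˣ, ‖(t : v.adicCompletion F)‖ = 1 →
        finComponent ω v t = 1) ∧
      ∀ S, S₀ ⊆ S → ∀ t : (Adele F)ˣ, (∀ v ∉ S, ‖finEval v (t : Adele F)‖ = 1) →
        (ω t : ℂ) = (∏ v, infComponent ω v (infUnit v t)) *
          ∏ v ∈ S, finComponent ω v (finUnit v t) := by
  classical
  obtain ⟨S₀, hS₀⟩ := exists_finset_eq_one ω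
  refine ⟨S₀, fun v hv t ht => ?_, fun S hS t ht => ?_⟩
  · rw [finComponent, hS₀ (finIdele v t) (fun w => infEval_finIdele w v t) (fun w => ?_)
      fun w hw => ?_, Circle.coe_one]
    · rcases eq_or_ne w v with rfl | h
      · rw [finEval_finIdele, ht]
      · rw [finEval_finIdele_of_ne h, norm_one]
    · exact finEval_finIdele_of_ne (fun h : w = v => hv (h ▸ hw)) t
  · let p : (Adele F)ˣ := (∏ v : InfinitePlace F, infIdele v (infUnit v t)) *
      ∏ v ∈ S, finIdele v (finUnit v t)
    have hinf : ∀ w, infEval w (p : Adele F) = infEval w (t : Adele F) := by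
      intro w
      simp only [p, Units.val_mul, Units.coe_prod, map_mul, map_prod, infEval_finIdele,
        Finset.prod_const_one, mul_one]
      rw [Finset.prod_eq_single w (fun v _ hv => infEval_infIdele_of_ne hv.symm _)
        (fun h => absurd (Finset.mem_univ w) h), infEval_infIdele, val_infUnit]
    have hfin : ∀ w ∈ S, finEval w (p : Adele F) = finEval w (t : Adele F) := by
      intro w hw
      simp only [p, Units.val_mul, Units.coe_prod, map_mul, map_prod, finEval_infIdele,
        Finset.prod_const_one, one_mul]
      rw [Finset.prod_eq_single w (fun v _ hv => finEval_finIdele_of_ne hv.symm _)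
        (fun h => absurd hw h), finEval_finIdele, val_finUnit]
    have hfin' : ∀ w ∉ S, finEval w (p : Adele F) = 1 := by
      intro w hw
      simp only [p, Units.val_mul, Units.coe_prod, map_mul, map_prod, finEval_infIdele,
        Finset.prod_const_one, one_mul]
      exact Finset.prod_eq_one fun v hv => finEval_finIdele_of_ne (fun h : w = v => hw (h ▸ hv)) _
    have h1 : ω (t * p⁻¹) = 1 := by
      refine hS₀ _ (fun v => ?_) (fun v => ?_) fun v hv => ?_
      · have : infEval v ((p⁻¹ : (Adele F)ˣ) : Adele F) = (infEval v (p : Adele F))⁻¹ :=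
          map_units_inv _ _
        rw [Units.val_mul, map_mul, this, hinf, mul_inv_cancel₀ (infEval_units_ne_zero v t)]
      · rw [Units.val_mul, map_mul, norm_mul, norm_finEval_units]
        by_cases hv : v ∈ S
        · rw [hfin v hv, mul_inv_cancel₀ (norm_ne_zero_iff.2 (finEval_units_ne_zero v t))]
        · rw [hfin' v hv, ht v hv, norm_one, inv_one, one_mul]
      · have : finEval v ((p⁻¹ : (Adele F)ˣ) : Adele F) = (finEval v (p : Adele F))⁻¹ :=
          map_units_inv _ _
        rw [Units.val_mul, map_mul, this, hfin v (hS hv),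
          mul_inv_cancel₀ (finEval_units_ne_zero v t)]
    rw [map_mul, map_inv, mul_inv_eq_one] at h1
    rw [h1]
    simp only [p, map_mul, map_prod, infComponent, finComponent]
    change Circle.coeHom (_ * _) = _
    rw [map_mul, map_prod, map_prod]
    rfl

end HeckeCharacters

section Unramified

variable {F : Type*} [Field F] [NumberField F] (v : HeightOneSpectrum (𝓞 F))

theorem norm_mulVec_apply_le_one {A : Matrix (Fin 2) (Fin 2) (v.adicCompletion F)}
    (hA : ∀ i j, ‖A i j‖ ≤ 1) {x : Fin 2 → v.adicCompletion F} (hx : ∀ i, ‖x i‖ ≤ 1) (i : Fin 2) :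
    ‖(A *ᵥ x) i‖ ≤ 1 := by
  have h : ∀ j, ‖A i j * x j‖ ≤ 1 := fun j => by
    rw [norm_mul]
    exact mul_le_one₀ (hA i j) (norm_nonneg _) (hx j)
  have : (A *ᵥ x) i = A i 0 * x 0 + A i 1 * x 1 := by simp [mulVec, dotProduct]
  rw [this]
  exact (IsUltrametricDist.norm_add_le_max _ _).trans (max_le (h 0) (h 1))

open scoped Classical in
theorem act_indicator {g : GL (Fin 2) (v.adicCompletion F)} (hg : ∀ i j, ‖g i j‖ ≤ 1)
    (hg' : ∀ i j, ‖((g⁻¹ : GL (Fin 2) (v.adicCompletion F)) :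
      Matrix (Fin 2) (Fin 2) (v.adicCompletion F)) i j‖ ≤ 1) (x : Fin 2 → v.adicCompletion F) :
    act g (Set.indicator {x | ∀ i, x i ∈ v.adicCompletionIntegers F} 1) x =
      if ‖x 0‖ ≤ 1 ∧ ‖x 1‖ ≤ 1 then 1 else 0 := by
  simp only [act_apply, Set.indicator_apply, Set.mem_ofPred_eq, ← norm_le_one_iff, Pi.one_apply]
  refine if_congr ?_ rfl rfl
  rw [← Fin.forall_fin_two (p := fun i => ‖x i‖ ≤ 1)]
  constructor
  · intro h
    have := norm_mulVec_apply_le_one v hg h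
    rwa [mulVec_inv_mulVec] at this
  · exact norm_mulVec_apply_le_one v hg'

theorem integral_finChar_ball {r : ℝ} (hr : ∃ x, ‖x‖ ≤ r ∧ finChar v x ≠ 1) :
    ∫ u, Set.indicator {u | ‖u‖ ≤ r} (finChar v) u ∂(finMeasure v) = 0 := by
  obtain ⟨x, hx, hx1⟩ := hr
  have hinv : ∀ u, Set.indicator {u | ‖u‖ ≤ r} (finChar v) (x + u) =
      finChar v x * Set.indicator {u | ‖u‖ ≤ r} (finChar v) u := by
    intro u
    have hiff : ‖x + u‖ ≤ r ↔ ‖u‖ ≤ r := by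
      constructor
      · intro h
        have := (norm_sub_le_max (x + u) x).trans (max_le h hx)
        rwa [add_sub_cancel_left] at this
      · exact fun h => (IsUltrametricDist.norm_add_le_max _ _).trans (max_le hx h)
    classical
    simp only [Set.indicator_apply, Set.mem_ofPred_eq, hiff]
    split_ifs
    · exact finChar_add v x u
    · rw [mul_zero]
  have h := integral_add_left_eq_self (μ := finMeasure v)
    (Set.indicator {u | ‖u‖ ≤ r} (finChar v)) x
  simp_rw [hinv] at h
  rw [integral_const_mul] at h
  have h3 : (1 - finChar v x) *
      ∫ u, Set.indicator {u | ‖u‖ ≤ r} (finChar v) u ∂(finMeasure v) = 0 := by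
    rw [sub_mul, one_mul, h, sub_self]
  exact (mul_eq_zero.1 h3).resolve_left (sub_ne_zero.2 hx1.symm)

theorem integral_whittakerIntegrand_unramified {ω : (Adele F)ˣ →ₜ* Circle} {s : ℂ}
    {g : GL (Fin 2) (v.adicCompletion F)} (hg : ∀ i j, ‖g i j‖ ≤ 1)
    (hg' : ∀ i j, ‖((g⁻¹ : GL (Fin 2) (v.adicCompletion F)) :
      Matrix (Fin 2) (Fin 2) (v.adicCompletion F)) i j‖ ≤ 1)
    (hω : ∀ t : (v.adicCompletion F)ˣ, ‖(t : v.adicCompletion F)‖ = 1 → finComponent ω v t = 1)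
    (hψ : ∃ x : v.adicCompletion F, ‖x‖ ≤ residueCard v ∧ finChar v x ≠ 1)
    (hvol : integersVolume v = 1)
    (hint : Integrable (whittakerIntegrand (‖·‖) (finChar v) (finComponent ω v) s
      (Set.indicator {x | ∀ i, x i ∈ v.adicCompletionIntegers F} 1) g)
      ((finMeasure v).prod (finMulMeasure v))) :
    ∫ p, whittakerIntegrand (‖·‖) (finChar v) (finComponent ω v) s
      (Set.indicator {x | ∀ i, x i ∈ v.adicCompletionIntegers F} 1) g p
      ∂((finMeasure v).prod (finMulMeasure v)) = 1 := by
  classical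
  have hq := one_lt_residueCard v
  rw [integral_prod_symm _ hint]
  have hinner : ∀ t : (v.adicCompletion F)ˣ,
      ∫ u, whittakerIntegrand (‖·‖) (finChar v) (finComponent ω v) s
        (Set.indicator {x | ∀ i, x i ∈ v.adicCompletionIntegers F} 1) g (u, t) ∂(finMeasure v) =
      Set.indicator {t : (v.adicCompletion F)ˣ | ‖(t : v.adicCompletion F)‖ = 1} 1 t := by
    intro t
    have ht0 : 0 < ‖(t : v.adicCompletion F)‖ := norm_pos_iff.2 t.ne_zero
    have hform : ∀ u, whittakerIntegrand (‖·‖) (finChar v) (finComponent ω v) s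
        (Set.indicator {x | ∀ i, x i ∈ v.adicCompletionIntegers F} 1) g (u, t) =
        (finComponent ω v t * ((‖(t : v.adicCompletion F)‖ : ℝ) : ℂ) ^ (2 * s)) *
          if ‖(t : v.adicCompletion F)‖ ≤ 1 then
            Set.indicator {u | ‖u‖ ≤ ‖(t : v.adicCompletion F)‖⁻¹} (finChar v) u else 0 := by
      intro u
      rw [whittakerIntegrand, act_indicator v hg hg', mul_assoc]
      congr 1
      have h1 : ‖(t : v.adicCompletion F) * u‖ ≤ 1 ↔ ‖u‖ ≤ ‖(t : v.adicCompletion F)‖⁻¹ := by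
        rw [norm_mul, ← mul_one ‖(t : v.adicCompletion F)‖⁻¹, le_inv_mul_iff₀ ht0]
      simp only [Set.indicator_apply, Set.mem_ofPred_eq, Pi.smul_apply, cons_val_zero, cons_val_one,
        smul_eq_mul, mul_one, h1]
      by_cases ha : ‖u‖ ≤ ‖(t : v.adicCompletion F)‖⁻¹ <;>
        by_cases hb : ‖(t : v.adicCompletion F)‖ ≤ 1 <;> simp [ha, hb]
    simp_rw [hform]
    rw [integral_const_mul]
    rcases lt_trichotomy ‖(t : v.adicCompletion F)‖ 1 with h | h | h
    · simp only [if_pos h.le]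
      rw [integral_finChar_ball, mul_zero, Set.indicator_of_notMem]
      · exact h.ne
      · obtain ⟨x, hx, hx1⟩ := hψ
        refine ⟨x, hx.trans ?_, hx1⟩
        obtain ⟨n, hn⟩ := exists_norm_eq_zpow v t.ne_zero
        rw [hn] at h ⊢
        have hn0 : n < 0 := (zpow_lt_one_iff_right₀ hq).1 h
        rw [← _root_.zpow_neg]
        calc residueCard v = residueCard v ^ (1 : ℤ) := (zpow_one _).symm
          _ ≤ _ := zpow_le_zpow_right₀ hq.le (by omega)
    · have h1 : ∀ u, (if ‖(t : v.adicCompletion F)‖ ≤ 1 then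
            Set.indicator {u | ‖u‖ ≤ ‖(t : v.adicCompletion F)‖⁻¹} (finChar v) u else 0) =
          Set.indicator {u | ‖u‖ ≤ 1} (1 : v.adicCompletion F → ℂ) u := by
        intro u
        rw [if_pos h.le, h, inv_one]
        simp only [Set.indicator_apply, Set.mem_ofPred_eq, Pi.one_apply]
        split_ifs with hu
        · exact finChar_eq_one v hu
        · rfl
      simp_rw [h1]
      rw [integral_indicator (isOpen_norm_le_one v).measurableSet]
      simp only [Pi.one_apply]
      rw [setIntegral_const, Measure.real,
        (isAddHaarMeasure_finMeasure_and v).2, hvol, hω t h, h, Set.indicator_of_mem (by exact h)]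
      simp
    · simp only [if_neg (not_le.2 h), integral_zero, mul_zero]
      rw [Set.indicator_of_notMem]
      exact h.ne'
  simp_rw [hinner]
  rw [integral_indicator (isOpen_units_norm_eq_one v).measurableSet]
  simp only [Pi.one_apply]
  rw [setIntegral_const, Measure.real,
    (isHaarMeasure_finMulMeasure_and v).2, hvol]
  simp

end Unramified


section EulerProduct

theorem ofReal_prod_cpow {ι : Type*} (S : Finset ι) {f : ι → ℝ} (hf : ∀ i ∈ S, 0 ≤ f i) (s : ℂ) :
    ((∏ i ∈ S, f i : ℝ) : ℂ) ^ s = ∏ i ∈ S, ((f i : ℝ) : ℂ) ^ s := by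
  classical
  induction S using Finset.induction_on with
  | empty => simp
  | insert a S ha ih =>
    have h1 : ∀ i ∈ S, 0 ≤ f i := fun i hi => hf i (Finset.mem_insert_of_mem hi)
    rw [Finset.prod_insert ha, Finset.prod_insert ha, Complex.ofReal_mul,
      Complex.mul_cpow_ofReal_nonneg (hf a (Finset.mem_insert_self a S)) (Finset.prod_nonneg h1),
      ih h1]

variable {F : Type*} [Field F] [NumberField F]

theorem eventually_norm_le_one (g : GL (Fin 2) (Adele F)) :
    ∀ᶠ v : HeightOneSpectrum (𝓞 F) in Filter.cofinite,
      ∀ i j, ‖(GeneralLinearGroup.map (finEval v) g : GL (Fin 2) (v.adicCompletion F)) i j‖ ≤ 1 :=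
  Filter.eventually_all.2 fun i => Filter.eventually_all.2 fun j => eventually_finEval_le_one (g i j)

theorem map_mulVec_act {R K : Type*} [CommRing R] [CommRing K] (e : R →+* K) (g : GL (Fin 2) R)
    (p : R × Rˣ) :
    (fun i => e ((((g⁻¹ : GL (Fin 2) R) : Matrix (Fin 2) (Fin 2) R) *ᵥ ((p.2 : R) • ![p.1, 1])) i)) =
      (((GeneralLinearGroup.map e g)⁻¹ : GL (Fin 2) K) : Matrix (Fin 2) (Fin 2) K) *ᵥ
        (((Units.map e.toMonoidHom p.2 : Kˣ) : K) • ![e p.1, 1]) := by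
  rw [← map_inv]
  ext i
  have h1 : ∀ j, ((GeneralLinearGroup.map e g⁻¹ : GL (Fin 2) K) : Matrix (Fin 2) (Fin 2) K) i j =
      e (((g⁻¹ : GL (Fin 2) R) : Matrix (Fin 2) (Fin 2) R) i j) := fun j => rfl
  simp only [mulVec, dotProduct, h1, map_sum, map_mul]
  refine Finset.sum_congr rfl fun j _ => ?_
  fin_cases j <;> simp

variable [IsTotallyReal F]

theorem adeleNorm_cpow_eq_prod {t : Adele F} {S : Finset (HeightOneSpectrum (𝓞 F))}
    (h : ∀ v ∉ S, ‖finEval v t‖ = 1) (s : ℂ) :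
    ((adeleNorm t : ℝ) : ℂ) ^ s = (∏ v : InfinitePlace F, ((‖infEval v t‖ : ℝ) : ℂ) ^ s) *
      ∏ v ∈ S, ((‖finEval v t‖ : ℝ) : ℂ) ^ s := by
  rw [adeleNorm_eq_prod h, Complex.ofReal_mul, Complex.mul_cpow_ofReal_nonneg (by positivity)
    (by positivity), ofReal_prod_cpow _ fun v _ => by positivity,
    ofReal_prod_cpow _ fun v _ => by positivity]
  simp_rw [IsTotallyReal.mult_eq, pow_one]

/-- The Whittaker integrand of a pure tensor is a product of local integrands. -/
theorem IsPureTensor.whittakerIntegrand_eq_prod {φ : (Fin 2 → Adele F) → ℂ}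
    {φinf : ∀ v : InfinitePlace F, (Fin 2 → v.Completion) → ℂ}
    {φfin : ∀ v : HeightOneSpectrum (𝓞 F), (Fin 2 → v.adicCompletion F) → ℂ}
    (hφ : IsPureTensor φ φinf φfin) (ω : (Adele F)ˣ →ₜ* Circle) (s : ℂ)
    (g : GL (Fin 2) (Adele F)) {S : Finset (HeightOneSpectrum (𝓞 F))}
    (hS : ∀ v ∉ S, φfin v = Set.indicator {x | ∀ i, x i ∈ v.adicCompletionIntegers F} 1)
    (hg : ∀ v ∉ S, ∀ i j, ‖(GeneralLinearGroup.map (finEval v) g :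
      GL (Fin 2) (v.adicCompletion F)) i j‖ ≤ 1)
    (hg' : ∀ v ∉ S, ∀ i j, ‖(GeneralLinearGroup.map (finEval v) g⁻¹ :
      GL (Fin 2) (v.adicCompletion F)) i j‖ ≤ 1)
    {p : Adele F × (Adele F)ˣ}
    (hω : (ω p.2 : ℂ) = (∏ v, infComponent ω v (infUnit v p.2)) *
      ∏ v ∈ S, finComponent ω v (finUnit v p.2))
    (hp1 : ∀ v ∉ S, ‖finEval v p.1‖ ≤ 1) (hp2 : ∀ v ∉ S, ‖finEval v (p.2 : Adele F)‖ = 1) :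
    whittakerIntegrand adeleNorm adeleChar (fun t => (ω t : ℂ)) s φ g p =
      (∏ v, whittakerIntegrand (‖·‖) (infChar v) (infComponent ω v) s (φinf v)
        (GeneralLinearGroup.map (infEval v) g) (infEval v p.1, infUnit v p.2)) *
      ∏ v ∈ S, whittakerIntegrand (‖·‖) (finChar v) (finComponent ω v) s (φfin v)
        (GeneralLinearGroup.map (finEval v) g) (finEval v p.1, finUnit v p.2) := by
  classical
  have hact : act g φ ((p.2 : Adele F) • ![p.1, 1]) =
      (∏ v, act (GeneralLinearGroup.map (infEval v) g) (φinf v)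
        ((infUnit v p.2 : v.Completion) • ![infEval v p.1, 1])) *
      ∏ v ∈ S, act (GeneralLinearGroup.map (finEval v) g) (φfin v)
        ((finUnit v p.2 : v.adicCompletion F) • ![finEval v p.1, 1]) := by
    rw [act_apply, hφ.eq_prod]
    simp only [map_mulVec_act, ← act_apply]
    congr 1
    refine finprod_eq_prod_of_mulSupport_subset _ fun v hv => ?_
    by_contra hvS
    refine hv ?_
    dsimp only
    have hv' : v ∉ S := hvS
    have h1 : ∀ i j, ‖(((GeneralLinearGroup.map (finEval v) g)⁻¹ : GL (Fin 2) (v.adicCompletion F)) :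
        Matrix (Fin 2) (Fin 2) (v.adicCompletion F)) i j‖ ≤ 1 := by
      rw [← map_inv]; exact hg' v hv'
    have h2 : ‖finEval v (p.2 : Adele F)‖ = 1 := hp2 v hv'
    rw [hS v hv', act_indicator v (hg v hv') h1, if_pos]
    constructor
    · change ‖finEval v (p.2 : Adele F) * finEval v p.1‖ ≤ 1
      rw [norm_mul, h2, one_mul]
      exact hp1 v hv'
    · change ‖finEval v (p.2 : Adele F) * 1‖ ≤ 1
      rw [mul_one, h2]
  have hchar : adeleChar p.1 = (∏ v, infChar v (infEval v p.1)) *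
      ∏ v ∈ S, finChar v (finEval v p.1) := by
    rw [adeleChar]
    congr 1
    refine finprod_eq_prod_of_mulSupport_subset _ fun v hv => ?_
    by_contra hvS
    exact hv (finChar_eq_one v (hp1 v hvS))
  unfold whittakerIntegrand
  dsimp only
  rw [hact, hchar, hω, adeleNorm_cpow_eq_prod hp2]
  simp only [Finset.prod_mul_distrib, val_infUnit, val_finUnit]
  ring

/-- The global Whittaker integral of a pure tensor is the product of the local ones. -/
theorem IsPureTensor.whittakerIntegral_eq_prod {φ : (Fin 2 → Adele F) → ℂ}
    {φinf : ∀ v : InfinitePlace F, (Fin 2 → v.Completion) → ℂ}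
    {φfin : ∀ v : HeightOneSpectrum (𝓞 F), (Fin 2 → v.adicCompletion F) → ℂ}
    (hφ : IsPureTensor φ φinf φfin) (hφ' : IsRapidlyDecreasing φ) (ω : (Adele F)ˣ →ₜ* Circle)
    {s : ℂ} (hs : 1 < s.re) (g : GL (Fin 2) (Adele F)) :
    (∀ᶠ v : HeightOneSpectrum (𝓞 F) in Filter.cofinite,
      whittakerIntegral (‖·‖) (finChar v) (finComponent ω v) (finMeasure v) (finMulMeasure v) s
        (φfin v) (GeneralLinearGroup.map (finEval v) g) = 1) ∧
    whittakerIntegral adeleNorm adeleChar (fun t => (ω t : ℂ)) (adeleMeasure F) (ideleMeasure F)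
        s φ g =
      (∏ v : InfinitePlace F, whittakerIntegral (‖·‖) (infChar v) (infComponent ω v)
        (infMeasure v) (infMulMeasure v) s (φinf v) (GeneralLinearGroup.map (infEval v) g)) *
      ∏ᶠ v : HeightOneSpectrum (𝓞 F), whittakerIntegral (‖·‖) (finChar v) (finComponent ω v)
        (finMeasure v) (finMulMeasure v) s (φfin v) (GeneralLinearGroup.map (finEval v) g) := by
  classical
  obtain ⟨S₀, hS₀, hS₀'⟩ := exists_finset_eq_prod ω
  have hev := ((hφ.unramified.and (eventually_norm_le_one g)).and
    ((eventually_norm_le_one g⁻¹).and (Filter.eventually_cofinite.2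
      (finite_integersVolume_ne_one (F := F))))).and
    ((eventually_exists_finChar_ne_one (F := F)).and S₀.finite_toSet.compl_mem_cofinite)
  let S₁ := (Filter.eventually_cofinite.1 hev).toFinset
  have hS₁ := fun (v : HeightOneSpectrum (𝓞 F)) (hv : v ∉ S₁) => not_not.1 fun h =>
    hv ((Set.Finite.mem_toFinset (Filter.eventually_cofinite.1 hev)).2 h)
  have hS₀S₁ : S₀ ⊆ S₁ := fun v hv => by
    by_contra h
    exact (hS₁ v h).2.2 hv
  have hgdet : ∀ v : HeightOneSpectrum (𝓞 F),
      ((GeneralLinearGroup.map (finEval v) g : GL (Fin 2) (v.adicCompletion F)) :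
        Matrix (Fin 2) (Fin 2) (v.adicCompletion F)).det =
      finEval v (g : Matrix (Fin 2) (Fin 2) (Adele F)).det := fun v =>
    (RingHom.map_det (finEval v) _).symm
  have hgdet' : ∀ v : InfinitePlace F,
      ((GeneralLinearGroup.map (infEval v) g : GL (Fin 2) v.Completion) :
        Matrix (Fin 2) (Fin 2) v.Completion).det =
      infEval v (g : Matrix (Fin 2) (Fin 2) (Adele F)).det := fun v =>
    (RingHom.map_det (infEval v) _).symm
  have hdet : ∀ v ∉ S₁, ‖finEval v (g : Matrix (Fin 2) (Fin 2) (Adele F)).det‖ = 1 := by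
    have hle : ∀ (h : GL (Fin 2) (Adele F)) (v : HeightOneSpectrum (𝓞 F)),
        (∀ i j, ‖finEval v (h i j)‖ ≤ 1) →
          ‖finEval v (h : Matrix (Fin 2) (Fin 2) (Adele F)).det‖ ≤ 1 := by
      intro h v hv
      rw [det_fin_two, map_sub, map_mul, map_mul]
      refine (norm_sub_le_max _ _).trans (max_le ?_ ?_) <;> rw [norm_mul] <;>
        exact mul_le_one₀ (hv _ _) (norm_nonneg _) (hv _ _)
    intro v hv
    have h1 := hle g v (hS₁ v hv).1.1.2
    have h2 := hle g⁻¹ v (hS₁ v hv).1.2.1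
    have h3 : ‖finEval v (g : Matrix (Fin 2) (Fin 2) (Adele F)).det‖ *
        ‖finEval v ((g⁻¹ : GL (Fin 2) (Adele F)) : Matrix (Fin 2) (Fin 2) (Adele F)).det‖ = 1 := by
      rw [← norm_mul, ← map_mul, ← det_mul, ← Units.val_mul, mul_inv_cancel, Units.val_one, det_one,
        map_one, norm_one]
    nlinarith [norm_nonneg (finEval v (g : Matrix (Fin 2) (Fin 2) (Adele F)).det)]
  have hunr : ∀ v ∉ S₁, ∫ p, whittakerIntegrand (‖·‖) (finChar v) (finComponent ω v) s (φfin v)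
      (GeneralLinearGroup.map (finEval v) g) p ∂((finMeasure v).prod (finMulMeasure v)) = 1 := by
    intro v hv
    obtain ⟨⟨⟨h1, h2⟩, h3, h4⟩, h5, h6⟩ := hS₁ v hv
    have hint := (integrable_whittakerIntegrand_adicCompletion ω hs v (hφ.locallyConstant v)
      (hφ.compactSupport v) (GeneralLinearGroup.map (finEval v) g)).2
    rw [h1] at hint ⊢
    refine integral_whittakerIntegrand_unramified v h2 ?_ (hS₀ v h6) h5 h4 hint
    rw [← map_inv]
    exact h3
  have hlocal : ∀ v ∉ S₁, whittakerIntegral (‖·‖) (finChar v) (finComponent ω v) (finMeasure v)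
      (finMulMeasure v) s (φfin v) (GeneralLinearGroup.map (finEval v) g) = 1 := by
    intro v hv
    rw [whittakerIntegral, hunr v hv, hgdet, hdet v hv, Complex.ofReal_one, Complex.one_cpow,
      one_mul]
  refine ⟨Filter.eventually_cofinite.2 (S₁.finite_toSet.subset fun v hv => ?_), ?_⟩
  · by_contra h
    exact hv (hlocal v h)
  have hglobal := ((isRestrictedProductMeasure_adele F).prod
    (isRestrictedProductMeasure_idele F)).integral_eq_prod (S₁ := S₁)
    (Φ := whittakerIntegrand adeleNorm adeleChar (fun t => (ω t : ℂ)) s φ g)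
    (f := fun v => whittakerIntegrand (‖·‖) (infChar v) (infComponent ω v) s (φinf v)
      (GeneralLinearGroup.map (infEval v) g))
    (k := fun v => whittakerIntegrand (‖·‖) (finChar v) (finComponent ω v) s (φfin v)
      (GeneralLinearGroup.map (finEval v) g))
    (fun v => (integrable_whittakerIntegrand_completion ω hs v (hφ.schwartz v) _).1.measurable)
    (fun v => (integrable_whittakerIntegrand_adicCompletion ω hs v (hφ.locallyConstant v)
      (hφ.compactSupport v) _).1.measurable)
    (fun S hS p hp => hφ.whittakerIntegrand_eq_prod ω s g
      (fun v hv => (hS₁ v fun h => hv (hS h)).1.1.1) (fun v hv => (hS₁ v fun h => hv (hS h)).1.1.2)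
      (fun v hv => (hS₁ v fun h => hv (hS h)).1.2.1)
      (hS₀' S (hS₀S₁.trans hS) p.2 fun v hv => (hp v hv).2)
      (fun v hv => (hp v hv).1) fun v hv => (hp v hv).2)
    hunr (hφ'.integrable_whittakerIntegrand ω hs continuous_adeleChar norm_adeleChar g)
  rw [whittakerIntegral, hglobal, adeleNorm_cpow_eq_prod hdet,
    finprod_eq_prod_of_mulSupport_subset (s := S₁) _ fun v hv => by
      by_contra h; exact hv (hunr v h),
    finprod_eq_prod_of_mulSupport_subset (s := S₁) _ fun v hv => by
      by_contra h; exact hv (hlocal v h)]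
  simp only [whittakerIntegral, hgdet, hgdet', Finset.prod_mul_distrib]
  ring

end EulerProduct

end EisensteinWhittaker

theorem mainTheorem7 (F : Type*) [Field F] [NumberField F] [IsTotallyReal F]
    (ω : (Adele F)ˣ →ₜ* Circle) (hω : ∀ t ∈ principalIdeles F, ω t = 1)
    (s : ℂ) (hs : 1 < s.re)
    (φ : (Fin 2 → Adele F) → ℂ) (hφ : φ ∈ SchwartzBruhat F) :
    (∀ (ξ : Fˣ) (g : GL (Fin 2) (Adele F)),
      fourierCoeff ω s φ (ξ : F) g =
        fourierCoeff ω s φ 1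
          (diagOne (Units.map (algebraMap F (Adele F)).toMonoidHom ξ) * g)) ∧
    (∀ g : GL (Fin 2) (Adele F),
      Integrable (whittakerIntegrand adeleNorm adeleChar (fun t => (ω t : ℂ)) s φ g)
        ((adeleMeasure F).prod (ideleMeasure F)) ∧
      fourierCoeff ω s φ 1 g =
        whittakerIntegral adeleNorm adeleChar (fun t => (ω t : ℂ))
          (adeleMeasure F) (ideleMeasure F) s φ g) ∧
    (∀ (φinf : ∀ v : InfinitePlace F, (Fin 2 → v.Completion) → ℂ)
      (φfin : ∀ v : HeightOneSpectrum (𝓞 F), (Fin 2 → v.adicCompletion F) → ℂ),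
      IsPureTensor φ φinf φfin → ∀ g : GL (Fin 2) (Adele F),
        (∀ v : InfinitePlace F,
          Integrable
            (whittakerIntegrand (‖·‖) (infChar v) (infComponent ω v) s (φinf v)
              (GeneralLinearGroup.map (infEval v) g))
            ((infMeasure v).prod (infMulMeasure v))) ∧
        (∀ v : HeightOneSpectrum (𝓞 F),
          Integrable
            (whittakerIntegrand (‖·‖) (finChar v) (finComponent ω v) s (φfin v)
              (GeneralLinearGroup.map (finEval v) g))
            ((finMeasure v).prod (finMulMeasure v))) ∧
        (∀ᶠ v : HeightOneSpectrum (𝓞 F) in Filter.cofinite,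
          whittakerIntegral (‖·‖) (finChar v) (finComponent ω v)
            (finMeasure v) (finMulMeasure v) s (φfin v)
            (GeneralLinearGroup.map (finEval v) g) = 1) ∧
        fourierCoeff ω s φ 1 g =
          (∏ v : InfinitePlace F,
            whittakerIntegral (‖·‖) (infChar v) (infComponent ω v)
              (infMeasure v) (infMulMeasure v) s (φinf v)
              (GeneralLinearGroup.map (infEval v) g)) *
          ∏ᶠ v : HeightOneSpectrum (𝓞 F),
            whittakerIntegral (‖·‖) (finChar v) (finComponent ω v)
              (finMeasure v) (finMulMeasure v) s (φfin v)
              (GeneralLinearGroup.map (finEval v) g)) := by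
  have hφ' := isRapidlyDecreasing_of_mem_schwartzBruhat hφ
  refine ⟨fun ξ g => fourierCoeff_eq_fourierCoeff_one hω hs hφ' ξ g, fun g =>
    ⟨hφ'.integrable_whittakerIntegrand ω hs continuous_adeleChar norm_adeleChar g,
      fourierCoeff_one_eq_whittakerIntegral hω hs hφ' g⟩, fun φinf φfin h g => ?_⟩
  obtain ⟨h1, h2⟩ := h.whittakerIntegral_eq_prod hφ' ω hs g
  exact ⟨fun v => (integrable_whittakerIntegrand_completion ω hs v (h.schwartz v) _).2,
    fun v => (integrable_whittakerIntegrand_adicCompletion ω hs v (h.locallyConstant v)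
      (h.compactSupport v) _).2,
    h1, (fourierCoeff_one_eq_whittakerIntegral hω hs hφ' g).trans h2⟩
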